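/- Let $0<q<1$, $\lambda=q-q^{-1}$, let $\mu_0$ be a finite positive Borel measure on $(q,1]$, and let $\mu$ be the Borel measure on $\mathbb R^+=(0,\infty)$ with $\mu(q^k M)=q^k\mu_0(M)$ for all $k\in\mathbb Z$ and Borel sets $M\subseteq(q,1]$. **Algebras.** $\mathcal U_q(\mathrm{su}_{1,1})$ is the Hopf $*$-algebra with generators $E,F,K,K^{-1}$ and relations $KK^{-1}=K^{-1}K=1$, $KE=qEK$, $KF=q^{-1}FK$, $EF-FE=\lambda^{-1}(K^2-K^{-2})$, with involution $E^*=-F$, $K^*=K$, counit $\varepsilon(E)=\varepsilon(F)=0$, $\varepsilon(K)=1$, and antipode $S(E)=-qE$, $S(F)=-q^{-1}F$, $S(K)=K^{-1}$. $\mathcal O(\mathrm{SU}_q(1,1))$ is the $*$-algebra with generators $a,b,c,d$, relations $ab=qba$, $ac=qca$, $bd=qdb$, $cd=qdc$, $bc=cb$, $ad-qbc=da-q^{-1}bc=1$, and involution $a^*=d$, $b^*=qc$. The cross product $*$-algebra $\mathcal U_q(\mathrm{su}_{1,1})\ltimes\mathcal O(\mathrm{SU}_q(1,1))$ is generated by these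 two $*$-algebras with the cross relations $$aK=q^{-1/2}Ka,\quad bK=q^{-1/2}Kb,\quad cK=q^{1/2}Kc,\quad dK=q^{1/2}Kd,$$ $$aE=q^{-1/2}Ea,\quad bE=q^{-1/2}Eb,\quad cE=q^{1/2}Ec+K^{-1}a,\quad dE=q^{1/2}Ed+K^{-1}b,$$ $$aF=q^{-1/2}Fa+K^{-1}c,\quad bF=q^{-1/2}Fb+K^{-1}d,\quad cF=q^{1/2}Fc,\quad dF=q^{1/2}Fd.$$ **Functions and action.** $\mathcal F(\mathrm{SU}_q(1,1))$ is the $*$-algebra generated by the Laurent polynomials in commuting variables $u,v$ and by the $*$-algebra of locally bounded Borel functions $f(r)$ on $\mathbb R^+$, with $u^nv^kf(r)=f(q^kr)u^nv^k$ and $(u^nv^kf(r))^*=\bar f(r)v^{-k}u^{-n}$. It carries the right $\mathcal U_q(\mathrm{su}_{1,1})$-action $$u^nv^kf(r)\triangleleft E=q^{\frac{n+k+1}2}\lambda^{-1}u^{n-1}v^{k+1}\big(f(r)\sqrt{1+q^{-2k}r^2}-q^{-n}f(q^{-1}r)\sqrt{1+r^2}\big)r^{-1},$$ $$u^nv^kf(r)\triangleleft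 F=q^{\frac{k-n-3}2}\lambda^{-1}u^{n+1}v^{k-1}\big(f(qr)\sqrt{1+q^2r^2}-q^nf(r)\sqrt{1+q^{-2k+2}r^2}\big)r^{-1},$$ $$u^nv^kf(r)\triangleleft K=q^{\frac{n-k}2}u^nv^kf(r).$$ The algebra $\mathcal O(\mathrm{SU}_q(1,1))$ acts on $\mathcal F(\mathrm{SU}_q(1,1))$ by left multiplication via $a=v\sqrt{1+r^2}$, $b=qu^{-1}r$, $c=ur$, $d=a^*=v^{-1}\sqrt{1+q^2r^2}$. $\mathcal F_0(\mathrm{SU}_q(1,1))$ is the $*$-subalgebra generated by the elements $p(u,v)f(r)$ with $p$ a Laurent polynomial and $f$ of compact support in $\mathbb R^+$. On it let $h_{\mu_0}$ be the linear functional $$h_{\mu_0}(p(u,v)f(r))=\int_{\mathbb T^2}p(u,v)\,du\,dv\int_0^\infty f(r)\,r\,d\mu(r),$$ where $du\,dv$ is the normalized Haar measure of the torus. **Claim.** (i) $h_{\mu_0}$ is $\mathcal U_q(\mathrm{su}_{1,1})$-invariant, i.e. $h_{\mu_0}(x\triangleleft f)=\varepsilon(f)h_{\mu_0}(x)$ for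 $x\in\mathcal F_0(\mathrm{SU}_q(1,1))$, $f\in\mathcal U_q(\mathrm{su}_{1,1})$, and positive, i.e. $h_{\mu_0}(x^*x)\ge0$. (ii) Let $\mathcal N=\{x\in \mathcal F_0(\mathrm{SU}_q(1,1)): h_{\mu_0}(x^*x)=0\}$ and let $\tilde x$ be the class of $x$ in $\mathcal F_0(\mathrm{SU}_q(1,1))/\mathcal N$, with scalar product $\langle\tilde x,\tilde y\rangle=h_{\mu_0}(y^*x)$. Then $$\pi_h(fa)\tilde x=\big((ax)\triangleleft S^{-1}(f)\big)^{\sim}\qquad(f\in\mathcal U_q(\mathrm{su}_{1,1}),\ a\in\mathcal O(\mathrm{SU}_q(1,1)),\ x\in\mathcal F_0(\mathrm{SU}_q(1,1)))$$ defines a $*$-representation $\pi_h$ (the Heisenberg representation) of $\mathcal U_q(\mathrm{su}_{1,1})\ltimes\mathcal O(\mathrm{SU}_q(1,1))$ on the dense domain $\mathcal F_0(\mathrm{SU}_q(1,1))/\mathcal N$ of its Hilbert space completion. (iii) $\pi_h$ is unitarily equivalent to the following $*$-representation with $\mathcal K=L^2((q,1],r\,d\mu_0)$, $A=Q$, $B=qQ^{-1}$,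 $H=I$, $\epsilon=1$, where $Q$ is the multiplication operator $(Q\zeta)(r)=r\zeta(r)$ on $\mathcal K$. For commuting self-adjoint operators $A,B,H$ on a Hilbert space $\mathcal K$ such that $\sigma(A)\subseteq[q,1]$, $\sigma(B)\subseteq[q,1]$, $\sigma(H)\subseteq[q^{1/2},1]$ and $q$, $1$, $q^{1/2}$ is not an eigenvalue of $A$, $B$, $H$, respectively, and for $\epsilon\in\{1,-1\}$, it acts on $\bigoplus_{n,k,l\in\mathbb Z}\mathcal K$ (where $\eta_{nkl}$ has $\eta\in\mathcal K$ in position $(n,k,l)$ and zero elsewhere) by $$a\eta_{nkl}=\alpha_n(A)\eta_{n-1,k,l},\quad d\eta_{nkl}=\alpha_{n+1}(A)\eta_{n+1,k,l},\quad b\eta_{nkl}=q^{n+1}A\eta_{n,k,l+1},\quad c\eta_{nkl}=q^nA\eta_{n,k,l-1},$$ $$F\eta_{nkl}=\lambda^{-1}q^{(-n-2k+l-1)/2}\alpha_{k+1}(B)\epsilon H\eta_{n,k+1,l}+\lambda^{-1}q^{(n+2k-l+1)/2}\epsilon H^{-1}\beta_{n+1}(A)\eta_{n+1,k,l-1},$$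 $$E\eta_{nkl}=-\lambda^{-1}q^{(-n-2k+l+1)/2}\alpha_k(B)\epsilon H\eta_{n,k-1,l}-\lambda^{-1}q^{(n+2k-l-1)/2}\epsilon H^{-1}\beta_n(A)\eta_{n-1,k,l+1},$$ $$K\eta_{nkl}=q^{(-n-2k+l)/2}\epsilon H\eta_{nkl},$$ with $\alpha_k(T)=(1+q^{2k}T^2)^{1/2}$ and $\beta_k(T)=(1+q^{-2k}T^{-2})^{1/2}$. More precisely, these formulas define a $*$-representation $\rho$ on the domain $\mathrm{Lin}\{\eta_{nkl}:\eta\in\mathcal K\}$ and a $*$-representation $\rho_0$ on the smaller dense domain $\mathrm{Lin}\{\eta_{nkl}:\eta\in L^\infty\cap\mathcal K\}$; the operators $\rho_0(x)$ and $\rho(x)$ have the same closure for every $x$ in the cross product algebra; and there is a unitary operator that maps the domain of $\pi_h$ onto the domain of $\rho_0$ and intertwines $\pi_h$ and $\rho_0$. -/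

import Mathlib

/-! ### Presented `*`-algebras -/
namespace SUq11
open MulOpposite MeasureTheory
set_option linter.unusedSimpArgs false

/-- The conjugate-linear antimultiplicative extension of a map `s` defined on free generators. -/
noncomputable def freeStar {X : Type} (s : X → FreeAlgebra ℂ X) :
    FreeAlgebra ℂ X →+* (FreeAlgebra ℂ X)ᵐᵒᵖ :=
  letI : Algebra ℂ (FreeAlgebra ℂ X)ᵐᵒᵖ :=
    RingHom.toAlgebra' ((algebraMap ℂ (FreeAlgebra ℂ X)ᵐᵒᵖ).comp (starRingEnd ℂ))
      (fun c x => Algebra.commutes ((starRingEnd ℂ) c) x)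
  (FreeAlgebra.lift ℂ (fun x => op (s x))).toRingHom

theorem freeStar_ι {X : Type} (s : X → FreeAlgebra ℂ X) (x : X) :
    freeStar s (FreeAlgebra.ι ℂ x) = op (s x) := by
  let _ : Algebra ℂ (FreeAlgebra ℂ X)ᵐᵒᵖ :=
    RingHom.toAlgebra' ((algebraMap ℂ (FreeAlgebra ℂ X)ᵐᵒᵖ).comp (starRingEnd ℂ))
      (fun c x => Algebra.commutes ((starRingEnd ℂ) c) x)
  exact FreeAlgebra.lift_ι_apply (A := (FreeAlgebra ℂ X)ᵐᵒᵖ) (fun x => op (s x)) x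

theorem freeStar_algebraMap {X : Type} (s : X → FreeAlgebra ℂ X) (c : ℂ) :
    freeStar s (algebraMap ℂ _ c) = op (algebraMap ℂ _ ((starRingEnd ℂ) c)) := by
  let _ : Algebra ℂ (FreeAlgebra ℂ X)ᵐᵒᵖ :=
    RingHom.toAlgebra' ((algebraMap ℂ (FreeAlgebra ℂ X)ᵐᵒᵖ).comp (starRingEnd ℂ))
      (fun c x => Algebra.commutes ((starRingEnd ℂ) c) x)
  exact AlgHom.commutes (FreeAlgebra.lift ℂ (A := (FreeAlgebra ℂ X)ᵐᵒᵖ) (fun x => op (s x))) c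

theorem freeStar_smul {X : Type} (s : X → FreeAlgebra ℂ X) (c : ℂ) (x : FreeAlgebra ℂ X) :
    freeStar s (c • x) = ((starRingEnd ℂ) c) • freeStar s x := by
  rw [Algebra.smul_def, map_mul, freeStar_algebraMap, Algebra.smul_def]
  rfl

/-- The conditions under which `s` induces an involution on the algebra with generators `X` and
relations `r`: it respects the relations and is involutive on generators. -/
structure StarCompatible {X : Type} (r : FreeAlgebra ℂ X → FreeAlgebra ℂ X → Prop)
    (s : X → FreeAlgebra ℂ X) : Prop where
  rel : ∀ ⦃x y⦄, r x y → RingQuot.mkAlgHom ℂ r (unop (freeStar s x)) =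
    RingQuot.mkAlgHom ℂ r (unop (freeStar s y))
  invol : ∀ i, RingQuot.mkAlgHom ℂ r (unop (freeStar s (s i))) =
    RingQuot.mkAlgHom ℂ r (FreeAlgebra.ι ℂ i)

section
variable {X : Type} {r : FreeAlgebra ℂ X → FreeAlgebra ℂ X → Prop} {s : X → FreeAlgebra ℂ X}

/-- The induced map on the presented algebra, as a ring homomorphism to the opposite ring. -/
noncomputable def quotStar (h : StarCompatible r s) : RingQuot r →+* (RingQuot r)ᵐᵒᵖ :=
  RingQuot.lift ⟨(RingHom.op (RingQuot.mkAlgHom ℂ r).toRingHom).comp (freeStar s),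
    fun _ _ hxy => congrArg op (h.rel hxy)⟩

theorem quotStar_mk (h : StarCompatible r s) (x : FreeAlgebra ℂ X) :
    quotStar h (RingQuot.mkAlgHom ℂ r x) = op (RingQuot.mkAlgHom ℂ r (unop (freeStar s x))) := by
  have : RingQuot.mkAlgHom ℂ r x = RingQuot.mkRingHom r x := by
    rw [← RingQuot.mkAlgHom_coe ℂ r]; rfl
  rw [this]
  exact RingQuot.lift_mkRingHom_apply _ (fun _ _ hxy => congrArg op (h.rel hxy)) x

theorem quotStar_quotStar (h : StarCompatible r s) (x : RingQuot r) :
    unop (quotStar h (unop (quotStar h x))) = x := by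
  obtain ⟨x, rfl⟩ := RingQuot.mkAlgHom_surjective ℂ r x
  rw [quotStar_mk, unop_op, quotStar_mk, unop_op]
  induction x using FreeAlgebra.induction with
  | grade0 c => rw [freeStar_algebraMap, unop_op, freeStar_algebraMap, unop_op]; simp
  | grade1 i => rw [freeStar_ι, unop_op, h.invol]
  | mul a b ha hb => simp only [map_mul, unop_mul, ha, hb]
  | add a b ha hb => simp only [map_add, unop_add, ha, hb]

/-- The presented algebra as a `*`-ring. -/
noncomputable abbrev presentedStarRing (h : StarCompatible r s) : StarRing (RingQuot r) where
  star x := unop (quotStar h x)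
  star_involutive x := quotStar_quotStar h x
  star_mul x y := by simp
  star_add x y := by simp
end


/-! ### The Hopf `*`-algebra `U_q(su_{1,1})` -/

/-- The positive half line `ℝ⁺ = (0, ∞)`; it is a group under multiplication. -/
abbrev RPos : Type := {r : ℝ // 0 < r}

/-- The number `q`, as a complex number. -/
noncomputable def qc (q : RPos) : ℂ := ((q : ℝ) : ℂ)

/-- The half-integral power `q^{m/2}`, as a complex number. -/
noncomputable def qh (q : RPos) (m : ℤ) : ℂ := ((√(q : ℝ) ^ m : ℝ) : ℂ)

/-- `λ = q - q⁻¹`. -/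
noncomputable def lam (q : RPos) : ℂ := qc q - (qc q)⁻¹

theorem qc_ne (q : RPos) : qc q ≠ 0 := by
  simpa [qc] using q.2.ne'

theorem sqrtq_ne (q : RPos) : √(q : ℝ) ≠ 0 := (Real.sqrt_pos.2 q.2).ne'

theorem qh_add (q : RPos) (m n : ℤ) : qh q (m + n) = qh q m * qh q n := by
  simp [qh, zpow_add₀ (sqrtq_ne q)]

theorem qh_zero (q : RPos) : qh q 0 = 1 := by simp [qh]

theorem qh_two (q : RPos) : qh q 2 = qc q := by
  have : √(q : ℝ) ^ (2 : ℤ) = q := by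
    rw [show (2 : ℤ) = ((2 : ℕ) : ℤ) from rfl, zpow_natCast, Real.sq_sqrt q.2.le]
  simp only [qh, this, qc]

theorem qh_ne (q : RPos) (m : ℤ) : qh q m ≠ 0 := by
  simp only [qh, ne_eq, Complex.ofReal_eq_zero]
  exact zpow_ne_zero _ (sqrtq_ne q)

theorem qh_two_mul (q : RPos) (m : ℤ) : qh q (2 * m) = qc q ^ m := by
  rw [← qh_two]; simp only [qh]; rw [zpow_mul]; push_cast; rfl

theorem conj_qc (q : RPos) : (starRingEnd ℂ) (qc q) = qc q := Complex.conj_ofReal _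
theorem conj_qh (q : RPos) (m : ℤ) : (starRingEnd ℂ) (qh q m) = qh q m := Complex.conj_ofReal _
theorem conj_lam (q : RPos) : (starRingEnd ℂ) (lam q) = lam q := by
  simp [lam, conj_qc]

/-- Generators of `U_q(su_{1,1})`; `Ki` stands for `K⁻¹`. -/
inductive UGen : Type
  | E | F | K | Ki

namespace UGen
/-- Generators in the free algebra. -/
noncomputable abbrev e : FreeAlgebra ℂ UGen := FreeAlgebra.ι ℂ UGen.E
noncomputable abbrev f : FreeAlgebra ℂ UGen := FreeAlgebra.ι ℂ UGen.F
noncomputable abbrev k : FreeAlgebra ℂ UGen := FreeAlgebra.ι ℂ UGen.K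
noncomputable abbrev k' : FreeAlgebra ℂ UGen := FreeAlgebra.ι ℂ UGen.Ki
end UGen

open UGen in
/-- The defining relations of `U_q(sl₂)`. -/
inductive URel (q : RPos) : FreeAlgebra ℂ UGen → FreeAlgebra ℂ UGen → Prop
  | kk' : URel q (k * k') 1
  | k'k : URel q (k' * k) 1
  | ke : URel q (k * e) (qc q • (e * k))
  | kf : URel q (k * f) ((qc q)⁻¹ • (f * k))
  | ef : URel q (e * f - f * e) ((lam q)⁻¹ • (k * k - k' * k'))

/-- The algebra `U_q(sl₂)`, with the involution defined below the Hopf `*`-algebra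
`U_q(su_{1,1})`. -/
def Uq (q : RPos) : Type := RingQuot (URel q)

noncomputable instance (q : RPos) : Ring (Uq q) := inferInstanceAs (Ring (RingQuot (URel q)))
noncomputable instance (q : RPos) : Algebra ℂ (Uq q) :=
  inferInstanceAs (Algebra ℂ (RingQuot (URel q)))

/-- The generators of `U_q(su_{1,1})`. -/
noncomputable def Uq.gen (q : RPos) (g : UGen) : Uq q :=
  RingQuot.mkAlgHom ℂ (URel q) (FreeAlgebra.ι ℂ g)

/-- The universal property of `U_q(su_{1,1})`. -/
noncomputable def Uq.lift {q : RPos} {B : Type*} [Ring B] [Algebra ℂ B] (t : UGen → B)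
    (h : ∀ ⦃x y⦄, URel q x y → FreeAlgebra.lift ℂ t x = FreeAlgebra.lift ℂ t y) :
    Uq q →ₐ[ℂ] B :=
  RingQuot.liftAlgHom ℂ ⟨FreeAlgebra.lift ℂ t, h⟩

/-- The involution on generators: `E* = -F`, `F* = -E`, `K* = K`. -/
noncomputable def UGen.star : UGen → FreeAlgebra ℂ UGen
  | .E => -UGen.f
  | .F => -UGen.e
  | .K => UGen.k
  | .Ki => UGen.k'

theorem URel.starCompatible (q : RPos) : StarCompatible (URel q) UGen.star where
  rel := by
    intro x y hxy
    have h := fun {x y} => RingQuot.mkAlgHom_rel (S := ℂ) (s := URel q) (x := x) (y := y)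
    have h1 := h URel.kk'
    have h2 := h URel.k'k
    have h3 := h URel.ke
    have h4 := h URel.kf
    have h5 := h URel.ef
    have hq := qc_ne q
    simp only [map_mul, map_one, map_sub, map_smul] at h1 h2 h3 h4 h5
    cases hxy
    · simp [freeStar_ι, UGen.star, h2]
    · simp [freeStar_ι, UGen.star, h1]
    · simp [freeStar_ι, freeStar_smul, UGen.star, conj_qc, h4, smul_smul, hq]
    · simp [freeStar_ι, freeStar_smul, UGen.star, conj_qc, h3, smul_smul, hq]
    · simp [freeStar_ι, freeStar_smul, UGen.star, conj_lam, h5]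
  invol := by
    intro i
    cases i <;> simp [freeStar_ι, UGen.star]

noncomputable instance (q : RPos) : StarRing (Uq q) := presentedStarRing (URel.starCompatible q)

theorem Uq.kk' (q : RPos) : gen q .K * gen q .Ki = 1 := by
  have h := RingQuot.mkAlgHom_rel (S := ℂ) (URel.kk' (q := q))
  simp only [map_mul, map_one, map_sub, map_smul] at h
  exact h
theorem Uq.k'k (q : RPos) : gen q .Ki * gen q .K = 1 := by
  have h := RingQuot.mkAlgHom_rel (S := ℂ) (URel.k'k (q := q))
  simp only [map_mul, map_one, map_sub, map_smul] at h
  exact h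
theorem Uq.ke (q : RPos) : gen q .K * gen q .E = qc q • (gen q .E * gen q .K) := by
  have h := RingQuot.mkAlgHom_rel (S := ℂ) (URel.ke (q := q))
  simp only [map_mul, map_one, map_sub, map_smul] at h
  exact h
theorem Uq.kf (q : RPos) : gen q .K * gen q .F = (qc q)⁻¹ • (gen q .F * gen q .K) := by
  have h := RingQuot.mkAlgHom_rel (S := ℂ) (URel.kf (q := q))
  simp only [map_mul, map_one, map_sub, map_smul] at h
  exact h
theorem Uq.ef (q : RPos) : gen q .E * gen q .F - gen q .F * gen q .E =
    (lam q)⁻¹ • (gen q .K * gen q .K - gen q .Ki * gen q .Ki) := by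
  have h := RingQuot.mkAlgHom_rel (S := ℂ) (URel.ef (q := q))
  simp only [map_mul, map_one, map_sub, map_smul] at h
  exact h
theorem Uq.ek' (q : RPos) : gen q .E * gen q .Ki = qc q • (gen q .Ki * gen q .E) := by
  have h : gen q .Ki * (gen q .K * gen q .E) * gen q .Ki =
      gen q .Ki * (qc q • (gen q .E * gen q .K)) * gen q .Ki := by rw [Uq.ke]
  rw [← mul_assoc, Uq.k'k, one_mul, mul_smul_comm, smul_mul_assoc, mul_assoc, mul_assoc,
    Uq.kk', mul_one] at h
  exact h
theorem Uq.fk' (q : RPos) : gen q .F * gen q .Ki = (qc q)⁻¹ • (gen q .Ki * gen q .F) := by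
  have h : gen q .Ki * (gen q .K * gen q .F) * gen q .Ki =
      gen q .Ki * ((qc q)⁻¹ • (gen q .F * gen q .K)) * gen q .Ki := by rw [Uq.kf]
  rw [← mul_assoc, Uq.k'k, one_mul, mul_smul_comm, smul_mul_assoc, mul_assoc, mul_assoc,
    Uq.kk', mul_one] at h
  exact h

@[simp] theorem Uq.lift_gen {q : RPos} {B : Type*} [Ring B] [Algebra ℂ B] (t : UGen → B)
    (h : ∀ ⦃x y⦄, URel q x y → FreeAlgebra.lift ℂ t x = FreeAlgebra.lift ℂ t y) (g : UGen) :
    Uq.lift t h (Uq.gen q g) = t g := by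
  unfold Uq.lift Uq.gen
  exact (RingQuot.liftAlgHom_mkAlgHom_apply ..).trans (FreeAlgebra.lift_ι_apply ..)

@[ext] theorem Uq.hom_ext {q : RPos} {B : Type*} [Ring B] [Algebra ℂ B] {f g : Uq q →ₐ[ℂ] B}
    (h : ∀ i, f (Uq.gen q i) = g (Uq.gen q i)) : f = g :=
  RingQuot.ringQuot_ext' ℂ f g (FreeAlgebra.hom_ext (funext h))

/-- The counit: `ε(K) = 1`, `ε(E) = ε(F) = 0`. -/
noncomputable def Uq.counit (q : RPos) : Uq q →ₐ[ℂ] ℂ :=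
  Uq.lift (fun | .E => 0 | .F => 0 | .K => 1 | .Ki => 1) (by
    intro x y h
    cases h <;> simp)

/-- The antipode, an algebra homomorphism to the opposite algebra:
`S(K) = K⁻¹`, `S(E) = -qE`, `S(F) = -q⁻¹F`. -/
noncomputable def Uq.antipode (q : RPos) : Uq q →ₐ[ℂ] (Uq q)ᵐᵒᵖ :=
  Uq.lift (fun
    | .E => op (-(qc q • Uq.gen q .E))
    | .F => op (-((qc q)⁻¹ • Uq.gen q .F))
    | .K => op (Uq.gen q .Ki)
    | .Ki => op (Uq.gen q .K)) (by
    have hq := qc_ne q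
    intro x y h
    apply unop_injective
    cases h
    · simp [Uq.kk']
    · simp [Uq.k'k]
    · simp [Uq.ek', smul_smul, hq]
    · simp [Uq.fk', smul_smul, hq]
    · simp only [map_sub, map_mul, FreeAlgebra.lift_ι_apply, map_smul, unop_sub, unop_mul,
        unop_smul, unop_op, neg_mul_neg, smul_mul_smul_comm, mul_inv_cancel₀ hq,
        inv_mul_cancel₀ hq, one_smul]
      rw [← neg_sub, Uq.ef, ← smul_neg, neg_sub])

/-- The inverse of the antipode:
`S⁻¹(K) = K⁻¹`, `S⁻¹(E) = -q⁻¹E`, `S⁻¹(F) = -qF`. -/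
noncomputable def Uq.antipodeInv (q : RPos) : Uq q →ₐ[ℂ] (Uq q)ᵐᵒᵖ :=
  Uq.lift (fun
    | .E => op (-((qc q)⁻¹ • Uq.gen q .E))
    | .F => op (-(qc q • Uq.gen q .F))
    | .K => op (Uq.gen q .Ki)
    | .Ki => op (Uq.gen q .K)) (by
    have hq := qc_ne q
    intro x y h
    apply unop_injective
    cases h
    · simp [Uq.kk']
    · simp [Uq.k'k]
    · simp [Uq.ek', smul_smul, hq]
    · simp [Uq.fk', smul_smul, hq]
    · simp only [map_sub, map_mul, FreeAlgebra.lift_ι_apply, map_smul, unop_sub, unop_mul,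
        unop_smul, unop_op, neg_mul_neg, smul_mul_smul_comm, mul_inv_cancel₀ hq,
        inv_mul_cancel₀ hq, one_smul]
      rw [← neg_sub, Uq.ef, ← smul_neg, neg_sub])

theorem Uq.antipodeInv_antipode (q : RPos) (x : Uq q) :
    unop (antipodeInv q (unop (antipode q x))) = x := by
  have hq := qc_ne q
  have h : (AlgHom.opComm (antipodeInv q)).comp (antipode q) = AlgHom.id ℂ _ := by
    ext i
    cases i <;> simp [AlgHom.opComm, antipode, antipodeInv, smul_smul, hq]
  exact DFunLike.congr_fun h x

theorem Uq.antipode_antipodeInv (q : RPos) (x : Uq q) :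
    unop (antipode q (unop (antipodeInv q x))) = x := by
  have hq := qc_ne q
  have h : (AlgHom.opComm (antipode q)).comp (antipodeInv q) = AlgHom.id ℂ _ := by
    ext i
    cases i <;> simp [AlgHom.opComm, antipode, antipodeInv, smul_smul, hq]
  exact DFunLike.congr_fun h x


/-! ### The coordinate `*`-algebra `O(SU_q(1,1))` -/

/-- Generators of `O(SU_q(1,1))`. -/
inductive OGen : Type
  | a | b | c | d

namespace OGen
/-- Generators in the free algebra. -/
noncomputable abbrev fa : FreeAlgebra ℂ OGen := FreeAlgebra.ι ℂ OGen.a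
noncomputable abbrev fb : FreeAlgebra ℂ OGen := FreeAlgebra.ι ℂ OGen.b
noncomputable abbrev fc : FreeAlgebra ℂ OGen := FreeAlgebra.ι ℂ OGen.c
noncomputable abbrev fd : FreeAlgebra ℂ OGen := FreeAlgebra.ι ℂ OGen.d
end OGen

open OGen in
/-- The defining relations of `O(SU_q(1,1))`. -/
inductive ORel (q : RPos) : FreeAlgebra ℂ OGen → FreeAlgebra ℂ OGen → Prop
  | ab : ORel q (fa * fb) (qc q • (fb * fa))
  | ac : ORel q (fa * fc) (qc q • (fc * fa))
  | bd : ORel q (fb * fd) (qc q • (fd * fb))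
  | cd : ORel q (fc * fd) (qc q • (fd * fc))
  | bc : ORel q (fb * fc) (fc * fb)
  | ad : ORel q (fa * fd - qc q • (fb * fc)) 1
  | da : ORel q (fd * fa - (qc q)⁻¹ • (fb * fc)) 1

/-- The coordinate algebra `O(SU_q(1,1))`. -/
def Oq (q : RPos) : Type := RingQuot (ORel q)

noncomputable instance (q : RPos) : Ring (Oq q) := inferInstanceAs (Ring (RingQuot (ORel q)))
noncomputable instance (q : RPos) : Algebra ℂ (Oq q) :=
  inferInstanceAs (Algebra ℂ (RingQuot (ORel q)))

/-- The generators of `O(SU_q(1,1))`. -/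
noncomputable def Oq.gen (q : RPos) (g : OGen) : Oq q :=
  RingQuot.mkAlgHom ℂ (ORel q) (FreeAlgebra.ι ℂ g)

/-- The universal property of `O(SU_q(1,1))`. -/
noncomputable def Oq.lift {q : RPos} {B : Type*} [Ring B] [Algebra ℂ B] (t : OGen → B)
    (h : ∀ ⦃x y⦄, ORel q x y → FreeAlgebra.lift ℂ t x = FreeAlgebra.lift ℂ t y) :
    Oq q →ₐ[ℂ] B :=
  RingQuot.liftAlgHom ℂ ⟨FreeAlgebra.lift ℂ t, h⟩

@[simp] theorem Oq.lift_gen {q : RPos} {B : Type*} [Ring B] [Algebra ℂ B] (t : OGen → B)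
    (h : ∀ ⦃x y⦄, ORel q x y → FreeAlgebra.lift ℂ t x = FreeAlgebra.lift ℂ t y) (g : OGen) :
    Oq.lift t h (Oq.gen q g) = t g := by
  unfold Oq.lift Oq.gen
  exact (RingQuot.liftAlgHom_mkAlgHom_apply ..).trans (FreeAlgebra.lift_ι_apply ..)

/-- The involution on generators: `a* = d`, `b* = qc`, `c* = q⁻¹b`, `d* = a`. -/
noncomputable def OGen.star (q : RPos) : OGen → FreeAlgebra ℂ OGen
  | .a => OGen.fd
  | .b => qc q • OGen.fc
  | .c => (qc q)⁻¹ • OGen.fb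
  | .d => OGen.fa

theorem ORel.starCompatible (q : RPos) : StarCompatible (ORel q) (OGen.star q) where
  rel := by
    intro x y hxy
    have h := fun {x y} => RingQuot.mkAlgHom_rel (S := ℂ) (s := ORel q) (x := x) (y := y)
    have h1 := h ORel.ab
    have h2 := h ORel.ac
    have h3 := h ORel.bd
    have h4 := h ORel.cd
    have h5 := h ORel.bc
    have h6 := h ORel.ad
    have h7 := h ORel.da
    have hq := qc_ne q
    simp only [map_mul, map_one, map_sub, map_smul] at h1 h2 h3 h4 h5 h6 h7
    cases hxy
    · simp [freeStar_ι, freeStar_smul, OGen.star, conj_qc, h4, smul_smul]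
    · simp [freeStar_ι, freeStar_smul, OGen.star, conj_qc, h3, smul_smul, hq]
    · simp [freeStar_ι, freeStar_smul, OGen.star, conj_qc, h2, smul_smul]
    · simp [freeStar_ι, freeStar_smul, OGen.star, conj_qc, h1, smul_smul, hq]
    · simp [freeStar_ι, freeStar_smul, OGen.star, h5, smul_smul, hq]
    · simpa [freeStar_ι, freeStar_smul, OGen.star, conj_qc, smul_smul, hq] using h6
    · simpa [freeStar_ι, freeStar_smul, OGen.star, conj_qc, smul_smul, hq] using h7
  invol := by
    have hq := qc_ne q
    intro i
    cases i <;> simp [freeStar_ι, freeStar_smul, OGen.star, conj_qc, smul_smul, hq]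

noncomputable instance (q : RPos) : StarRing (Oq q) := presentedStarRing (ORel.starCompatible q)

/-! ### The cross product `*`-algebra `U_q(su_{1,1}) ⋉ O(SU_q(1,1))` -/

/-- The free algebra on the generators of `U_q(su_{1,1})` and of `O(SU_q(1,1))`. -/
abbrev CFree : Type := FreeAlgebra ℂ (UGen ⊕ OGen)

/-- The generators of the two algebras as elements of the common free algebra. -/
noncomputable abbrev cu (g : UGen) : CFree := FreeAlgebra.ι ℂ (Sum.inl g)
noncomputable abbrev co (g : OGen) : CFree := FreeAlgebra.ι ℂ (Sum.inr g)

/-- The defining relations of `U_q(su_{1,1}) ⋉ O(SU_q(1,1))`: those of `U_q(su_{1,1})`, those of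
`O(SU_q(1,1))`, and the cross relations `x f = f₍₁₎ (x ◁ f₍₂₎)` for generators `x`, `f`, where
`Δ(K) = K ⊗ K`, `Δ(E) = E ⊗ K + K⁻¹ ⊗ E`, `Δ(F) = F ⊗ K + K⁻¹ ⊗ F`, `c ◁ E = a`, `d ◁ E = b`,
`a ◁ F = c`, `b ◁ F = d`, `a ◁ E = b ◁ E = c ◁ F = d ◁ F = 0`, and `K` acts on `a`, `b` by
`q^{-1/2}` and on `c`, `d` by `q^{1/2}`. -/
inductive CRel (q : RPos) : CFree → CFree → Prop
  | u {x y} (h : URel q x y) : CRel q (FreeAlgebra.lift ℂ cu x) (FreeAlgebra.lift ℂ cu y)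
  | o {x y} (h : ORel q x y) : CRel q (FreeAlgebra.lift ℂ co x) (FreeAlgebra.lift ℂ co y)
  | aK : CRel q (co .a * cu .K) (qh q (-1) • (cu .K * co .a))
  | bK : CRel q (co .b * cu .K) (qh q (-1) • (cu .K * co .b))
  | cK : CRel q (co .c * cu .K) (qh q 1 • (cu .K * co .c))
  | dK : CRel q (co .d * cu .K) (qh q 1 • (cu .K * co .d))
  | aE : CRel q (co .a * cu .E) (qh q (-1) • (cu .E * co .a))
  | bE : CRel q (co .b * cu .E) (qh q (-1) • (cu .E * co .b))
  | cE : CRel q (co .c * cu .E) (qh q 1 • (cu .E * co .c) + cu .Ki * co .a)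
  | dE : CRel q (co .d * cu .E) (qh q 1 • (cu .E * co .d) + cu .Ki * co .b)
  | aF : CRel q (co .a * cu .F) (qh q (-1) • (cu .F * co .a) + cu .Ki * co .c)
  | bF : CRel q (co .b * cu .F) (qh q (-1) • (cu .F * co .b) + cu .Ki * co .d)
  | cF : CRel q (co .c * cu .F) (qh q 1 • (cu .F * co .c))
  | dF : CRel q (co .d * cu .F) (qh q 1 • (cu .F * co .d))

/-- The cross product algebra `U_q(su_{1,1}) ⋉ O(SU_q(1,1))`. -/
def Cross (q : RPos) : Type := RingQuot (CRel q)

noncomputable instance (q : RPos) : Ring (Cross q) := inferInstanceAs (Ring (RingQuot (CRel q)))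
noncomputable instance (q : RPos) : Algebra ℂ (Cross q) :=
  inferInstanceAs (Algebra ℂ (RingQuot (CRel q)))

/-- The canonical map of `U_q(su_{1,1})` into the cross product algebra. -/
noncomputable def Cross.ofU (q : RPos) : Uq q →ₐ[ℂ] Cross q :=
  Uq.lift (fun g => RingQuot.mkAlgHom ℂ (CRel q) (cu g)) (by
    intro x y h
    have e : FreeAlgebra.lift ℂ (fun g => RingQuot.mkAlgHom ℂ (CRel q) (cu g)) =
        (RingQuot.mkAlgHom ℂ (CRel q)).comp (FreeAlgebra.lift ℂ cu) := by
      ext g; simp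
    exact (DFunLike.congr_fun e x).trans
      ((RingQuot.mkAlgHom_rel ℂ (CRel.u h)).trans (DFunLike.congr_fun e y).symm))

/-- The canonical map of `O(SU_q(1,1))` into the cross product algebra. -/
noncomputable def Cross.ofO (q : RPos) : Oq q →ₐ[ℂ] Cross q :=
  Oq.lift (fun g => RingQuot.mkAlgHom ℂ (CRel q) (co g)) (by
    intro x y h
    have e : FreeAlgebra.lift ℂ (fun g => RingQuot.mkAlgHom ℂ (CRel q) (co g)) =
        (RingQuot.mkAlgHom ℂ (CRel q)).comp (FreeAlgebra.lift ℂ co) := by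
      ext g; simp
    exact (DFunLike.congr_fun e x).trans
      ((RingQuot.mkAlgHom_rel ℂ (CRel.o h)).trans (DFunLike.congr_fun e y).symm))

/-- The involution on generators, that of `U_q(su_{1,1})` and of `O(SU_q(1,1))`. -/
noncomputable def cstar (q : RPos) : UGen ⊕ OGen → CFree
  | .inl g => FreeAlgebra.lift ℂ cu (UGen.star g)
  | .inr g => FreeAlgebra.lift ℂ co (OGen.star q g)

theorem cstar_u (q : RPos) (x : FreeAlgebra ℂ UGen) :
    unop (freeStar (cstar q) (FreeAlgebra.lift ℂ cu x)) =
      FreeAlgebra.lift ℂ cu (unop (freeStar UGen.star x)) := by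
  induction x using FreeAlgebra.induction with
  | grade0 c => simp [freeStar_algebraMap]
  | grade1 i => simp [freeStar_ι, cstar]
  | mul a b ha hb => simp only [map_mul, unop_mul, ha, hb]
  | add a b ha hb => simp only [map_add, unop_add, ha, hb]

theorem cstar_o (q : RPos) (x : FreeAlgebra ℂ OGen) :
    unop (freeStar (cstar q) (FreeAlgebra.lift ℂ co x)) =
      FreeAlgebra.lift ℂ co (unop (freeStar (OGen.star q) x)) := by
  induction x using FreeAlgebra.induction with
  | grade0 c => simp [freeStar_algebraMap]
  | grade1 i => simp [freeStar_ι, cstar]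
  | mul a b ha hb => simp only [map_mul, unop_mul, ha, hb]
  | add a b ha hb => simp only [map_add, unop_add, ha, hb]

theorem Cross.mk_u (q : RPos) (x : FreeAlgebra ℂ UGen) :
    RingQuot.mkAlgHom ℂ (CRel q) (FreeAlgebra.lift ℂ cu x) =
      Cross.ofU q (RingQuot.mkAlgHom ℂ (URel q) x) := by
  have e : (RingQuot.mkAlgHom ℂ (CRel q)).comp (FreeAlgebra.lift ℂ cu) =
      (Cross.ofU q).comp (RingQuot.mkAlgHom ℂ (URel q)) := by
    ext g
    have h1 : FreeAlgebra.lift ℂ cu (FreeAlgebra.ι ℂ g) = cu g := FreeAlgebra.lift_ι_apply _ _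
    have h2 : Cross.ofU q (Uq.gen q g) = RingQuot.mkAlgHom ℂ (CRel q) (cu g) :=
      Uq.lift_gen _ _ g
    simp only [Function.comp_apply, AlgHom.comp_apply, h1]
    exact h2.symm
  exact DFunLike.congr_fun e x

theorem Cross.mk_o (q : RPos) (x : FreeAlgebra ℂ OGen) :
    RingQuot.mkAlgHom ℂ (CRel q) (FreeAlgebra.lift ℂ co x) =
      Cross.ofO q (RingQuot.mkAlgHom ℂ (ORel q) x) := by
  have e : (RingQuot.mkAlgHom ℂ (CRel q)).comp (FreeAlgebra.lift ℂ co) =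
      (Cross.ofO q).comp (RingQuot.mkAlgHom ℂ (ORel q)) := by
    ext g
    have h1 : FreeAlgebra.lift ℂ co (FreeAlgebra.ι ℂ g) = co g := FreeAlgebra.lift_ι_apply _ _
    have h2 : Cross.ofO q (Oq.gen q g) = RingQuot.mkAlgHom ℂ (CRel q) (co g) :=
      Oq.lift_gen _ _ g
    simp only [Function.comp_apply, AlgHom.comp_apply, h1]
    exact h2.symm
  exact DFunLike.congr_fun e x

theorem CRel.starCompatible (q : RPos) : StarCompatible (CRel q) (cstar q) where
  rel := by
    intro x y hxy
    have h := fun {x y} => RingQuot.mkAlgHom_rel (S := ℂ) (s := CRel q) (x := x) (y := y)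
    have aK := h CRel.aK
    have bK := h CRel.bK
    have cK := h CRel.cK
    have dK := h CRel.dK
    have aE := h CRel.aE
    have bE := h CRel.bE
    have cE := h CRel.cE
    have dE := h CRel.dE
    have aF := h CRel.aF
    have bF := h CRel.bF
    have cF := h CRel.cF
    have dF := h CRel.dF
    have hq := qc_ne q
    have h1 := qh_ne q 1
    have kk' := h (CRel.u URel.kk')
    have k'k := h (CRel.u URel.k'k)
    have hi : qh q (-1) = (qh q 1)⁻¹ := by simp [qh]
    have hs : qc q = qh q 1 ^ 2 := by rw [← qh_two, pow_two, ← qh_add]; rfl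
    simp only [map_mul, map_one, FreeAlgebra.lift_ι_apply] at kk' k'k
    have swap : ∀ (z : RingQuot (CRel q)) (c c' : ℂ), c' * c = 1 →
        z * RingQuot.mkAlgHom ℂ (CRel q) (cu .K) = c • (RingQuot.mkAlgHom ℂ (CRel q) (cu .K) * z) →
        z * RingQuot.mkAlgHom ℂ (CRel q) (cu .Ki) =
          c' • (RingQuot.mkAlgHom ℂ (CRel q) (cu .Ki) * z) := by
      intro z c c' hc hz
      have h2 : RingQuot.mkAlgHom ℂ (CRel q) (cu .Ki) * (z * RingQuot.mkAlgHom ℂ (CRel q) (cu .K)) *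
          RingQuot.mkAlgHom ℂ (CRel q) (cu .Ki) = RingQuot.mkAlgHom ℂ (CRel q) (cu .Ki) * z := by
        rw [mul_assoc, mul_assoc, kk', mul_one]
      rw [hz, mul_smul_comm, smul_mul_assoc, ← mul_assoc, k'k, one_mul] at h2
      rw [← h2, smul_smul, hc, one_smul]
    simp only [map_mul, map_add, map_smul] at aK bK cK dK aE bE cE dE aF bF cF dF
    rw [hi] at aK bK aE bE aF bF
    cases hxy with
    | u hu => 
      rw [cstar_u, cstar_u, Cross.mk_u, Cross.mk_u, (URel.starCompatible q).rel hu]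
    | o ho => 
      rw [cstar_o, cstar_o, Cross.mk_o, Cross.mk_o, (ORel.starCompatible q).rel ho]
    | aK =>
      simp only [freeStar_ι, freeStar_smul, cstar, map_inv₀, conj_qh, OGen.star, UGen.star, map_mul, map_add, map_neg,
        map_smul, unop_mul, unop_add, unop_smul, unop_op, FreeAlgebra.lift_ι_apply, smul_mul_assoc,
        mul_smul_comm, neg_mul, mul_neg, dK, hs, hi]
      match_scalars <;> field_simp
    | bK =>
      simp only [freeStar_ι, freeStar_smul, cstar, map_inv₀, conj_qh, OGen.star, UGen.star, map_mul, map_add, map_neg,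
        map_smul, unop_mul, unop_add, unop_smul, unop_op, FreeAlgebra.lift_ι_apply, smul_mul_assoc,
        mul_smul_comm, neg_mul, mul_neg, cK, hs, hi]
      match_scalars <;> field_simp
    | cK =>
      simp only [freeStar_ι, freeStar_smul, cstar, map_inv₀, conj_qh, OGen.star, UGen.star, map_mul, map_add, map_neg,
        map_smul, unop_mul, unop_add, unop_smul, unop_op, FreeAlgebra.lift_ι_apply, smul_mul_assoc,
        mul_smul_comm, neg_mul, mul_neg, bK, hs, hi]
      match_scalars <;> field_simp
    | dK =>
      simp only [freeStar_ι, freeStar_smul, cstar, map_inv₀, conj_qh, OGen.star, UGen.star, map_mul, map_add, map_neg,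
        map_smul, unop_mul, unop_add, unop_smul, unop_op, FreeAlgebra.lift_ι_apply, smul_mul_assoc,
        mul_smul_comm, neg_mul, mul_neg, aK, hs, hi]
      match_scalars <;> field_simp
    | aE =>
      simp only [freeStar_ι, freeStar_smul, cstar, map_inv₀, conj_qh, OGen.star, UGen.star, map_mul, map_add, map_neg,
        map_smul, unop_mul, unop_add, unop_smul, unop_op, FreeAlgebra.lift_ι_apply, smul_mul_assoc,
        mul_smul_comm, neg_mul, mul_neg, dF, hs, hi]
      match_scalars <;> field_simp
    | bE =>
      simp only [freeStar_ι, freeStar_smul, cstar, map_inv₀, conj_qh, OGen.star, UGen.star, map_mul, map_add, map_neg,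
        map_smul, unop_mul, unop_add, unop_smul, unop_op, FreeAlgebra.lift_ι_apply, smul_mul_assoc,
        mul_smul_comm, neg_mul, mul_neg, cF, hs, hi]
      match_scalars <;> field_simp
    | cF =>
      simp only [freeStar_ι, freeStar_smul, cstar, map_inv₀, conj_qh, OGen.star, UGen.star, map_mul, map_add, map_neg,
        map_smul, unop_mul, unop_add, unop_smul, unop_op, FreeAlgebra.lift_ι_apply, smul_mul_assoc,
        mul_smul_comm, neg_mul, mul_neg, bE, hs, hi]
      match_scalars <;> field_simp
    | dF =>
      simp only [freeStar_ι, freeStar_smul, cstar, map_inv₀, conj_qh, OGen.star, UGen.star, map_mul, map_add, map_neg,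
        map_smul, unop_mul, unop_add, unop_smul, unop_op, FreeAlgebra.lift_ι_apply, smul_mul_assoc,
        mul_smul_comm, neg_mul, mul_neg, aE, hs, hi]
      match_scalars <;> field_simp
    | cE =>
      have hw := swap _ _ _ (inv_mul_cancel₀ h1) dK
      simp only [freeStar_ι, freeStar_smul, cstar, map_inv₀, conj_qh, OGen.star, UGen.star, map_mul, map_add, map_neg,
        map_smul, unop_mul, unop_add, unop_smul, unop_op, FreeAlgebra.lift_ι_apply, smul_mul_assoc,
        mul_smul_comm, neg_mul, mul_neg, bF, hw, hs, hi]
      match_scalars <;> field_simp <;> ring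
    | dE =>
      have hw := swap _ _ _ (inv_mul_cancel₀ h1) cK
      simp only [freeStar_ι, freeStar_smul, cstar, map_inv₀, conj_qh, OGen.star, UGen.star, map_mul, map_add, map_neg,
        map_smul, unop_mul, unop_add, unop_smul, unop_op, FreeAlgebra.lift_ι_apply, smul_mul_assoc,
        mul_smul_comm, neg_mul, mul_neg, aF, hw, hs, hi]
      match_scalars <;> field_simp <;> ring
    | aF =>
      have hw := swap _ _ _ (mul_inv_cancel₀ h1) bK
      simp only [freeStar_ι, freeStar_smul, cstar, map_inv₀, conj_qh, OGen.star, UGen.star, map_mul, map_add, map_neg,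
        map_smul, unop_mul, unop_add, unop_smul, unop_op, FreeAlgebra.lift_ι_apply, smul_mul_assoc,
        mul_smul_comm, neg_mul, mul_neg, dE, hw, hs, hi]
      match_scalars <;> field_simp <;> ring
    | bF =>
      have hw := swap _ _ _ (mul_inv_cancel₀ h1) aK
      simp only [freeStar_ι, freeStar_smul, cstar, map_inv₀, conj_qh, OGen.star, UGen.star, map_mul, map_add, map_neg,
        map_smul, unop_mul, unop_add, unop_smul, unop_op, FreeAlgebra.lift_ι_apply, smul_mul_assoc,
        mul_smul_comm, neg_mul, mul_neg, cE, hw, hs, hi]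
      match_scalars <;> field_simp <;> ring
  invol := by
    intro i
    cases i with
    | inl g => 
      simp only [cstar]
      rw [cstar_u, Cross.mk_u, (URel.starCompatible q).invol, ← Cross.mk_u, FreeAlgebra.lift_ι_apply]
    | inr g => 
      simp only [cstar]
      rw [cstar_o, Cross.mk_o, (ORel.starCompatible q).invol, ← Cross.mk_o, FreeAlgebra.lift_ι_apply]

noncomputable instance (q : RPos) : StarRing (Cross q) := presentedStarRing (CRel.starCompatible q)


/-! ### The function `*`-algebra `F(SU_q(1,1))` -/

/-- The `*`-algebra `F(ℝ⁺)` of locally bounded complex Borel functions on `ℝ⁺` (`q` is recorded in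
the type because the action of `ℤ²` below depends on it). -/
def LB (_q : RPos) : StarSubalgebra ℂ (RPos → ℂ) where
  carrier := {f | Measurable f ∧ ∀ C : Set RPos, IsCompact C → ∃ M : ℝ, ∀ r ∈ C, ‖f r‖ ≤ M}
  mul_mem' := by
    rintro f g ⟨hf, hf'⟩ ⟨hg, hg'⟩
    refine ⟨hf.mul hg, fun C hC => ?_⟩
    obtain ⟨M, hM⟩ := hf' C hC
    obtain ⟨N, hN⟩ := hg' C hC
    refine ⟨M * N, fun r hr => ?_⟩
    rw [Pi.mul_apply, norm_mul]
    exact mul_le_mul (hM r hr) (hN r hr) (norm_nonneg _) ((norm_nonneg _).trans (hM r hr))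
  add_mem' := by
    rintro f g ⟨hf, hf'⟩ ⟨hg, hg'⟩
    refine ⟨hf.add hg, fun C hC => ?_⟩
    obtain ⟨M, hM⟩ := hf' C hC
    obtain ⟨N, hN⟩ := hg' C hC
    exact ⟨M + N, fun r hr => (norm_add_le _ _).trans (add_le_add (hM r hr) (hN r hr))⟩
  algebraMap_mem' := fun c => ⟨measurable_const, fun _ _ => ⟨‖c‖, fun _ _ => le_rfl⟩⟩
  star_mem' := by
    rintro f ⟨hf, hf'⟩
    refine ⟨Complex.continuous_conj.measurable.comp hf, fun C hC => ?_⟩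
    obtain ⟨M, hM⟩ := hf' C hC
    exact ⟨M, fun r hr => by simpa using hM r hr⟩

instance (q : RPos) : CoeFun (LB q) (fun _ => RPos → ℂ) := ⟨fun f => f.1⟩

theorem LB.ext {q : RPos} {f g : LB q} (h : ∀ r, f r = g r) : f = g := Subtype.ext (funext h)

/-- A continuous function as an element of `F(ℝ⁺)`. -/
def LB.ofCont (q : RPos) (f : RPos → ℂ) (hf : Continuous f) : LB q :=
  ⟨f, hf.measurable, fun _ hC => hC.exists_bound_of_continuousOn hf.continuousOn⟩

theorem continuous_scale (p : RPos) : Continuous fun r : RPos => p * r :=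
  (continuous_const.mul continuous_subtype_val).subtype_mk _

/-- The rescaling `f(r) ↦ f(q^k r)`. -/
noncomputable def LB.shift (q : RPos) (k : ℤ) : LB q →⋆ₐ[ℂ] LB q where
  toFun f := ⟨fun r => f (q ^ k * r), f.2.1.comp (continuous_scale _).measurable, fun C hC => by
    obtain ⟨M, hM⟩ := f.2.2 _ (hC.image (continuous_scale (q ^ k)))
    exact ⟨M, fun r hr => hM _ ⟨r, hr, rfl⟩⟩⟩
  map_one' := rfl
  map_mul' _ _ := rfl
  map_zero' := rfl
  map_add' _ _ := rfl
  commutes' _ := rfl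
  map_star' _ := rfl

@[simp] theorem LB.shift_apply (q : RPos) (k : ℤ) (f : LB q) (r : RPos) :
    LB.shift q k f r = f (q ^ k * r) := rfl

theorem LB.shift_shift (q : RPos) (k l : ℤ) (f : LB q) :
    LB.shift q k (LB.shift q l f) = LB.shift q (k + l) f :=
  LB.ext fun r => by simp only [LB.shift_apply]; rw [← mul_assoc, ← zpow_add, add_comm]

theorem LB.shift_zero (q : RPos) (f : LB q) : LB.shift q 0 f = f :=
  LB.ext fun r => by simp

/-- The group `ℤ²` of monomials `u^n v^k`. -/
abbrev Mon : Type := Multiplicative (ℤ × ℤ)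

/-- The monomial `u^n v^k`. -/
def mon (n k : ℤ) : Mon := Multiplicative.ofAdd (n, k)

/-- The action of `ℤ²` on `F(ℝ⁺)` with `(u^n v^k) • f(r) = f(q^k r)`. -/
noncomputable instance (q : RPos) : MulSemiringAction Mon (LB q) where
  smul g f := LB.shift q g.toAdd.2 f
  one_smul f := LB.shift_zero q f
  mul_smul g h f := (LB.shift_shift q _ _ f).symm
  smul_zero _ := map_zero _
  smul_add _ := map_add _
  smul_one _ := map_one _
  smul_mul _ := map_mul _

theorem mon_smul (q : RPos) (n k : ℤ) (f : LB q) : mon n k • f = LB.shift q k f := rfl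

/-- The algebra `F(SU_q(1,1))`, generated by the Laurent polynomials in commuting `u`, `v` and by
`F(ℝ⁺)` with the relation `u^n v^k f(r) = f(q^k r) u^n v^k`. -/
def FAlg (q : RPos) : Type := SkewMonoidAlgebra (LB q) Mon

noncomputable instance (q : RPos) : Ring (FAlg q) :=
  inferInstanceAs (Ring (SkewMonoidAlgebra (LB q) Mon))

/-- The element `f(r) u^n v^k` of `F(SU_q(1,1))`. -/
noncomputable def sgl (q : RPos) (g : Mon) : LB q →+ FAlg q where
  toFun a := (SkewMonoidAlgebra.single g a : SkewMonoidAlgebra (LB q) Mon)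
  map_zero' := SkewMonoidAlgebra.single_zero _
  map_add' := SkewMonoidAlgebra.single_add _

theorem sgl_mul (q : RPos) (g h : Mon) (a b : LB q) :
    sgl q g a * sgl q h b = sgl q (g * h) (a * g • b) :=
  SkewMonoidAlgebra.single_mul_single

/-- The coefficients of an element with respect to the monomials `u^n v^k` on the right. -/
noncomputable def lco (q : RPos) : FAlg q →+ (Mon →₀ LB q) where
  toFun x := SkewMonoidAlgebra.coeff x
  map_zero' := SkewMonoidAlgebra.coeff_zero
  map_add' := SkewMonoidAlgebra.coeff_add

theorem lco_sgl (q : RPos) (g : Mon) (a : LB q) : lco q (sgl q g a) = Finsupp.single g a :=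
  SkewMonoidAlgebra.coeff_single g a

theorem lco_injective (q : RPos) : Function.Injective (lco q) :=
  SkewMonoidAlgebra.coeff_injective

theorem FAlg.induction_sgl {q : RPos} {p : FAlg q → Prop} (x : FAlg q) (h0 : p 0)
    (hs : ∀ g a, p (sgl q g a)) (ha : ∀ x y, p x → p y → p (x + y)) : p x :=
  SkewMonoidAlgebra.induction_on x h0 hs ha

theorem mon_one_smul (q : RPos) (a : LB q) : (1 : Mon) • a = a := one_smul _ a

noncomputable instance (q : RPos) : Algebra ℂ (FAlg q) :=
  RingHom.toAlgebra'
    { toFun := fun c => sgl q 1 (algebraMap ℂ (LB q) c)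
      map_one' := rfl
      map_mul' := fun c d => by rw [sgl_mul, mon_one_smul, map_mul, one_mul]
      map_zero' := by rw [map_zero, map_zero]
      map_add' := fun c d => by rw [map_add, map_add] }
    (fun c x => by
      change sgl q 1 (algebraMap ℂ (LB q) c) * x = x * sgl q 1 (algebraMap ℂ (LB q) c)
      induction x using FAlg.induction_sgl with
      | h0 => simp
      | ha x y hx hy => rw [mul_add, hx, hy, add_mul]
      | hs g a =>
        have hg : g • algebraMap ℂ (LB q) c = algebraMap ℂ (LB q) c :=
          (LB.shift q g.toAdd.2).commutes' c
        rw [sgl_mul, sgl_mul, hg, one_mul, mul_one, mon_one_smul, mul_comm])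

theorem smul_sgl (q : RPos) (c : ℂ) (g : Mon) (a : LB q) : c • sgl q g a = sgl q g (c • a) := by
  rw [Algebra.smul_def, Algebra.smul_def]
  refine (sgl_mul q 1 g (algebraMap ℂ (LB q) c) a).trans ?_
  rw [one_mul, mon_one_smul]

theorem lco_smul (q : RPos) (c : ℂ) (x : FAlg q) : lco q (c • x) = c • lco q x := by
  induction x using FAlg.induction_sgl with
  | h0 => simp
  | ha x y hx hy => rw [smul_add, map_add, hx, hy, map_add, smul_add]
  | hs g a => rw [smul_sgl, lco_sgl, lco_sgl, Finsupp.smul_single]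

/-- The element `u^n v^k f(r)`, linearly in `f`. -/
noncomputable def mono (q : RPos) (n k : ℤ) : LB q →ₗ[ℂ] FAlg q where
  toFun f := sgl q (mon n k) (LB.shift q k f)
  map_add' f g := by rw [map_add, map_add]
  map_smul' c f := by rw [map_smul, RingHom.id_apply, smul_sgl]

/-- The coefficient `f_{nk}` in the unique expansion `x = ∑ u^n v^k f_{nk}(r)`. -/
noncomputable def coef (q : RPos) (n k : ℤ) (x : FAlg q) : LB q :=
  LB.shift q (-k) (lco q x (mon n k))

/-- The coefficients, as a linear map. -/
noncomputable def lcoL (q : RPos) : FAlg q →ₗ[ℂ] (Mon →₀ LB q) :=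
  { lco q with map_smul' := lco_smul q }

/-- The linear map with prescribed values `T n k f` on the elements `u^n v^k f(r)`. -/
noncomputable def ofMono {q : RPos} {M : Type*} [AddCommMonoid M] [Module ℂ M]
    (T : ℤ → ℤ → LB q →ₗ[ℂ] M) : FAlg q →ₗ[ℂ] M :=
  (Finsupp.lsum ℂ fun g : Mon =>
    (T g.toAdd.1 g.toAdd.2).comp (LB.shift q (-g.toAdd.2)).toAlgHom.toLinearMap).comp (lcoL q)

@[simp] theorem ofMono_mono {q : RPos} {M : Type*} [AddCommMonoid M] [Module ℂ M]
    (T : ℤ → ℤ → LB q →ₗ[ℂ] M) (n k : ℤ) (f : LB q) : ofMono T (mono q n k f) = T n k f := by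
  have h : LB.shift q (-k) (LB.shift q k f) = f := by
    rw [LB.shift_shift, neg_add_cancel, LB.shift_zero]
  have h1 : ofMono T (mono q n k f) = (Finsupp.lsum ℂ fun g : Mon =>
      (T g.toAdd.1 g.toAdd.2).comp (LB.shift q (-g.toAdd.2)).toAlgHom.toLinearMap)
      (lco q (sgl q (mon n k) (LB.shift q k f))) := rfl
  rw [h1, lco_sgl, Finsupp.lsum_single]
  exact congrArg (T n k) h

theorem mono_eq_single (q : RPos) (g : Mon) (a : LB q) :
    mono q g.toAdd.1 g.toAdd.2 (LB.shift q (-g.toAdd.2) a) = sgl q g a := by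
  have h : LB.shift q g.toAdd.2 (LB.shift q (-g.toAdd.2) a) = a := by
    rw [LB.shift_shift, add_neg_cancel, LB.shift_zero]
  exact congrArg (sgl q g) h

theorem FAlg.induction {q : RPos} {p : FAlg q → Prop} (x : FAlg q) (h0 : p 0)
    (hm : ∀ n k f, p (mono q n k f)) (ha : ∀ x y, p x → p y → p (x + y)) : p x :=
  FAlg.induction_sgl x h0 (fun g a => mono_eq_single q g a ▸ hm _ _ _) ha

theorem mono_mul (q : RPos) (n k m l : ℤ) (f g : LB q) :
    mono q n k f * mono q m l g = mono q (n + m) (k + l) (LB.shift q (-l) f * g) := by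
  have h : LB.shift q k f * LB.shift q k (LB.shift q l g) =
      LB.shift q (k + l) (LB.shift q (-l) f * g) := by
    rw [map_mul, LB.shift_shift, LB.shift_shift, add_neg_cancel_right]
  exact (sgl_mul ..).trans
    (congrArg (sgl q (mon (n + m) (k + l))) h)

theorem mono_one (q : RPos) : mono q 0 0 1 = 1 := by
  have h : LB.shift q 0 (1 : LB q) = 1 := map_one _
  exact congrArg (sgl q (1 : Mon)) h

theorem FAlg.hom_ext {q : RPos} {M : Type*} [AddCommMonoid M] [Module ℂ M] {S T : FAlg q →ₗ[ℂ] M}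
    (h : ∀ n k f, S (mono q n k f) = T (mono q n k f)) : S = T := by
  refine LinearMap.ext fun x => ?_
  induction x using FAlg.induction with
  | h0 => simp
  | hm n k f => exact h n k f
  | ha x y hx hy => rw [map_add, map_add, hx, hy]

/-- The involution `(u^n v^k f(r))* = \bar f(r) v^{-k} u^{-n} = u^{-n} v^{-k} \bar f(q^k r)`. -/
noncomputable def FAlg.starMap (q : RPos) : FAlg q →+ FAlg q where
  toFun x := (lco q x).sum fun g a => mono q (-g.toAdd.1) (-g.toAdd.2) (star a)
  map_zero' := by simp
  map_add' x y := by
    rw [map_add]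
    exact Finsupp.sum_add_index' (by simp) (by simp)

theorem FAlg.starMap_mono (q : RPos) (n k : ℤ) (f : LB q) :
    FAlg.starMap q (mono q n k f) = mono q (-n) (-k) (LB.shift q k (star f)) := by
  have h : FAlg.starMap q (mono q n k f) = (lco q (sgl q (mon n k) (LB.shift q k f))).sum
      fun g a => mono q (-g.toAdd.1) (-g.toAdd.2) (star a) := rfl
  rw [h, lco_sgl, Finsupp.sum_single_index (by simp), ← map_star]
  rfl

noncomputable instance (q : RPos) : StarRing (FAlg q) where
  star := FAlg.starMap q
  star_involutive x := by
    induction x using FAlg.induction with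
    | h0 => simp
    | hm n k f =>
      rw [FAlg.starMap_mono, FAlg.starMap_mono, ← map_star, LB.shift_shift, star_star,
        neg_add_cancel, LB.shift_zero, neg_neg, neg_neg]
    | ha x y hx hy => rw [map_add, map_add, hx, hy]
  star_mul x y := by
    induction x using FAlg.induction with
    | h0 => simp
    | ha x x' hx hx' => rw [add_mul, map_add, map_add, hx, hx', mul_add]
    | hm n k f =>
      induction y using FAlg.induction with
      | h0 => simp
      | ha y y' hy hy' => rw [mul_add, map_add, map_add, hy, hy', add_mul]
      | hm m l g =>
        rw [mono_mul, FAlg.starMap_mono, FAlg.starMap_mono, FAlg.starMap_mono, mono_mul]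
        rw [neg_neg, LB.shift_shift, star_mul, map_mul, ← map_star, LB.shift_shift]
        rw [neg_add, neg_add, add_comm (-n), add_comm (-k), add_neg_cancel_right, add_comm k l]
  star_add := map_add _

theorem star_mono (q : RPos) (n k : ℤ) (f : LB q) :
    star (mono q n k f) = mono q (-n) (-k) (LB.shift q k (star f)) := FAlg.starMap_mono q n k f


/-! ### The right action of `U_q(su_{1,1})` on `F(SU_q(1,1))` -/

/-- The function `√(1 + q^{2m} r²)`. -/
noncomputable def wt (q : RPos) (m : ℤ) : LB q :=
  LB.ofCont q (fun r => ((√(1 + (q : ℝ) ^ (2 * m) * (r : ℝ) ^ 2) : ℝ) : ℂ)) (by fun_prop)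

/-- The function `r`. -/
noncomputable def rfun (q : RPos) : LB q :=
  LB.ofCont q (fun r => ((r : ℝ) : ℂ)) (by fun_prop)

/-- The function `r⁻¹`. -/
noncomputable def rinv (q : RPos) : LB q :=
  LB.ofCont q (fun r => (((r : ℝ)⁻¹ : ℝ) : ℂ))
    (Complex.continuous_ofReal.comp (continuous_subtype_val.inv₀ fun r => r.2.ne'))

/-- The function
`(u^n v^k f(r)) ◁ E = q^{(n+k+1)/2} λ⁻¹ u^{n-1} v^{k+1}
  (f(r) √(1 + q^{-2k} r²) - q^{-n} f(q⁻¹ r) √(1 + r²)) r⁻¹`. -/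
noncomputable def actE (q : RPos) : FAlg q →ₗ[ℂ] FAlg q :=
  ofMono fun n k => (qh q (n + k + 1) * (lam q)⁻¹) • (mono q (n - 1) (k + 1)).comp
    ((LinearMap.mulRight ℂ (rinv q)).comp
      (LinearMap.mulRight ℂ (wt q (-k)) -
        (qc q ^ (-n)) • (LinearMap.mulRight ℂ (wt q 0)).comp
          (LB.shift q (-1)).toAlgHom.toLinearMap))

theorem actE_mono (q : RPos) (n k : ℤ) (f : LB q) :
    actE q (mono q n k f) = (qh q (n + k + 1) * (lam q)⁻¹) • mono q (n - 1) (k + 1)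
      ((f * wt q (-k) - (qc q ^ (-n)) • (LB.shift q (-1) f * wt q 0)) * rinv q) :=
  ofMono_mono _ n k f

/-- The function
`(u^n v^k f(r)) ◁ F = q^{(k-n-3)/2} λ⁻¹ u^{n+1} v^{k-1}
  (f(qr) √(1 + q² r²) - q^n f(r) √(1 + q^{-2k+2} r²)) r⁻¹`. -/
noncomputable def actF (q : RPos) : FAlg q →ₗ[ℂ] FAlg q :=
  ofMono fun n k => (qh q (k - n - 3) * (lam q)⁻¹) • (mono q (n + 1) (k - 1)).comp
    ((LinearMap.mulRight ℂ (rinv q)).comp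
      ((LinearMap.mulRight ℂ (wt q 1)).comp (LB.shift q 1).toAlgHom.toLinearMap -
        (qc q ^ n) • LinearMap.mulRight ℂ (wt q (-k + 1))))

theorem actF_mono (q : RPos) (n k : ℤ) (f : LB q) :
    actF q (mono q n k f) = (qh q (k - n - 3) * (lam q)⁻¹) • mono q (n + 1) (k - 1)
      ((LB.shift q 1 f * wt q 1 - (qc q ^ n) • (f * wt q (-k + 1))) * rinv q) :=
  ofMono_mono _ n k f

/-- The functions `(u^n v^k f(r)) ◁ K^{±1} = q^{±(n-k)/2} u^n v^k f(r)`, where `e = ±1`. -/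
noncomputable def actK (q : RPos) (e : ℤ) : FAlg q →ₗ[ℂ] FAlg q :=
  ofMono fun n k => qh q (e * (n - k)) • mono q n k

theorem actK_mono (q : RPos) (e n k : ℤ) (f : LB q) :
    actK q e (mono q n k f) = qh q (e * (n - k)) • mono q n k f :=
  ofMono_mono _ n k f

/-- The right action of generators of `U_q(su_{1,1})`. -/
noncomputable def actGen (q : RPos) : UGen → Module.End ℂ (FAlg q)
  | .E => actE q
  | .F => actF q
  | .K => actK q 1
  | .Ki => actK q (-1)

theorem wt_shift (q : RPos) (k m : ℤ) : LB.shift q k (wt q m) = wt q (m + k) := by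
  refine LB.ext fun r => ?_
  have hq : (q : ℝ) ≠ 0 := q.2.ne'
  have h : (q : ℝ) ^ (2 * m) * ((q : ℝ) ^ k * r) ^ 2 = (q : ℝ) ^ (2 * (m + k)) * r ^ 2 := by
    rw [mul_pow, ← mul_assoc, ← zpow_natCast, ← zpow_mul, ← zpow_add₀ hq]
    congr 2; push_cast; ring
  simp only [LB.shift_apply, wt, LB.ofCont, Positive.val_mul, Positive.coe_zpow, h]

theorem wt_sq (q : RPos) (m : ℤ) :
    wt q m * wt q m = 1 + (qc q ^ (2 * m)) • (rfun q * rfun q) := by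
  refine LB.ext fun r => ?_
  have h : (√(1 + (q : ℝ) ^ (2 * m) * (r : ℝ) ^ 2)) * √(1 + (q : ℝ) ^ (2 * m) * (r : ℝ) ^ 2) =
      1 + (q : ℝ) ^ (2 * m) * ((r : ℝ) * r) := by
    rw [Real.mul_self_sqrt (by have := q.2; positivity)]; ring
  have h' := congrArg Complex.ofReal h
  push_cast at h'
  exact h'

theorem rinv_shift (q : RPos) (k : ℤ) : LB.shift q k (rinv q) = (qc q ^ (-k)) • rinv q := by
  refine LB.ext fun r => ?_
  change (((((q ^ k * r : RPos) : ℝ))⁻¹ : ℝ) : ℂ) = qc q ^ (-k) * (((r : ℝ)⁻¹ : ℝ) : ℂ)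
  simp [qc, mul_comm]

theorem rfun_shift (q : RPos) (k : ℤ) : LB.shift q k (rfun q) = (qc q ^ k) • rfun q := by
  refine LB.ext fun r => ?_
  change (((q ^ k * r : RPos) : ℝ) : ℂ) = qc q ^ k * ((r : ℝ) : ℂ)
  simp [qc]

theorem rfun_rinv (q : RPos) : rfun q * rinv q = 1 := by
  refine LB.ext fun r => ?_
  change ((r : ℝ) : ℂ) * (((r : ℝ)⁻¹ : ℝ) : ℂ) = 1
  have := r.2.ne'
  rw [← Complex.ofReal_mul, mul_inv_cancel₀ this, Complex.ofReal_one]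

theorem actGen_aux (Q N P x f g h w z y t : ℂ) (hQ : Q ≠ 0) (hN : N ≠ 0) (hP : P ≠ 0)
    (hx : x ≠ 0) (hw : w * w = 1 + x ^ 2) (hz : z * z = 1 + Q ^ 2 * x ^ 2)
    (hy : y * y = 1 + P⁻¹ ^ 2 * x ^ 2) (ht : t * t = 1 + (P⁻¹ * Q) ^ 2 * x ^ 2) :
    P * (Q - Q⁻¹)⁻¹ ^ 2 * (((g * t - N⁻¹ * (f * z)) * (Q⁻¹ * x⁻¹) * z -
        N / Q * ((f * y - N⁻¹ * (h * w)) * x⁻¹ * y)) * x⁻¹) -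
      P / Q * (Q - Q⁻¹)⁻¹ ^ 2 * (((g * z - N * (f * t)) * x⁻¹ * t -
        (N * Q)⁻¹ * ((f * w - N * (h * y)) * (Q * x⁻¹) * w)) * x⁻¹) =
    (Q - Q⁻¹)⁻¹ * (N / P * f - P / N * f) := by
  by_cases hL : Q - Q⁻¹ = 0
  · simp [hL]
  · obtain ⟨L, hL'⟩ : ∃ L, L = (Q - Q⁻¹)⁻¹ := ⟨_, rfl⟩
    have h1 : L * (Q - Q⁻¹) = 1 := by rw [hL', inv_mul_cancel₀ hL]
    rw [← hL']
    have h2 : ((g * t - N⁻¹ * (f * z)) * (Q⁻¹ * x⁻¹) * z -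
        N / Q * ((f * y - N⁻¹ * (h * w)) * x⁻¹ * y)) * x⁻¹ * Q -
        ((g * z - N * (f * t)) * x⁻¹ * t -
        (N * Q)⁻¹ * ((f * w - N * (h * y)) * (Q * x⁻¹) * w)) * x⁻¹ =
        f * (N * (t * t - y * y) - N⁻¹ * (z * z - w * w)) * x⁻¹ ^ 2 := by
      field_simp
      ring
    have h3 : P * L ^ 2 * (((g * t - N⁻¹ * (f * z)) * (Q⁻¹ * x⁻¹) * z -
        N / Q * ((f * y - N⁻¹ * (h * w)) * x⁻¹ * y)) * x⁻¹) -
      P / Q * L ^ 2 * (((g * z - N * (f * t)) * x⁻¹ * t -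
        (N * Q)⁻¹ * ((f * w - N * (h * y)) * (Q * x⁻¹) * w)) * x⁻¹) =
        P / Q * L ^ 2 * (f * (N * (t * t - y * y) - N⁻¹ * (z * z - w * w)) * x⁻¹ ^ 2) := by
      rw [← h2]
      field_simp
    rw [h3, hw, hz, hy, ht]
    have h4 : P / Q * L ^ 2 * (f * (N * (1 + (P⁻¹ * Q) ^ 2 * x ^ 2 - (1 + P⁻¹ ^ 2 * x ^ 2)) -
        N⁻¹ * (1 + Q ^ 2 * x ^ 2 - (1 + x ^ 2))) * x⁻¹ ^ 2) =
        L * (N / P * f - P / N * f) * (L * (Q - Q⁻¹)) := by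
      field_simp
      ring
    rw [h4, h1, mul_one]

theorem actGen_rel (q : RPos) ⦃x y : FreeAlgebra ℂ UGen⦄ (h : URel q x y) :
    FreeAlgebra.lift ℂ (fun g => op (actGen q g)) x =
      FreeAlgebra.lift ℂ (fun g => op (actGen q g)) y := by
  have hq := qc_ne q
  apply unop_injective
  cases h with
  | kk' =>
    refine FAlg.hom_ext fun n k f => ?_
    simp [actGen, actK_mono, smul_smul, ← qh_add, qh_zero]
  | k'k =>
    refine FAlg.hom_ext fun n k f => ?_
    simp [actGen, actK_mono, smul_smul, ← qh_add, qh_zero]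
  | ke =>
    refine FAlg.hom_ext fun n k f => ?_
    simp only [map_mul, map_smul, FreeAlgebra.lift_ι_apply, unop_mul, unop_smul, unop_op, actGen,
      Module.End.mul_apply, LinearMap.smul_apply, actK_mono, actE_mono, map_smul, smul_smul,
      ← qh_two]
    congr 1
    rw [mul_assoc _ (lam q)⁻¹, mul_comm (lam q)⁻¹, ← mul_assoc, ← mul_assoc, ← mul_assoc,
      ← qh_add, ← qh_add, ← qh_add]
    congr 2
    ring
  | kf =>
    refine FAlg.hom_ext fun n k f => ?_
    simp only [map_mul, map_smul, FreeAlgebra.lift_ι_apply, unop_mul, unop_smul, unop_op, actGen,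
      Module.End.mul_apply, LinearMap.smul_apply, actK_mono, actF_mono, map_smul, smul_smul]
    congr 1
    have h2 : (qc q)⁻¹ = qh q (-2) := by rw [← qh_two]; simp [qh]
    rw [h2, mul_assoc, mul_comm (lam q)⁻¹, ← mul_assoc, ← mul_assoc, ← mul_assoc,
      ← qh_add, ← qh_add, ← qh_add]
    congr 2
    ring
  | ef =>
    refine FAlg.hom_ext fun n k f => ?_
    simp only [map_mul, map_sub, map_smul, FreeAlgebra.lift_ι_apply, unop_mul, unop_sub, unop_smul, unop_op, actGen,
      Module.End.mul_apply, LinearMap.smul_apply, LinearMap.sub_apply, actK_mono, actE_mono, actF_mono, map_smul, smul_smul,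
      LB.shift_shift, smul_mul_assoc, map_sub, wt_shift, rinv_shift]
    rw [show n - 1 + 1 = n by ring, show k + 1 - 1 = k by ring, show n + 1 - 1 = n by ring,
      show k - 1 + 1 = k by ring, ← map_smul, ← map_smul, ← map_smul, ← map_smul, ← map_sub,
      ← map_sub, ← map_smul]
    congr 1
    refine LB.ext fun r => ?_
    have hx : ((r : ℝ) : ℂ) ≠ 0 := Complex.ofReal_ne_zero.2 r.2.ne'
    have hsq : ∀ m : ℤ, wt q m r * wt q m r = 1 + (qc q ^ m) ^ 2 * ((r : ℝ) : ℂ) ^ 2 := fun m => by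
      have h := congrArg (fun g : LB q => g r) (wt_sq q m)
      refine h.trans ?_
      rw [← zpow_natCast (qc q ^ m), ← zpow_mul, mul_comm m]
      exact congrArg (fun z => 1 + qc q ^ (2 * m) * z) (sq _).symm
    have e1 : qh q (n + k + 1) * (lam q)⁻¹ * (qh q (k + 1 - (n - 1) - 3) * (lam q)⁻¹) =
        qc q ^ k * (lam q)⁻¹ ^ 2 := by
      rw [mul_mul_mul_comm, ← qh_add, ← sq, ← qh_two_mul]; congr 2; ring
    have e2 : qh q (k - n - 3) * (lam q)⁻¹ * (qh q (n + 1 + (k - 1) + 1) * (lam q)⁻¹) =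
        qc q ^ (k - 1) * (lam q)⁻¹ ^ 2 := by
      rw [mul_mul_mul_comm, ← qh_add, ← sq, ← qh_two_mul]; congr 2; ring
    have e3 : qh q (1 * (n - k)) * qh q (1 * (n - k)) = qc q ^ (n - k) := by
      rw [← qh_two_mul, ← qh_add]; congr 1; ring
    have e4 : qh q (-1 * (n - k)) * qh q (-1 * (n - k)) = qc q ^ (k - n) := by
      rw [← qh_two_mul, ← qh_add]; congr 1; ring
    have f1 : LB.shift q (1 + -1) f = f := LB.shift_zero q f
    have f2 : LB.shift q (-1 + 1) f = f := LB.shift_zero q f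
    rw [e1, e2, e3, e4, f1, f2, show (0 : ℤ) + 1 = 1 by ring, show (1 : ℤ) + -1 = 0 by ring,
      show -(k + 1) + 1 = -k by ring, show -(k - 1) = -k + 1 by ring,
      show -k + 1 + -1 = -k by ring]
    have key := actGen_aux (qc q) (qc q ^ n) (qc q ^ k) ((r : ℝ) : ℂ) (f r) (LB.shift q 1 f r)
      (LB.shift q (-1) f r) (wt q 0 r) (wt q 1 r) (wt q (-k) r) (wt q (-k + 1) r) hq
      (zpow_ne_zero _ hq) (zpow_ne_zero _ hq) hx (by rw [hsq]; simp) (by rw [hsq]; simp)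
      (by rw [hsq, zpow_neg]) (by rw [hsq, zpow_add₀ hq, zpow_neg, zpow_one])
    have hr : rinv q r = ((r : ℝ) : ℂ)⁻¹ := Complex.ofReal_inv _
    simp only [zpow_sub₀ hq, zpow_add₀ hq, zpow_neg, zpow_one, neg_neg]
    change qc q ^ k * _ * ((((_ * _ - _ * (_ * _)) * (_ * rinv q r) * _ - _ * (
      (_ * _ - _ * (_ * _)) * rinv q r * _)) * rinv q r)) - _ * _ * (
      ((_ * _ - _ * (_ * _)) * rinv q r * _ - _ * ((_ * _ - _ * (_ * _)) * (_ * rinv q r) * _)) * rinv q r) =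
      _ * (_ * _ - _ * _)
    rw [hr]
    exact key

/-- The right action `◁` as a homomorphism into the opposite of the endomorphism algebra. -/
noncomputable def actHom (q : RPos) : Uq q →ₐ[ℂ] (Module.End ℂ (FAlg q))ᵐᵒᵖ :=
  Uq.lift (fun g => op (actGen q g)) (actGen_rel q)

/-- The right action `x ◁ f` of `f ∈ U_q(su_{1,1})` on `x ∈ F(SU_q(1,1))`. -/
noncomputable def act (q : RPos) (x : FAlg q) (f : Uq q) : FAlg q := unop (actHom q f) x

/-- The embedding of `O(SU_q(1,1))` into `F(SU_q(1,1))`: `a = v √(1 + r²)`, `b = q u⁻¹ r`,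
`c = u r`, `d = a* = v⁻¹ √(1 + q² r²)`. -/
noncomputable def phi (q : RPos) : Oq q →ₐ[ℂ] FAlg q :=
  Oq.lift (fun
    | .a => mono q 0 1 (wt q 0)
    | .b => mono q (-1) 0 (qc q • rfun q)
    | .c => mono q 1 0 (rfun q)
    | .d => mono q 0 (-1) (wt q 1)) (by
    have hq := qc_ne q
    intro x y h
    have h1 : qc q * qc q ^ (-1 : ℤ) = 1 := by rw [zpow_neg_one, mul_inv_cancel₀ hq]
    cases h <;>
    simp only [map_mul, map_sub, map_one, map_smul, FreeAlgebra.lift_ι_apply, mono_mul,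
        smul_mul_assoc, mul_smul_comm, rfun_shift, wt_shift, neg_neg, neg_zero, smul_smul,
        zero_add, add_zero, add_neg_cancel, neg_add_cancel, zpow_one, zpow_zero, mul_one, h1,
        mul_comm (rfun q) (wt q _)]
    · rw [one_smul]
    · rw [wt_sq, map_add, mono_one, map_smul, mul_one, zpow_ofNat, sq, add_sub_cancel_right]
    · rw [wt_sq, map_add, mono_one, map_smul, mul_zero, zpow_zero, inv_mul_cancel₀ hq,
        add_sub_cancel_right])

instance (q : RPos) : StarModule ℂ (FAlg q) where
  star_smul c x := by
    induction x using FAlg.induction with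
    | h0 => simp
    | ha x y hx hy => rw [smul_add, star_add, hx, hy, star_add, smul_add]
    | hm n k f => rw [← map_smul, star_mono, star_mono, star_smul, map_smul, map_smul]

/-! ### The `*`-subalgebra `F_0(SU_q(1,1))` -/

/-- The functions in `F(ℝ⁺)` with compact support. -/
def LBc (q : RPos) : Submodule ℂ (LB q) where
  carrier := {f | HasCompactSupport (f : RPos → ℂ)}
  zero_mem' := HasCompactSupport.zero
  add_mem' hf hg := HasCompactSupport.add hf hg
  smul_mem' _ _ hf := HasCompactSupport.smul_left (f := fun _ => _) hf

theorem LBc.mul_mem {q : RPos} {f : LB q} (hf : f ∈ LBc q) (g : LB q) : f * g ∈ LBc q :=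
  HasCompactSupport.mul_right (f := (f : RPos → ℂ)) hf

theorem LBc.mul_mem' {q : RPos} {f : LB q} (hf : f ∈ LBc q) (g : LB q) : g * f ∈ LBc q :=
  HasCompactSupport.mul_left (f' := (f : RPos → ℂ)) hf

theorem LBc.star_mem {q : RPos} {f : LB q} (hf : f ∈ LBc q) : star f ∈ LBc q :=
  HasCompactSupport.comp_left (g := (starRingEnd ℂ)) hf (map_zero _)

theorem LBc.shift_mem {q : RPos} {f : LB q} (hf : f ∈ LBc q) (k : ℤ) :
    LB.shift q k f ∈ LBc q := by
  let e : RPos ≃ₜ RPos :=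
    { toFun := fun r => q ^ k * r
      invFun := fun r => q ^ (-k) * r
      left_inv := fun r => by dsimp only; rw [← mul_assoc, ← zpow_add, neg_add_cancel, zpow_zero, one_mul]
      right_inv := fun r => by dsimp only; rw [← mul_assoc, ← zpow_add, add_neg_cancel, zpow_zero, one_mul]
      continuous_toFun := continuous_scale _
      continuous_invFun := continuous_scale _ }
  exact HasCompactSupport.comp_homeomorph (f := (f : RPos → ℂ)) hf e

/-- The linear span of the elements `u^n v^k f(r)` with `f` of compact support. -/
noncomputable def F0span (q : RPos) : Submodule ℂ (FAlg q) :=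
  Submodule.span ℂ {x | ∃ n k, ∃ f ∈ LBc q, x = mono q n k f}

theorem mono_mem {q : RPos} {f : LB q} (hf : f ∈ LBc q) (n k : ℤ) :
    mono q n k f ∈ F0span q :=
  Submodule.subset_span ⟨n, k, f, hf, rfl⟩

theorem F0span.mul_mem {q : RPos} (x : FAlg q) {y : FAlg q} (hy : y ∈ F0span q) :
    x * y ∈ F0span q := by
  induction x using FAlg.induction with
  | h0 => rw [zero_mul]; exact zero_mem _
  | ha x x' hx hx' => rw [add_mul]; exact add_mem hx hx'
  | hm n k f =>
    induction hy using Submodule.span_induction with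
    | zero => rw [mul_zero]; exact zero_mem _
    | add y y' _ _ hy hy' => rw [mul_add]; exact add_mem hy hy'
    | smul c y _ hy => rw [mul_smul_comm]; exact Submodule.smul_mem _ c hy
    | mem y hy =>
      obtain ⟨m, l, g, hg, rfl⟩ := hy
      rw [mono_mul]
      exact mono_mem (LBc.mul_mem' hg _) _ _

theorem F0span.star_mem {q : RPos} {y : FAlg q} (hy : y ∈ F0span q) : star y ∈ F0span q := by
  induction hy using Submodule.span_induction with
  | zero => rw [star_zero]; exact zero_mem _
  | add y y' _ _ hy hy' => rw [star_add]; exact add_mem hy hy'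
  | smul c y _ hy => rw [star_smul]; exact Submodule.smul_mem _ _ hy
  | mem y hy =>
    obtain ⟨m, l, g, hg, rfl⟩ := hy
    rw [star_mono]
    exact mono_mem (LBc.shift_mem (LBc.star_mem hg) _) _ _

/-- The `*`-algebra `F_0(SU_q(1,1))` generated by the elements `p(u,v) f(r)` with `p` a Laurent
polynomial and `f` of compact support; it is spanned by the elements `u^n v^k f(r)`. -/
noncomputable def F0 (q : RPos) : NonUnitalStarSubalgebra ℂ (FAlg q) where
  carrier := F0span q
  zero_mem' := zero_mem _
  add_mem' := add_mem
  smul_mem' _ _ := Submodule.smul_mem _ _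
  mul_mem' _ hy := F0span.mul_mem _ hy
  star_mem' := F0span.star_mem

/-- Multiplication by elements of `F(SU_q(1,1))` from the left on `F_0(SU_q(1,1))`. -/
noncomputable def mulF0 {q : RPos} (x : FAlg q) (y : F0 q) : F0 q :=
  ⟨x * y, F0span.mul_mem x y.2⟩

theorem actGen_mem {q : RPos} (g : UGen) {x : FAlg q} (hx : x ∈ F0span q) :
    actGen q g x ∈ F0span q := by
  induction hx using Submodule.span_induction with
  | zero => rw [map_zero]; exact zero_mem _
  | add y y' _ _ hy hy' => rw [map_add]; exact add_mem hy hy'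
  | smul c y _ hy => rw [map_smul]; exact Submodule.smul_mem _ _ hy
  | mem y hy =>
    obtain ⟨n, k, f, hf, rfl⟩ := hy
    cases g
    · rw [actGen, actE_mono]
      exact Submodule.smul_mem _ _ (mono_mem (LBc.mul_mem (sub_mem (LBc.mul_mem hf _)
        (Submodule.smul_mem _ _ (LBc.mul_mem (LBc.shift_mem hf _) _))) _) _ _)
    · rw [actGen, actF_mono]
      exact Submodule.smul_mem _ _ (mono_mem (LBc.mul_mem (sub_mem (LBc.mul_mem
        (LBc.shift_mem hf _) _) (Submodule.smul_mem _ _ (LBc.mul_mem hf _))) _) _ _)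
    · rw [actGen, actK_mono]
      exact Submodule.smul_mem _ _ (mono_mem hf _ _)
    · rw [actGen, actK_mono]
      exact Submodule.smul_mem _ _ (mono_mem hf _ _)

theorem act_mem {q : RPos} (f : Uq q) {x : FAlg q} (hx : x ∈ F0span q) :
    act q x f ∈ F0span q := by
  obtain ⟨f, rfl⟩ := RingQuot.mkAlgHom_surjective ℂ (URel q) f
  induction f using FreeAlgebra.induction generalizing x with
  | grade0 c =>
    have h : act q x (algebraMap ℂ (Uq q) c) = c • x := by
      rw [act, AlgHom.commutes]; rfl
    rw [AlgHom.commutes]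
    exact (congrArg (· ∈ F0span q) h).mpr (Submodule.smul_mem _ _ hx)
  | grade1 g =>
    have h : act q x (Uq.gen q g) = actGen q g x := by rw [act, actHom, Uq.lift_gen]; rfl
    exact (congrArg (· ∈ F0span q) h).mpr (actGen_mem g hx)
  | mul a b ha hb =>
    have h : act q x (RingQuot.mkAlgHom ℂ (URel q) (a * b)) =
        act q (act q x (RingQuot.mkAlgHom ℂ (URel q) a)) (RingQuot.mkAlgHom ℂ (URel q) b) := by
      rw [map_mul]
      exact DFunLike.congr_fun (congrArg unop (map_mul (actHom q) _ _)) x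
    rw [h]
    exact hb (ha hx)
  | add a b ha hb =>
    have h : act q x (RingQuot.mkAlgHom ℂ (URel q) (a + b)) =
        act q x (RingQuot.mkAlgHom ℂ (URel q) a) + act q x (RingQuot.mkAlgHom ℂ (URel q) b) := by
      rw [map_add]
      exact DFunLike.congr_fun (congrArg unop (map_add (actHom q) _ _)) x
    rw [h]
    exact add_mem (ha hx) (hb hx)

/-- The right action of `U_q(su_{1,1})` on `F_0(SU_q(1,1))`. -/
noncomputable def actF0 {q : RPos} (x : F0 q) (f : Uq q) : F0 q := ⟨act q x f, act_mem f x.2⟩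

/-! ### The functional `h_{μ₀}` -/

/-- The embedding `s ↦ q^k s` of `(q,1]` into `ℝ⁺`. -/
noncomputable def shell (q : RPos) (k : ℤ) (s : Set.Ioc (q : ℝ) 1) : RPos :=
  q ^ k * ⟨(s : ℝ), q.2.trans s.2.1⟩

theorem measurable_shell (q : RPos) (k : ℤ) : Measurable (shell q k) :=
  ((continuous_scale (q ^ k)).comp (continuous_subtype_val.subtype_mk _)).measurable

/-- The extension `μ` of a measure `μ₀` on `(q,1]` to `ℝ⁺` with `μ(q^k M) = q^k μ₀(M)` for
`k ∈ ℤ` and `M ⊆ (q,1]`. -/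
noncomputable def extMeasure (q : RPos) (μ₀ : Measure (Set.Ioc (q : ℝ) 1)) : Measure RPos :=
  Measure.sum fun k : ℤ => ENNReal.ofReal ((q : ℝ) ^ k) • μ₀.map (shell q k)

theorem finite_shells (q : RPos) {C : Set RPos} (hC : IsCompact C) :
    {k : ℤ | ∃ s, shell q k s ∈ C}.Finite := by
  rcases C.eq_empty_or_nonempty with rfl | hne
  · simp
  rcases le_or_gt 1 (q : ℝ) with h1 | h1
  · convert Set.finite_empty using 1
    ext k
    simp only [Set.mem_ofPred_eq, Set.mem_empty_iff_false, iff_false]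
    rintro ⟨s, -⟩
    exact absurd (s.2.1.trans_le s.2.2) (not_lt.2 h1)
  obtain ⟨a, -, ha⟩ := hC.exists_isMinOn hne continuous_subtype_val.continuousOn
  obtain ⟨b, -, hb⟩ := hC.exists_isMaxOn hne continuous_subtype_val.continuousOn
  obtain ⟨N, hN⟩ := exists_pow_lt_of_lt_one a.2 h1
  obtain ⟨M, hM⟩ := exists_pow_lt_of_lt_one (inv_pos.2 b.2) h1
  refine (Set.finite_Ioo (-(M : ℤ) - 1) (N : ℤ)).subset ?_
  rintro k ⟨s, hs⟩
  have hk : (0 : ℝ) < (q : ℝ) ^ k := zpow_pos q.2 k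
  have h2 : (a : ℝ) ≤ (q : ℝ) ^ k * s := ha hs
  have h3 : (q : ℝ) ^ k * s ≤ b := hb hs
  constructor
  · by_contra! hcon
    have h4 : (q : ℝ) ^ (-(M : ℤ)) ≤ (q : ℝ) ^ (k + 1) :=
      zpow_le_zpow_right_of_le_one₀ q.2 h1.le (by omega)
    have h5 : (q : ℝ) ^ (k + 1) < b := by
      rw [zpow_add_one₀ q.2.ne']
      exact (mul_lt_mul_of_pos_left s.2.1 hk).trans_le h3
    rw [zpow_neg, zpow_natCast] at h4
    have h6 : (b : ℝ) < ((q : ℝ) ^ M)⁻¹ := by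
      rw [lt_inv_comm₀ b.2 (pow_pos q.2 _)]; exact hM
    exact absurd (h6.trans_le h4) (not_lt.2 h5.le)
  · by_contra! hcon
    have h4 : (q : ℝ) ^ k ≤ (q : ℝ) ^ (N : ℤ) := zpow_le_zpow_right_of_le_one₀ q.2 h1.le hcon
    rw [zpow_natCast] at h4
    have h5 : (q : ℝ) ^ k * s ≤ (q : ℝ) ^ k := mul_le_of_le_one_right hk.le s.2.2
    linarith

theorem extMeasure_lt_top (q : RPos) (μ₀ : Measure (Set.Ioc (q : ℝ) 1)) [IsFiniteMeasure μ₀]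
    {C : Set RPos} (hC : IsCompact C) : extMeasure q μ₀ C < ⊤ := by
  have hm : ∀ k : ℤ, (ENNReal.ofReal ((q : ℝ) ^ k) • μ₀.map (shell q k)) C < ⊤ := fun k => by
    rw [Measure.smul_apply, Measure.map_apply (measurable_shell q k) hC.measurableSet]
    exact ENNReal.mul_lt_top ENNReal.ofReal_lt_top (measure_lt_top _ _)
  rw [extMeasure, Measure.sum_apply _ hC.measurableSet,
    tsum_eq_sum (s := (finite_shells q hC).toFinset)]
  · exact ENNReal.sum_lt_top.2 fun k _ => hm k
  · intro k hk
    rw [Set.Finite.mem_toFinset, Set.mem_ofPred_eq, not_exists] at hk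
    rw [Measure.smul_apply, Measure.map_apply (measurable_shell q k) hC.measurableSet]
    have : shell q k ⁻¹' C = ∅ :=
      Set.eq_empty_of_forall_notMem hk
    rw [this, measure_empty, smul_zero]

theorem integrable_of_mem (q : RPos) (μ₀ : Measure (Set.Ioc (q : ℝ) 1)) [IsFiniteMeasure μ₀]
    {f : LB q} (hf : f ∈ LBc q) :
    Integrable (fun r => f r * ((r : ℝ) : ℂ)) (extMeasure q μ₀) := by
  have hg : f * rfun q ∈ LBc q := LBc.mul_mem hf _
  obtain ⟨M, hM⟩ := (f * rfun q).2.2 _ hg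
  have h := Measure.integrableOn_of_bounded (μ := extMeasure q μ₀) (extMeasure_lt_top q μ₀ hg).ne
    (f * rfun q).2.1.aestronglyMeasurable (M := M)
    ((ae_restrict_iff' (IsCompact.measurableSet hg)).2 (Filter.Eventually.of_forall hM))
  exact (integrableOn_iff_integrable_of_support_subset (subset_tsupport _)).1 h

/-- The integral of `u^n v^k` over the torus `𝕋²`. -/
noncomputable def torusInt (n k : ℤ) : ℂ :=
  ∫ s : UnitAddCircle, ∫ t : UnitAddCircle, fourier n s * fourier k t

theorem lco_mem {q : RPos} {x : FAlg q} (hx : x ∈ F0span q) (g : Mon) : lco q x g ∈ LBc q := by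
  induction hx using Submodule.span_induction with
  | zero => rw [map_zero]; exact zero_mem _
  | add y y' _ _ hy hy' => rw [map_add]; exact add_mem hy hy'
  | smul c y _ hy => rw [lco_smul]; exact Submodule.smul_mem _ _ hy
  | mem y hy =>
    obtain ⟨n, k, f, hf, rfl⟩ := hy
    have h : lco q (mono q n k f) = Finsupp.single (mon n k) (LB.shift q k f) := lco_sgl ..
    rw [h, Finsupp.single_apply]
    split_ifs
    · exact LBc.shift_mem hf k
    · exact zero_mem _

theorem coef_mem {q : RPos} {x : FAlg q} (hx : x ∈ F0span q) (n k : ℤ) :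
    coef q n k x ∈ LBc q := LBc.shift_mem (lco_mem hx _) _

/-- The functional `f ↦ ∫ f(r) r dμ(r)` on functions with compact support. -/
noncomputable def radialInt (q : RPos) (μ₀ : Measure (Set.Ioc (q : ℝ) 1)) [IsFiniteMeasure μ₀] :
    LBc q →ₗ[ℂ] ℂ where
  toFun f := ∫ r, f.1 r * ((r : ℝ) : ℂ) ∂(extMeasure q μ₀)
  map_add' f g := by
    rw [← integral_add (integrable_of_mem q μ₀ f.2) (integrable_of_mem q μ₀ g.2)]
    exact integral_congr_ae (Filter.Eventually.of_forall fun r => add_mul _ _ _)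
  map_smul' c f := by
    rw [RingHom.id_apply, smul_eq_mul, ← integral_const_mul]
    exact integral_congr_ae (Filter.Eventually.of_forall fun r => mul_assoc _ _ _)

/-- The coefficients `f_{nk}` of an element of `F_0(SU_q(1,1))`. -/
noncomputable def coefc {q : RPos} (n k : ℤ) : F0 q →ₗ[ℂ] LBc q where
  toFun x := ⟨coef q n k x, coef_mem x.2 n k⟩
  map_add' x y := Subtype.ext (by
    change LB.shift q (-k) (lco q (x.1 + y.1) (mon n k)) = _
    rw [map_add, Finsupp.add_apply, map_add]
    rfl)
  map_smul' c x := Subtype.ext (by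
    change LB.shift q (-k) (lco q (c • x.1) (mon n k)) = _
    rw [lco_smul, Finsupp.smul_apply, map_smul]
    rfl)

theorem finite_support (q : RPos) (μ₀ : Measure (Set.Ioc (q : ℝ) 1)) [IsFiniteMeasure μ₀]
    (x : F0 q) : (Function.support fun g : ℤ × ℤ =>
      torusInt g.1 g.2 * radialInt q μ₀ (coefc g.1 g.2 x)).Finite := by
  refine ((Finset.finite_toSet (lco q x).support).preimage (f := fun g : ℤ × ℤ => mon g.1 g.2)
    Multiplicative.ofAdd.injective.injOn).subset ?_
  intro g hg
  by_contra hcon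
  have h0 : lco q x (mon g.1 g.2) = 0 := by
    by_contra h
    exact hcon (Set.mem_preimage.2 <| Finset.mem_coe.2 (Finsupp.mem_support_iff.2 h))
  have h1 : coefc g.1 g.2 x = 0 := Subtype.ext (by
    change LB.shift q (-g.2) (lco q x (mon g.1 g.2)) = 0
    rw [h0, map_zero])
  exact hg (by simp only [h1, map_zero, mul_zero])

/-- The functional
`h_{μ₀}(∑ u^n v^k f_{nk}(r)) = ∑ ∫_{𝕋²} u^n v^k du dv ∫ f_{nk}(r) r dμ(r)` on
`F_0(SU_q(1,1))`. -/
noncomputable def haar (q : RPos) (μ₀ : Measure (Set.Ioc (q : ℝ) 1)) [IsFiniteMeasure μ₀] :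
    F0 q →ₗ[ℂ] ℂ where
  toFun x := ∑ᶠ g : ℤ × ℤ, torusInt g.1 g.2 * radialInt q μ₀ (coefc g.1 g.2 x)
  map_add' x y := by
    rw [← finsum_add_distrib (finite_support q μ₀ x) (finite_support q μ₀ y)]
    exact finsum_congr fun g => by rw [map_add, map_add, mul_add]
  map_smul' c x := by
    rw [RingHom.id_apply, smul_eq_mul, mul_finsum' _ _ (finite_support q μ₀ x)]
    exact finsum_congr fun g => by rw [map_smul, map_smul, smul_eq_mul, mul_left_comm]

theorem haar_mono (q : RPos) (μ₀ : Measure (Set.Ioc (q : ℝ) 1)) [IsFiniteMeasure μ₀] (n k : ℤ)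
    {f : LB q} (hf : f ∈ LBc q) : haar q μ₀ ⟨mono q n k f, mono_mem hf n k⟩ =
      torusInt n k * ∫ r, f r * ((r : ℝ) : ℂ) ∂(extMeasure q μ₀) := by
  have hl : lco q (mono q n k f) = Finsupp.single (mon n k) (LB.shift q k f) := lco_sgl ..
  have h : ∀ g : ℤ × ℤ, coefc g.1 g.2 (⟨mono q n k f, mono_mem hf n k⟩ : F0 q) =
      if g = (n, k) then ⟨f, hf⟩ else 0 := fun g => Subtype.ext (by
    change LB.shift q (-g.2) (lco q (mono q n k f) (mon g.1 g.2)) = _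
    rw [hl]
    split_ifs with hg
    · subst hg
      rw [Finsupp.single_eq_same, LB.shift_shift, neg_add_cancel, LB.shift_zero]
    · rw [Finsupp.single_eq_of_ne, map_zero]
      · rfl
      · exact fun h => hg (Multiplicative.ofAdd.injective h))
  refine (finsum_eq_single _ (n, k) fun g hg => ?_).trans ?_
  · rw [h, if_neg hg, map_zero, mul_zero]
  · rw [h, if_pos rfl]
    rfl

/-! ### Positive functionals and the associated Hilbert space -/

section GNS
variable {A : Type*} [NonUnitalRing A] [StarRing A] [Module ℂ A] [StarModule ℂ A]
  [IsScalarTower ℂ A A] [SMulCommClass ℂ A A]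

/-- A linear functional `h` is positive if `h(x* x) ≥ 0` for all `x`. -/
def IsPositive (h : A →ₗ[ℂ] ℂ) : Prop := ∀ x, ∃ t : ℝ, 0 ≤ t ∧ h (star x * x) = t

theorem IsPositive.conj_symm {h : A →ₗ[ℂ] ℂ} (hp : IsPositive h) (x y : A) :
    (starRingEnd ℂ) (h (star y * x)) = h (star x * y) := by
  obtain ⟨a, -, ha⟩ := hp x
  obtain ⟨b, -, hb⟩ := hp y
  obtain ⟨s, -, hs⟩ := hp (x + y)
  obtain ⟨t, -, ht⟩ := hp (x + Complex.I • y)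
  simp only [star_add, star_smul, add_mul, mul_add, map_add, smul_mul_assoc, mul_smul_comm,
    map_smul, smul_eq_mul, ha, hb, Complex.star_def, Complex.conj_I] at hs ht
  have h1 := congrArg Complex.im hs
  have h2 := congrArg Complex.im ht
  simp at h1 h2
  apply Complex.ext
  · simp only [Complex.conj_re]; linarith
  · simp only [Complex.conj_im]; linarith

/-- The space `A` with the semi-inner product given by a positive functional `h`. -/
@[nolint unusedArguments]
def PreGNS (h : A →ₗ[ℂ] ℂ) (_hp : IsPositive h) : Type _ := A

variable {h : A →ₗ[ℂ] ℂ} (hp : IsPositive h)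

noncomputable instance : AddCommGroup (PreGNS h hp) := inferInstanceAs (AddCommGroup A)
noncomputable instance : Module ℂ (PreGNS h hp) := inferInstanceAs (Module ℂ A)

/-- The identity map from `A`. -/
noncomputable def toPreGNS : A ≃ₗ[ℂ] PreGNS h hp := LinearEquiv.refl ℂ A

/-- The semi-inner product `⟨x, y⟩ = h(x* y)`, linear in the second variable. -/
noncomputable abbrev preGNSCore : PreInnerProductSpace.Core ℂ (PreGNS h hp) where
  inner x y := h (star ((toPreGNS hp).symm x) * (toPreGNS hp).symm y)
  conj_inner_symm x y := hp.conj_symm _ _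
  re_inner_nonneg x := by
    obtain ⟨t, ht, hx⟩ := hp ((toPreGNS hp).symm x)
    rw [hx]
    exact ht
  add_left x y z := by rw [map_add, star_add, add_mul, map_add]
  smul_left x y c := by
    rw [map_smul, star_smul, smul_mul_assoc, map_smul, smul_eq_mul]; rfl

noncomputable instance : SeminormedAddCommGroup (PreGNS h hp) :=
  InnerProductSpace.Core.toSeminormedAddCommGroup (c := preGNSCore hp)

noncomputable instance : InnerProductSpace ℂ (PreGNS h hp) :=
  InnerProductSpace.ofCore (preGNSCore hp)

/-- The Hilbert space completion of the quotient of `A` by the null space of the semi-inner product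
`h(x* y)`. -/
abbrev GNS : Type _ := UniformSpace.Completion (PreGNS h hp)

/-- The class of `x ∈ A` in the Hilbert space. -/
noncomputable def toGNS : A →ₗ[ℂ] GNS hp :=
  (UniformSpace.Completion.toComplₗᵢ (𝕜 := ℂ) (E := PreGNS h hp)).toLinearMap.comp
    (toPreGNS hp).toLinearMap

theorem inner_toGNS (x y : A) : inner ℂ (toGNS hp x) (toGNS hp y) = h (star x * y) :=
  UniformSpace.Completion.inner_coe _ _
end GNS

/-! ### `*`-representations by unbounded operators -/

/-- A `*`-representation of a `*`-algebra `X` on a Hilbert space `H`: a homomorphism `π` of `X` into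
the linear operators on a dense subspace, the domain, such that `⟨π(x)ξ, η⟩ = ⟨ξ, π(x*)η⟩`. -/
structure StarRep (X H : Type*) [Ring X] [Algebra ℂ X] [StarRing X]
    [NormedAddCommGroup H] [InnerProductSpace ℂ H] where
  domain : Submodule ℂ H
  dense : Dense (domain : Set H)
  toHom : X →ₐ[ℂ] Module.End ℂ domain
  adjoint : ∀ (x : X) (ξ η : domain),
    inner ℂ (toHom x ξ : H) (η : H) = inner ℂ (ξ : H) (toHom (star x) η : H)

namespace StarRep
variable {X H H₁ H₂ : Type*} [Ring X] [Algebra ℂ X] [StarRing X]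
  [NormedAddCommGroup H] [InnerProductSpace ℂ H]
  [NormedAddCommGroup H₁] [InnerProductSpace ℂ H₁]
  [NormedAddCommGroup H₂] [InnerProductSpace ℂ H₂]

/-- `ξ` lies in the domain and `π(x) ξ = ζ`. -/
def Maps (π : StarRep X H) (x : X) (ξ ζ : H) : Prop :=
  ∃ hξ : ξ ∈ π.domain, (π.toHom x ⟨ξ, hξ⟩ : H) = ζ

/-- The graph of the operator `π(x)`. -/
def graph (π : StarRep X H) (x : X) : Set (H × H) := {p | π.Maps x p.1 p.2}

/-- Unitary equivalence of `*`-representations. -/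
def UnitarilyEquivalent (π₁ : StarRep X H₁) (π₂ : StarRep X H₂) : Prop :=
  ∃ U : H₁ ≃ₗᵢ[ℂ] H₂, (∀ ξ, ξ ∈ π₁.domain ↔ U ξ ∈ π₂.domain) ∧
    ∀ x ξ ζ, π₁.Maps x ξ ζ → π₂.Maps x (U ξ) (U ζ)

end StarRep

/-! ### The Heisenberg representation -/

/-- A functional `h` on `F_0(SU_q(1,1))` is `U_q(su_{1,1})`-invariant if `h(x ◁ f) = ε(f) h(x)`. -/
def IsUqInvariant {q : RPos} (h : F0 q →ₗ[ℂ] ℂ) : Prop :=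
  ∀ (x : F0 q) (f : Uq q), h (actF0 x f) = Uq.counit q f * h x

/-- `π` is the Heisenberg representation associated with the positive functional `h` on
`F_0(SU_q(1,1))`: its domain consists of the classes of the elements of `F_0(SU_q(1,1))`, and
`π(f a) x = (a x) ◁ S⁻¹(f)` for `f ∈ U_q(su_{1,1})`, `a ∈ O(SU_q(1,1))`. -/
structure IsHeisenbergRep {q : RPos} {h : F0 q →ₗ[ℂ] ℂ} (hp : IsPositive h)
    (π : StarRep (Cross q) (GNS hp)) : Prop where
  domain_eq : π.domain = LinearMap.range (toGNS hp)
  map : ∀ (f : Uq q) (a : Oq q) (x : F0 q),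
    π.Maps (Cross.ofU q f * Cross.ofO q a) (toGNS hp x)
      (toGNS hp (actF0 (mulF0 (phi q a) x) (unop (Uq.antipodeInv q f))))

/-! ### The series of `*`-representations with parameters `A`, `B`, `H`, `ε` -/

section SeriesI2
variable {K : Type*} [NormedAddCommGroup K] [InnerProductSpace ℂ K] [CompleteSpace K]

/-- `α_k(T) = (1 + q^{2k} T²)^{1/2}`. -/
noncomputable def alpha (q : RPos) (k : ℤ) (T : K →L[ℂ] K) : K →L[ℂ] K :=
  cfc (fun t : ℝ => √(1 + (q : ℝ) ^ (2 * k) * t ^ 2)) T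

/-- `β_k(T) = (1 + q^{-2k} T^{-2})^{1/2}`. -/
noncomputable def beta (q : RPos) (k : ℤ) (T : K →L[ℂ] K) : K →L[ℂ] K :=
  cfc (fun t : ℝ => √(1 + (q : ℝ) ^ (-2 * k) * (t ^ 2)⁻¹)) T

/-- The Hilbert space `⊕_{n,k,l ∈ ℤ} K`. -/
abbrev HSum (K : Type*) [NormedAddCommGroup K] : Type _ := lp (fun _ : ℤ × ℤ × ℤ => K) 2

/-- The vector `η_{nkl}` with `η` in position `(n,k,l)` and zero elsewhere. -/
noncomputable def vec (n k l : ℤ) (η : K) : HSum K :=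
  lp.single 2 ((n, k, l) : ℤ × ℤ × ℤ) η

/-- The admissible parameters: commuting self-adjoint operators `A`, `B`, `H` with
`σ(A) ⊑ (q,1]`, `σ(B) ⊑ [q,1)`, `σ(H) ⊑ (q^{1/2},1]` (the spectrum is contained in the closed
interval and the excluded endpoint is not an eigenvalue), and `ε ∈ {1,-1}`. -/
structure I2Params (q : RPos) (A B H : K →L[ℂ] K) (ε : ℂ) : Prop where
  sign : ε = 1 ∨ ε = -1
  selfAdjoint_A : IsSelfAdjoint A
  selfAdjoint_B : IsSelfAdjoint B
  selfAdjoint_H : IsSelfAdjoint H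
  comm_AB : Commute A B
  comm_AH : Commute A H
  comm_BH : Commute B H
  spec_A : spectrum ℝ A ⊆ Set.Icc (q : ℝ) 1
  spec_B : spectrum ℝ B ⊆ Set.Icc (q : ℝ) 1
  spec_H : spectrum ℝ H ⊆ Set.Icc √(q : ℝ) 1
  eig_A : ∀ η, A η = (q : ℝ) • η → η = 0
  eig_B : ∀ η, B η = η → η = 0
  eig_H : ∀ η, H η = √(q : ℝ) • η → η = 0

/-- `ρ` is the representation with parameters `A`, `B`, `H`, `ε` of `U_q(su_{1,1}) ⋉ O(SU_q(1,1))` on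
`⊕_{n,k,l ∈ ℤ} K` with the domain `Lin {η_{nkl} ; η ∈ D₀, n,k,l ∈ ℤ}`. -/
structure IsSeriesI2 {q : RPos} (ρ : StarRep (Cross q) (HSum K)) (D₀ : Submodule ℂ K)
    (A B H : K →L[ℂ] K) (ε : ℂ) : Prop where
  params : I2Params q A B H ε
  domain_eq : ρ.domain = Submodule.span ℂ {ξ | ∃ n k l, ∃ η ∈ D₀, ξ = vec n k l η}
  a : ∀ n k l, ∀ η ∈ D₀, ρ.Maps (Cross.ofO q (Oq.gen q .a)) (vec n k l η)
    (vec (n - 1) k l (alpha q n A η))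
  d : ∀ n k l, ∀ η ∈ D₀, ρ.Maps (Cross.ofO q (Oq.gen q .d)) (vec n k l η)
    (vec (n + 1) k l (alpha q (n + 1) A η))
  b : ∀ n k l, ∀ η ∈ D₀, ρ.Maps (Cross.ofO q (Oq.gen q .b)) (vec n k l η)
    (qc q ^ (n + 1) • vec n k (l + 1) (A η))
  c : ∀ n k l, ∀ η ∈ D₀, ρ.Maps (Cross.ofO q (Oq.gen q .c)) (vec n k l η)
    (qc q ^ n • vec n k (l - 1) (A η))
  F : ∀ n k l, ∀ η ∈ D₀, ρ.Maps (Cross.ofU q (Uq.gen q .F)) (vec n k l η)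
    (((lam q)⁻¹ * qh q (-n - 2 * k + l - 1) * ε) • vec n (k + 1) l (alpha q (k + 1) B (H η)) +
      ((lam q)⁻¹ * qh q (n + 2 * k - l + 1) * ε) •
        vec (n + 1) k (l - 1) (Ring.inverse H (beta q (n + 1) A η)))
  E : ∀ n k l, ∀ η ∈ D₀, ρ.Maps (Cross.ofU q (Uq.gen q .E)) (vec n k l η)
    (-(((lam q)⁻¹ * qh q (-n - 2 * k + l + 1) * ε) • vec n (k - 1) l (alpha q k B (H η))) -
      ((lam q)⁻¹ * qh q (n + 2 * k - l - 1) * ε) •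
        vec (n - 1) k (l + 1) (Ring.inverse H (beta q n A η)))
  K : ∀ n k l, ∀ η ∈ D₀, ρ.Maps (Cross.ofU q (Uq.gen q .K)) (vec n k l η)
    ((qh q (-n - 2 * k + l) * ε) • vec n k l (H η))
end SeriesI2

/-! ### The multiplication operator on `L²((q,1], r dμ₀)` -/

/-- The measure `r dμ₀(r)` on `(q,1]`. -/
noncomputable def weighted (q : RPos) (μ₀ : Measure (Set.Ioc (q : ℝ) 1)) :
    Measure (Set.Ioc (q : ℝ) 1) :=
  μ₀.withDensity fun r => ENNReal.ofReal (r : ℝ)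

/-- The Hilbert space `L²((q,1], r dμ₀)`. -/
abbrev L2q (q : RPos) (μ₀ : Measure (Set.Ioc (q : ℝ) 1)) : Type _ := Lp ℂ 2 (weighted q μ₀)

theorem memLp_coord (q : RPos) (μ₀ : Measure (Set.Ioc (q : ℝ) 1)) :
    MemLp (fun r : Set.Ioc (q : ℝ) 1 => ((r : ℝ) : ℂ)) ⊤ (weighted q μ₀) := by
  refine memLp_top_of_bound
    (Complex.measurable_ofReal.comp measurable_subtype_coe).aestronglyMeasurable 1
    (Filter.Eventually.of_forall fun r => ?_)
  rw [Complex.norm_real, Real.norm_of_nonneg (q.2.trans r.2.1).le]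
  exact r.2.2

/-- The multiplication operator `(Q ζ)(r) = r ζ(r)` on `L²((q,1], r dμ₀)`. -/
noncomputable def mulQ (q : RPos) (μ₀ : Measure (Set.Ioc (q : ℝ) 1)) :
    L2q q μ₀ →L[ℂ] L2q q μ₀ :=
  (ContinuousLinearMap.mul ℂ ℂ).holderL (weighted q μ₀) ⊤ 2 2 (memLp_coord q μ₀).toLp

theorem mulQ_coe (q : RPos) (μ₀ : Measure (Set.Ioc (q : ℝ) 1)) (ζ : L2q q μ₀) :
    mulQ q μ₀ ζ =ᵐ[weighted q μ₀] fun r => ((r : ℝ) : ℂ) * ζ r := by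
  refine ((ContinuousLinearMap.mul ℂ ℂ).coeFn_holder (r := 2)
    (memLp_coord q μ₀).toLp ζ).trans ?_
  filter_upwards [(memLp_coord q μ₀).coeFn_toLp] with r hr
  rw [hr]
  rfl

/-- The operator `q Q⁻¹`. -/
noncomputable def qQinv (q : RPos) (μ₀ : Measure (Set.Ioc (q : ℝ) 1)) :
    L2q q μ₀ →L[ℂ] L2q q μ₀ :=
  qc q • Ring.inverse (mulQ q μ₀)

/-- The subspace of essentially bounded functions in `L²((q,1], r dμ₀)`. -/
noncomputable def boundedL2 (q : RPos) (μ₀ : Measure (Set.Ioc (q : ℝ) 1)) :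
    Submodule ℂ (L2q q μ₀) where
  carrier := {ζ | MemLp ζ ⊤ (weighted q μ₀)}
  zero_mem' := MemLp.ae_eq (Lp.coeFn_zero ℂ 2 (weighted q μ₀)).symm MemLp.zero
  add_mem' hf hg := MemLp.ae_eq (Lp.coeFn_add _ _).symm (hf.add hg)
  smul_mem' c _ hf := MemLp.ae_eq (Lp.coeFn_smul c _).symm (hf.const_smul c)

end SUq11

open SUq11 MeasureTheory

namespace SUq11
open MulOpposite MeasureTheory
set_option linter.unusedSimpArgs false


/-! ### Induction principles and universal properties -/

/-! With H = 1 and B = qA⁻¹ the operators α_n(A), β_n(A) and α_k(B) are all functions of A. So every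
generator acts as a sum of weighted shifts η_p ↦ (c_p η)_{p+σ} on finitely supported families over
ℤ³, with coefficients c_p in the commutative ring C([q,1]). A relation between such shifts is then a
scalar identity at each t in [q,1]. This is how `opU_rel`, `opO_rel` and `opCross_rel` produce one
algebraic representation `seriesHom`.

The shifts are formally adjoint in the pairs that the involution prescribes
(`formalAdjoint_seriesHom`). Hence restricting to families with entries in a dense subspace D₀
stable under C([q,1]) gives a `*`-representation: D₀ = K yields ρ, and the bounded functions yield
ρ₀. The two have equal closures because, for a fixed x and a fixed position p, the vector x η_p has
finitely many components, each depending boundedly on η (`closure_graph_seriesRep_eq`).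

The link with the Heisenberg representation is a Fourier transform. The half line is the disjoint
union of the shells q^m(q,1]. On the shell m the measure μ carries the weight q^m, and the density r
contributes another q^m. The transform takes u^i v^j f, restricts f to each shell as s ↦ f(q^m s),
multiplies by (-q)^m and places the result at (m-j, -m-2, -i-m-4). The modulus of the factor makes
it isometric for h (`haar_star_mul`), so positivity is immediate. Its range is exactly the space of
families with bounded entries (`range_fourierW`).

The transform intertwines the actions (`opO_fourierW`, `opU_fourierW`) because √(1+q^{2a}r²)/r at r
= q^m s equals q^a β_{a+m}(s). In the formulas for E and F the undilated term stays on its shell and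
moves n, while the dilated term passes to a neighbouring shell and moves k. The sign of (-q)^m turns
the difference of the two terms into the sum found in the series.

Invariance is a separate computation: ∫ f(q^k r) r dμ = q^{-2k} ∫ f(r) r dμ makes the two terms of
E, and those of F, cancel. The Heisenberg representation is constructed by transporting ρ₀ through
the unitary that extends the transform, and the formula with S⁻¹ is verified afterwards.
Independence of representatives modulo the null space and the `*`-property are thereby inherited
from ρ₀. -/

theorem Uq.induction {q : RPos} {p : Uq q → Prop} (x : Uq q) (hc : ∀ c, p (algebraMap ℂ _ c))
    (hg : ∀ g, p (Uq.gen q g)) (hm : ∀ x y, p x → p y → p (x * y))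
    (ha : ∀ x y, p x → p y → p (x + y)) : p x := by
  obtain ⟨x, rfl⟩ := RingQuot.mkAlgHom_surjective ℂ (URel q) x
  induction x using FreeAlgebra.induction with
  | grade0 c => rw [AlgHom.commutes]; exact hc c
  | grade1 g => exact hg g
  | mul a b h h' => rw [map_mul]; exact hm _ _ h h'
  | add a b h h' => rw [map_add]; exact ha _ _ h h'

theorem Oq.induction {q : RPos} {p : Oq q → Prop} (x : Oq q) (hc : ∀ c, p (algebraMap ℂ _ c))
    (hg : ∀ g, p (Oq.gen q g)) (hm : ∀ x y, p x → p y → p (x * y))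
    (ha : ∀ x y, p x → p y → p (x + y)) : p x := by
  obtain ⟨x, rfl⟩ := RingQuot.mkAlgHom_surjective ℂ (ORel q) x
  induction x using FreeAlgebra.induction with
  | grade0 c => rw [AlgHom.commutes]; exact hc c
  | grade1 g => exact hg g
  | mul a b h h' => rw [map_mul]; exact hm _ _ h h'
  | add a b h h' => rw [map_add]; exact ha _ _ h h'

theorem Cross.ofU_gen (q : RPos) (g : UGen) :
    Cross.ofU q (Uq.gen q g) = RingQuot.mkAlgHom ℂ (CRel q) (cu g) :=
  Uq.lift_gen _ _ g

theorem Cross.ofO_gen (q : RPos) (g : OGen) :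
    Cross.ofO q (Oq.gen q g) = RingQuot.mkAlgHom ℂ (CRel q) (co g) :=
  Oq.lift_gen _ _ g

theorem Cross.induction {q : RPos} {p : Cross q → Prop} (x : Cross q)
    (hc : ∀ c, p (algebraMap ℂ _ c)) (hu : ∀ g, p (Cross.ofU q (Uq.gen q g)))
    (ho : ∀ g, p (Cross.ofO q (Oq.gen q g))) (hm : ∀ x y, p x → p y → p (x * y))
    (ha : ∀ x y, p x → p y → p (x + y)) : p x := by
  obtain ⟨x, rfl⟩ := RingQuot.mkAlgHom_surjective ℂ (CRel q) x
  induction x using FreeAlgebra.induction with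
  | grade0 c => rw [AlgHom.commutes]; exact hc c
  | grade1 g =>
    cases g with
    | inl g => exact Cross.ofU_gen q g ▸ hu g
    | inr g => exact Cross.ofO_gen q g ▸ ho g
  | mul a b h h' => rw [map_mul]; exact hm _ _ h h'
  | add a b h h' => rw [map_add]; exact ha _ _ h h'

/-- The conjunction of the cross relations for the images `s`, `t` of the generators. -/
structure CrossRelations {B : Type*} [Ring B] [Algebra ℂ B] (q : RPos) (s : UGen → B)
    (t : OGen → B) : Prop where
  aK : t .a * s .K = qh q (-1) • (s .K * t .a)
  bK : t .b * s .K = qh q (-1) • (s .K * t .b)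
  cK : t .c * s .K = qh q 1 • (s .K * t .c)
  dK : t .d * s .K = qh q 1 • (s .K * t .d)
  aE : t .a * s .E = qh q (-1) • (s .E * t .a)
  bE : t .b * s .E = qh q (-1) • (s .E * t .b)
  cE : t .c * s .E = qh q 1 • (s .E * t .c) + s .Ki * t .a
  dE : t .d * s .E = qh q 1 • (s .E * t .d) + s .Ki * t .b
  aF : t .a * s .F = qh q (-1) • (s .F * t .a) + s .Ki * t .c
  bF : t .b * s .F = qh q (-1) • (s .F * t .b) + s .Ki * t .d
  cF : t .c * s .F = qh q 1 • (s .F * t .c)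
  dF : t .d * s .F = qh q 1 • (s .F * t .d)

/-- The universal property of the cross product algebra. -/
noncomputable def Cross.lift {B : Type*} [Ring B] [Algebra ℂ B] {q : RPos} {s : UGen → B}
    {t : OGen → B}
    (hs : ∀ ⦃x y⦄, URel q x y → FreeAlgebra.lift ℂ s x = FreeAlgebra.lift ℂ s y)
    (ht : ∀ ⦃x y⦄, ORel q x y → FreeAlgebra.lift ℂ t x = FreeAlgebra.lift ℂ t y)
    (h : CrossRelations q s t) : Cross q →ₐ[ℂ] B :=
  RingQuot.liftAlgHom ℂ ⟨FreeAlgebra.lift ℂ (Sum.elim s t), by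
    have eu : (FreeAlgebra.lift ℂ (Sum.elim s t)).comp (FreeAlgebra.lift ℂ cu) =
        FreeAlgebra.lift ℂ s := by ext g; simp
    have eo : (FreeAlgebra.lift ℂ (Sum.elim s t)).comp (FreeAlgebra.lift ℂ co) =
        FreeAlgebra.lift ℂ t := by ext g; simp
    intro x y hxy
    cases hxy with
    | u hu =>
      exact (DFunLike.congr_fun eu _).trans ((hs hu).trans (DFunLike.congr_fun eu _).symm)
    | o ho =>
      exact (DFunLike.congr_fun eo _).trans ((ht ho).trans (DFunLike.congr_fun eo _).symm)
    | aK => simpa using h.aK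
    | bK => simpa using h.bK
    | cK => simpa using h.cK
    | dK => simpa using h.dK
    | aE => simpa using h.aE
    | bE => simpa using h.bE
    | cE => simpa using h.cE
    | dE => simpa using h.dE
    | aF => simpa using h.aF
    | bF => simpa using h.bF
    | cF => simpa using h.cF
    | dF => simpa using h.dF⟩

section
variable {B : Type*} [Ring B] [Algebra ℂ B] {q : RPos} {s : UGen → B} {t : OGen → B}
    (hs : ∀ ⦃x y⦄, URel q x y → FreeAlgebra.lift ℂ s x = FreeAlgebra.lift ℂ s y)
    (ht : ∀ ⦃x y⦄, ORel q x y → FreeAlgebra.lift ℂ t x = FreeAlgebra.lift ℂ t y)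
    (h : CrossRelations q s t)

theorem Cross.lift_ofU (g : UGen) : Cross.lift hs ht h (Cross.ofU q (Uq.gen q g)) = s g := by
  rw [Cross.ofU_gen]
  exact (RingQuot.liftAlgHom_mkAlgHom_apply ..).trans (FreeAlgebra.lift_ι_apply ..)

theorem Cross.lift_ofO (g : OGen) : Cross.lift hs ht h (Cross.ofO q (Oq.gen q g)) = t g := by
  rw [Cross.ofO_gen]
  exact (RingQuot.liftAlgHom_mkAlgHom_apply ..).trans (FreeAlgebra.lift_ι_apply ..)
end

/-! ### The involution on the generators of the cross product. -/

theorem Cross.star_ofU (q : RPos) (g : UGen) :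
    star (Cross.ofU q (Uq.gen q g)) =
      Cross.ofU q (RingQuot.mkAlgHom ℂ (URel q) (UGen.star g)) := by
  have h := quotStar_mk (CRel.starCompatible q) (cu g)
  rw [freeStar_ι] at h
  rw [Cross.ofU_gen, ← Cross.mk_u]
  exact congrArg unop h

theorem Cross.star_ofO (q : RPos) (g : OGen) :
    star (Cross.ofO q (Oq.gen q g)) =
      Cross.ofO q (RingQuot.mkAlgHom ℂ (ORel q) (OGen.star q g)) := by
  have h := quotStar_mk (CRel.starCompatible q) (co g)
  rw [freeStar_ι] at h
  rw [Cross.ofO_gen, ← Cross.mk_o]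
  exact congrArg unop h

theorem Cross.star_E (q : RPos) :
    star (Cross.ofU q (Uq.gen q .E)) = -Cross.ofU q (Uq.gen q .F) :=
  (Cross.star_ofU q .E).trans ((congrArg (Cross.ofU q)
    (map_neg (RingQuot.mkAlgHom ℂ (URel q)) UGen.f)).trans (map_neg (Cross.ofU q) (Uq.gen q .F)))

theorem Cross.star_F (q : RPos) :
    star (Cross.ofU q (Uq.gen q .F)) = -Cross.ofU q (Uq.gen q .E) :=
  (Cross.star_ofU q .F).trans ((congrArg (Cross.ofU q)
    (map_neg (RingQuot.mkAlgHom ℂ (URel q)) UGen.e)).trans (map_neg (Cross.ofU q) (Uq.gen q .E)))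

theorem Cross.star_K (q : RPos) :
    star (Cross.ofU q (Uq.gen q .K)) = Cross.ofU q (Uq.gen q .K) := Cross.star_ofU q .K

theorem Cross.star_Ki (q : RPos) :
    star (Cross.ofU q (Uq.gen q .Ki)) = Cross.ofU q (Uq.gen q .Ki) := Cross.star_ofU q .Ki

theorem Cross.star_a (q : RPos) :
    star (Cross.ofO q (Oq.gen q .a)) = Cross.ofO q (Oq.gen q .d) := Cross.star_ofO q .a

theorem Cross.star_b (q : RPos) :
    star (Cross.ofO q (Oq.gen q .b)) = qc q • Cross.ofO q (Oq.gen q .c) :=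
  (Cross.star_ofO q .b).trans ((congrArg (Cross.ofO q)
    (map_smul (RingQuot.mkAlgHom ℂ (ORel q)) _ OGen.fc)).trans
      (map_smul (Cross.ofO q) _ (Oq.gen q .c)))

theorem Cross.star_c (q : RPos) :
    star (Cross.ofO q (Oq.gen q .c)) = (qc q)⁻¹ • Cross.ofO q (Oq.gen q .b) :=
  (Cross.star_ofO q .c).trans ((congrArg (Cross.ofO q)
    (map_smul (RingQuot.mkAlgHom ℂ (ORel q)) _ OGen.fb)).trans
      (map_smul (Cross.ofO q) _ (Oq.gen q .b)))

theorem Cross.star_d (q : RPos) :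
    star (Cross.ofO q (Oq.gen q .d)) = Cross.ofO q (Oq.gen q .a) := Cross.star_ofO q .d

theorem Cross.star_algebraMap (q : RPos) (c : ℂ) :
    star (algebraMap ℂ (Cross q) c) = algebraMap ℂ (Cross q) ((starRingEnd ℂ) c) := by
  have h := quotStar_mk (CRel.starCompatible q) (algebraMap ℂ _ c)
  rw [freeStar_algebraMap, AlgHom.commutes, unop_op, AlgHom.commutes] at h
  exact congrArg unop h

/-! ### Weighted shifts -/

/-- The index set `ℤ³`. -/
abbrev Idx : Type := ℤ × ℤ × ℤ

section WeightedShift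
variable {R M : Type*} [CommRing R] [Algebra ℂ R] [AddCommGroup M] [Module ℂ M]
  (Φ : R →ₐ[ℂ] Module.End ℂ M)

/-- The weighted shift `η_p ↦ (c_p η)_{p + σ}` on the algebraic direct sum of copies of `M`. -/
noncomputable def weightedShift (σ : Idx) :
    (Idx → R) →ₗ[ℂ] Module.End ℂ (Idx →₀ M) where
  toFun c := Finsupp.lsum ℂ fun p => (Finsupp.lsingle (p + σ)).comp (Φ (c p))
  map_add' c d := by
    ext p η : 2
    simp
  map_smul' z c := by
    ext p η : 2
    simp

theorem weightedShift_single (σ : Idx) (c : Idx → R) (p : Idx) (η : M) :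
    weightedShift Φ σ c (Finsupp.single p η) = Finsupp.single (p + σ) (Φ (c p) η) := by
  simp [weightedShift]

theorem weightedShift_apply (σ : Idx) (c : Idx → R) (g : Idx →₀ M) (p : Idx) :
    weightedShift Φ σ c g p = Φ (c (p - σ)) (g (p - σ)) := by
  induction g using Finsupp.induction_linear with
  | zero => simp
  | add f g hf hg => simp [hf, hg]
  | single p' η =>
    rw [weightedShift_single]
    by_cases h : p' = p - σ
    · subst h; simp
    · rw [Finsupp.single_eq_of_ne, Finsupp.single_eq_of_ne, map_zero]
      · exact Ne.symm h
      · rintro rfl; simp at h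

/-- Weighted shifts are closed under products: the second factor moves p to p + τ before c is read
off. Every relation between them thus becomes a relation between coefficients in R. -/
theorem weightedShift_mul (σ τ : Idx) (c d : Idx → R) :
    weightedShift Φ σ c * weightedShift Φ τ d =
      weightedShift Φ (σ + τ) fun p => c (p + τ) * d p := by
  ext p η : 2
  simp [weightedShift_single, add_assoc, add_comm σ τ]

theorem weightedShift_one : weightedShift Φ 0 1 = 1 := by
  ext p η : 2
  simp [weightedShift_single]

theorem weightedShift_congr {σ τ : Idx} {c d : Idx → R} (h : σ = τ) (h' : ∀ n k l,
    c (n, k, l) = d (n, k, l)) : weightedShift Φ σ c = weightedShift Φ τ d := by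
  rw [h, show c = d from funext fun p => h' p.1 p.2.1 p.2.2]

theorem weightedShift_mul_eq {σ τ υ : Idx} {c d e : Idx → R} (h : σ + τ = υ) (h' : ∀ n k l,
    c ((n, k, l) + τ) * d (n, k, l) = e (n, k, l)) :
    weightedShift Φ σ c * weightedShift Φ τ d = weightedShift Φ υ e :=
  (weightedShift_mul Φ σ τ c d).trans (weightedShift_congr Φ h h')
end WeightedShift

/-! ### The coefficient functions -/

/-- The ring of coefficients of the weighted shifts. -/
abbrev Coef (q : RPos) : Type := C(Set.Icc (q : ℝ) 1, ℂ)

theorem icc_pos {q : RPos} (t : Set.Icc (q : ℝ) 1) : (0 : ℝ) < t := q.2.trans_le t.2.1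

/-- A real continuous function as a coefficient. -/
noncomputable def coefOfReal (q : RPos) (f : ℝ → ℝ) (hf : ContinuousOn f (Set.Icc (q : ℝ) 1)) :
    Coef q :=
  ⟨fun t => ((f t : ℝ) : ℂ), Complex.continuous_ofReal.comp hf.domRestrict⟩

theorem continuousOn_inv_icc (q : RPos) : ContinuousOn (fun t : ℝ => t⁻¹) (Set.Icc (q : ℝ) 1) :=
  continuousOn_id.inv₀ fun _ h => (q.2.trans_le h.1).ne'

theorem continuousOn_inv_sq_icc (q : RPos) :
    ContinuousOn (fun t : ℝ => (t ^ 2)⁻¹) (Set.Icc (q : ℝ) 1) :=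
  (continuousOn_id.pow 2).inv₀ fun _ h => (pow_pos (q.2.trans_le h.1) 2).ne'

/-- The function `t`. -/
noncomputable def coefA (q : RPos) : Coef q := coefOfReal q (fun t => t) continuousOn_id

/-- The function `√(1 + q^{2n} t²)`. -/
noncomputable def coefAlpha (q : RPos) (n : ℤ) : Coef q :=
  coefOfReal q (fun t => √(1 + (q : ℝ) ^ (2 * n) * t ^ 2)) (by fun_prop)

/-- The function `√(1 + q^{2k} (q t⁻¹)²)`. -/
noncomputable def coefKappa (q : RPos) (k : ℤ) : Coef q :=
  coefOfReal q (fun t => √(1 + (q : ℝ) ^ (2 * k) * (q * t⁻¹) ^ 2))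
    (Real.continuous_sqrt.comp_continuousOn (continuousOn_const.add (continuousOn_const.mul
      ((continuousOn_const.mul (continuousOn_inv_icc q)).pow 2))))

/-- The function `√(1 + q^{-2n} t⁻²)`. -/
noncomputable def coefBeta (q : RPos) (n : ℤ) : Coef q :=
  coefOfReal q (fun t => √(1 + (q : ℝ) ^ (-2 * n) * (t ^ 2)⁻¹))
    (Real.continuous_sqrt.comp_continuousOn (continuousOn_const.add (continuousOn_const.mul
      (continuousOn_inv_sq_icc q))))

theorem coefAlpha_sq (q : RPos) (n : ℤ) (t : Set.Icc (q : ℝ) 1) :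
    coefAlpha q n t * coefAlpha q n t = 1 + qc q ^ (2 * n) * (coefA q t) ^ 2 := by
  have h : √(1 + (q : ℝ) ^ (2 * n) * (t : ℝ) ^ 2) * √(1 + (q : ℝ) ^ (2 * n) * (t : ℝ) ^ 2) =
      1 + (q : ℝ) ^ (2 * n) * (t : ℝ) ^ 2 := Real.mul_self_sqrt (by have := q.2; positivity)
  have h' := congrArg Complex.ofReal h
  push_cast at h'
  exact h'

theorem coefKappa_sq (q : RPos) (k : ℤ) (t : Set.Icc (q : ℝ) 1) :
    coefKappa q k t * coefKappa q k t = 1 + qc q ^ (2 * k) * (qc q * (coefA q t)⁻¹) ^ 2 := by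
  have h : √(1 + (q : ℝ) ^ (2 * k) * (q * (t : ℝ)⁻¹) ^ 2) *
      √(1 + (q : ℝ) ^ (2 * k) * (q * (t : ℝ)⁻¹) ^ 2) =
      1 + (q : ℝ) ^ (2 * k) * (q * (t : ℝ)⁻¹) ^ 2 :=
    Real.mul_self_sqrt (by have := q.2; positivity)
  have h' := congrArg Complex.ofReal h
  push_cast at h'
  exact h'

theorem coefA_ne (q : RPos) (t : Set.Icc (q : ℝ) 1) : coefA q t ≠ 0 :=
  Complex.ofReal_ne_zero.2 (icc_pos t).ne'

/-- Pulling q^{-2n}t⁻² out of the root expresses β_n through α_n. The cross relations then involve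
only powers of q, t and the roots α_n. -/
theorem coefBeta_eq (q : RPos) (n : ℤ) (t : Set.Icc (q : ℝ) 1) :
    coefBeta q n t = (qc q ^ n)⁻¹ * (coefA q t)⁻¹ * coefAlpha q n t := by
  have ht := icc_pos t
  have hq : (0 : ℝ) < (q : ℝ) ^ n := zpow_pos q.2 n
  have h : √(1 + (q : ℝ) ^ (-2 * n) * ((t : ℝ) ^ 2)⁻¹) =
      ((q : ℝ) ^ n)⁻¹ * (t : ℝ)⁻¹ * √(1 + (q : ℝ) ^ (2 * n) * (t : ℝ) ^ 2) := by
    rw [Real.sqrt_eq_iff_mul_self_eq (by have := q.2; positivity) (by positivity),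
      mul_mul_mul_comm, Real.mul_self_sqrt (by have := q.2; positivity), neg_mul,
      zpow_neg, mul_comm 2, zpow_mul]
    rw [zpow_ofNat]
    field_simp
    ring
  have h' := congrArg Complex.ofReal h
  push_cast at h'
  exact h'

/-! ### The operators of the series of representations -/

theorem qc_eq_qh (q : RPos) : qc q = qh q 1 ^ 2 := by
  rw [← qh_two, pow_two, ← qh_add]; rfl

theorem qc_zpow_eq_qh (q : RPos) (m : ℤ) : qc q ^ m = qh q (m + m) := by
  rw [← two_mul, qh_two_mul]

theorem qh_neg (q : RPos) (m : ℤ) : qh q (-m) = (qh q m)⁻¹ := by simp [qh]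

theorem qh_sub (q : RPos) (m n : ℤ) : qh q (m - n) = qh q m * (qh q n)⁻¹ := by
  rw [sub_eq_add_neg, qh_add, qh_neg]

section Operators
variable {q : RPos} {M : Type*} [AddCommGroup M] [Module ℂ M] (Φ : Coef q →ₐ[ℂ] Module.End ℂ M)

/-- The form in which q-commutation is checked throughout: since the coefficients are functions on
[q,1], it is enough to compare numbers at each position and each t. -/
theorem weightedShift_comm {σ τ σ' τ' : Idx} {c d c' d' : Idx → Coef q} {z : ℂ}
    (h : σ + τ = τ' + σ') (h' : ∀ n k l t, c ((n, k, l) + τ) t * d (n, k, l) t =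
      z * (d' ((n, k, l) + σ') t * c' (n, k, l) t)) :
    weightedShift Φ σ c * weightedShift Φ τ d =
      z • (weightedShift Φ τ' d' * weightedShift Φ σ' c') := by
  rw [weightedShift_mul, weightedShift_mul, ← map_smul]
  exact weightedShift_congr Φ h fun n k l => ContinuousMap.ext fun t => h' n k l t

/-- The summand of the action of `F` that raises `k`. -/
noncomputable def raiseK : Module.End ℂ (Idx →₀ M) :=
  weightedShift Φ (0, 1, 0) fun p =>
    ((lam q)⁻¹ * qh q (-p.1 - 2 * p.2.1 + p.2.2 - 1)) • coefKappa q (p.2.1 + 1)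

/-- The summand of the action of `F` that raises `n`. -/
noncomputable def raiseN : Module.End ℂ (Idx →₀ M) :=
  weightedShift Φ (1, 0, -1) fun p =>
    ((lam q)⁻¹ * qh q (p.1 + 2 * p.2.1 - p.2.2 + 1)) • coefBeta q (p.1 + 1)

/-- The summand of the action of `-E` that lowers `k`. -/
noncomputable def lowerK : Module.End ℂ (Idx →₀ M) :=
  weightedShift Φ (0, -1, 0) fun p =>
    ((lam q)⁻¹ * qh q (-p.1 - 2 * p.2.1 + p.2.2 + 1)) • coefKappa q p.2.1

/-- The summand of the action of `-E` that lowers `n`. -/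
noncomputable def lowerN : Module.End ℂ (Idx →₀ M) :=
  weightedShift Φ (-1, 0, 1) fun p =>
    ((lam q)⁻¹ * qh q (p.1 + 2 * p.2.1 - p.2.2 - 1)) • coefBeta q p.1

/-- The operators by which `K^{±1}` acts, where `e = ±1`. -/
noncomputable def opK (e : ℤ) : Module.End ℂ (Idx →₀ M) :=
  weightedShift Φ 0 fun p => qh q (e * (-p.1 - 2 * p.2.1 + p.2.2)) • 1

/-- The operators by which the generators of `U_q(su_{1,1})` act. -/
noncomputable def opU : UGen → Module.End ℂ (Idx →₀ M)
  | .E => (-1 : ℂ) • (lowerK Φ + lowerN Φ)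
  | .F => raiseK Φ + raiseN Φ
  | .K => opK Φ 1
  | .Ki => opK Φ (-1)

/-- The operators by which the generators of `O(SU_q(1,1))` act. -/
noncomputable def opO : OGen → Module.End ℂ (Idx →₀ M)
  | .a => weightedShift Φ (-1, 0, 0) (fun p => coefAlpha q p.1)
  | .b => weightedShift Φ (0, 0, 1) (fun p => qc q ^ (p.1 + 1) • coefA q)
  | .c => weightedShift Φ (0, 0, -1) (fun p => qc q ^ p.1 • coefA q)
  | .d => weightedShift Φ (1, 0, 0) (fun p => coefAlpha q (p.1 + 1))

/-- The product bc acts at level n by q^{2n+1}t², while ad and da act by α_{n+1}² = 1 + q^{2n+2}t²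
and α_n² = 1 + q^{2n}t²; this gives both determinant relations. The others only compare powers of q.
-/
theorem opO_rel ⦃x y : FreeAlgebra ℂ OGen⦄ (h : ORel q x y) :
    FreeAlgebra.lift ℂ (opO Φ) x = FreeAlgebra.lift ℂ (opO Φ) y := by
  have hq := qc_ne q
  cases h <;> simp only [map_mul, map_sub, map_smul, map_one, FreeAlgebra.lift_ι_apply, opO]
  case ad =>
    rw [weightedShift_mul, weightedShift_mul,
      show ((-1, 0, 0) + (1, 0, 0) : Idx) = 0 by norm_num,
      show ((0, 0, 1) + (0, 0, -1) : Idx) = 0 by norm_num, ← weightedShift_one Φ, ← map_smul, ← map_sub]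
    refine weightedShift_congr Φ rfl fun n k l => ?_
    ext t
    simp [coefAlpha_sq]
    simp only [two_mul, zpow_add₀ hq, zpow_one]
    ring
  case da =>
    rw [weightedShift_mul, weightedShift_mul,
      show ((1, 0, 0) + (-1, 0, 0) : Idx) = 0 by norm_num,
      show ((0, 0, 1) + (0, 0, -1) : Idx) = 0 by norm_num, ← weightedShift_one Φ, ← map_smul, ← map_sub]
    refine weightedShift_congr Φ rfl fun n k l => ?_
    ext t
    simp [coefAlpha_sq]
    simp only [two_mul, zpow_add₀ hq, zpow_one]
    field_simp
    ring
  case bc =>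
    rw [weightedShift_mul, weightedShift_mul]
    refine weightedShift_congr Φ (by norm_num) fun n k l => ?_
    ext t
    simp
    ring
  all_goals
    refine weightedShift_comm Φ (by norm_num) fun n k l t => ?_
    simp [zpow_add₀ hq]
    try field_simp

theorem coefBeta_sq (q : RPos) (n : ℤ) (t : Set.Icc (q : ℝ) 1) :
    coefBeta q n t * coefBeta q n t = 1 + qc q ^ (-2 * n) * (coefA q t ^ 2)⁻¹ := by
  have h : √(1 + (q : ℝ) ^ (-2 * n) * ((t : ℝ) ^ 2)⁻¹) * √(1 + (q : ℝ) ^ (-2 * n) * ((t : ℝ) ^ 2)⁻¹) =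
      1 + (q : ℝ) ^ (-2 * n) * ((t : ℝ) ^ 2)⁻¹ := Real.mul_self_sqrt (by have := q.2; positivity)
  have h' := congrArg Complex.ofReal h
  push_cast at h'
  exact h'

theorem qh_two_eq (q : RPos) : qh q 2 = qh q 1 ^ 2 := by rw [qh_two, qc_eq_qh]

/-! #### Commutation relations of the summands -/

theorem opK_raiseK (e : ℤ) : opK Φ e * raiseK Φ = qh q (-(e + e)) • (raiseK Φ * opK Φ e) := by
  refine weightedShift_comm Φ (by simp) fun n k l t => ?_
  have := qh_ne q
  simp [mul_add, mul_sub, two_mul, mul_two, qh_add, qh_neg, qh_sub, qh_two_eq]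
  field_simp [this]

theorem opK_raiseN (e : ℤ) : opK Φ e * raiseN Φ = qh q (-(e + e)) • (raiseN Φ * opK Φ e) := by
  refine weightedShift_comm Φ (by simp) fun n k l t => ?_
  have := qh_ne q
  simp [mul_add, mul_sub, two_mul, mul_two, qh_add, qh_neg, qh_sub, qh_two_eq]
  field_simp [this]

theorem opK_lowerK (e : ℤ) : opK Φ e * lowerK Φ = qh q (e + e) • (lowerK Φ * opK Φ e) := by
  refine weightedShift_comm Φ (by simp) fun n k l t => ?_
  have := qh_ne q
  simp [mul_add, mul_sub, two_mul, mul_two, qh_add, qh_neg, qh_sub, qh_two_eq]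
  field_simp [this]

theorem opK_lowerN (e : ℤ) : opK Φ e * lowerN Φ = qh q (e + e) • (lowerN Φ * opK Φ e) := by
  refine weightedShift_comm Φ (by simp) fun n k l t => ?_
  have := qh_ne q
  simp [mul_add, mul_sub, two_mul, mul_two, qh_add, qh_neg, qh_sub, qh_two_eq]
  field_simp [this]

/-- Moves in k and moves in n involve different roots and commute exactly, so the mixed terms drop
out of EF - FE. -/
theorem lowerK_raiseN : lowerK Φ * raiseN Φ = raiseN Φ * lowerK Φ := by
  refine (weightedShift_comm Φ (z := 1) (by simp) fun n k l t => ?_).trans (one_smul _ _)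
  have := qh_ne q
  simp [mul_add, mul_sub, two_mul, mul_two, qh_add, qh_neg, qh_sub, qh_two_eq]
  field_simp [this]

theorem lowerN_raiseK : lowerN Φ * raiseK Φ = raiseK Φ * lowerN Φ := by
  refine (weightedShift_comm Φ (z := 1) (by simp) fun n k l t => ?_).trans (one_smul _ _)
  have := qh_ne q
  simp [mul_add, mul_sub, two_mul, mul_two, qh_add, qh_neg, qh_sub, qh_two_eq]
  field_simp [this]

theorem lam_eq_qh (q : RPos) : lam q = qh q 1 ^ 2 - (qh q 1 ^ 2)⁻¹ := by
  rw [lam, qc_eq_qh]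

/-- With w = -n-2k+l the difference is λ⁻² q^w (q κ_k² - q⁻¹ κ_{k+1}²). The t-dependent parts of the
two squares cancel, which leaves q - q⁻¹ = λ. -/
theorem raiseK_lowerK_sub :
    raiseK Φ * lowerK Φ - lowerK Φ * raiseK Φ = (lam q)⁻¹ • (opK Φ 1 * opK Φ 1) := by
  rw [raiseK, lowerK, opK, weightedShift_mul, weightedShift_mul, weightedShift_mul,
    show ((0, 1, 0) + (0, -1, 0) : Idx) = 0 by norm_num,
    show ((0, -1, 0) + (0, 1, 0) : Idx) = 0 by norm_num, ← map_sub, ← map_smul]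
  refine weightedShift_congr Φ (by norm_num) fun n k l => ?_
  ext t
  have := qh_ne q
  have ht := coefA_ne q t
  have hs := coefKappa_sq q k t
  have hs' := coefKappa_sq q (k + 1) t
  -- Here λ is not assumed nonzero; when it vanishes, so does its inverse by convention, and both
  -- sides are zero.
  by_cases hl : lam q = 0
  · simp [hl]
  have hl' := lam_eq_qh q
  simp only [qc_zpow_eq_qh] at hs hs'
  rw [qc_eq_qh] at hs hs'
  simp [mul_add, mul_sub, two_mul, mul_two, qh_add, qh_neg, qh_sub, qh_two_eq] at hs hs' ⊢
  field_simp [this] at hs hs' hl' ⊢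
  rw [hl']
  refine mul_left_cancel₀ (pow_ne_zero 2 ht) ?_
  -- The factor is q², the ratio that matches the q^{2k} of κ_k² with the q^{2k+2} of κ_{k+1}².
  linear_combination qh q 1 ^ 4 * hs - hs'

/-- The counterpart for n: q⁻¹ β_n² - q β_{n+1}² loses its t-dependence and leaves q⁻¹ - q = -λ,
whence the K⁻² term. -/
theorem raiseN_lowerN_sub :
    raiseN Φ * lowerN Φ - lowerN Φ * raiseN Φ = -((lam q)⁻¹ • (opK Φ (-1) * opK Φ (-1))) := by
  rw [raiseN, lowerN, opK, weightedShift_mul, weightedShift_mul, weightedShift_mul,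
    show ((1, 0, -1) + (-1, 0, 1) : Idx) = 0 by norm_num,
    show ((-1, 0, 1) + (1, 0, -1) : Idx) = 0 by norm_num, ← map_sub, ← map_smul, ← map_neg]
  refine weightedShift_congr Φ (by norm_num) fun n k l => ?_
  ext t
  have := qh_ne q
  have ht := coefA_ne q t
  have hs := coefBeta_sq q n t
  have hs' := coefBeta_sq q (n + 1) t
  by_cases hl : lam q = 0
  · simp [hl]
  have hl' := lam_eq_qh q
  simp only [qc_zpow_eq_qh, neg_mul] at hs hs'
  simp [mul_add, mul_sub, two_mul, mul_two, qh_add, qh_neg, qh_sub, qh_two_eq] at hs hs' ⊢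
  field_simp [this] at hs hs' hl' ⊢
  rw [hl']
  refine mul_left_cancel₀ (mul_ne_zero (pow_ne_zero 4 (this n)) (pow_ne_zero 2 ht)) ?_
  linear_combination hs - hs'

/-- Since E is minus the sum of the lowering parts and F the sum of the raising parts, EF - FE is
the sum of the two diagonal commutators, one giving K² and the other -K⁻². -/
theorem opU_rel ⦃x y : FreeAlgebra ℂ UGen⦄ (h : URel q x y) :
    FreeAlgebra.lift ℂ (opU Φ) x = FreeAlgebra.lift ℂ (opU Φ) y := by
  have hi : ∀ e : ℤ, opK Φ e * opK Φ (-e) = 1 := fun e => by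
    rw [← weightedShift_one Φ]
    refine weightedShift_mul_eq Φ (by norm_num) fun n k l => ?_
    simp [smul_smul, ← qh_add, qh_zero]
  cases h <;> simp only [map_mul, map_sub, map_smul, map_one, FreeAlgebra.lift_ι_apply, opU]
  case kk' => exact hi 1
  case k'k => exact hi (-1)
  case ke =>
    simp only [show qc q = qh q (1 + 1) from (qh_two q).symm, mul_smul_comm, smul_mul_assoc,
      mul_add, add_mul, opK_lowerK, opK_lowerN]
    module
  case kf =>
    rw [mul_add, opK_raiseK, opK_raiseN, qc_eq_qh, ← qh_two_eq, ← qh_neg]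
    simp [add_mul]
  case ef =>
    rw [smul_sub, ← raiseK_lowerK_sub, ← neg_neg ((lam q)⁻¹ • (opK Φ (-1) * opK Φ (-1))),
      ← raiseN_lowerN_sub]
    simp only [mul_add, add_mul, smul_mul_assoc, mul_smul_comm, smul_add, lowerK_raiseN,
      lowerN_raiseK]
    module

/-! ### The cross relations, summand by summand. -/

theorem op_a_opK : opO Φ .a * opK Φ 1 = qh q (-1) • (opK Φ 1 * opO Φ .a) := by
  refine weightedShift_comm Φ (by simp) fun n k l t => ?_
  have := qh_ne q
  simp [mul_add, mul_sub, two_mul, mul_two, qh_add, qh_neg, qh_sub, qh_two_eq]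
  field_simp [this]

theorem op_a_lowerK : opO Φ .a * lowerK Φ = qh q (-1) • (lowerK Φ * opO Φ .a) := by
  refine weightedShift_comm Φ (by simp) fun n k l t => ?_
  have := qh_ne q
  have hq := qc_ne q
  have ht := coefA_ne q t
  simp [mul_add, mul_sub, two_mul, mul_two, qh_add, qh_neg, qh_sub, qh_two_eq, coefBeta_eq, qc_zpow_eq_qh]
  field_simp [this]

theorem op_a_lowerN : opO Φ .a * lowerN Φ = qh q (-1) • (lowerN Φ * opO Φ .a) := by
  refine weightedShift_comm Φ (by simp) fun n k l t => ?_
  have := qh_ne q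
  have hq := qc_ne q
  have ht := coefA_ne q t
  simp [mul_add, mul_sub, two_mul, mul_two, qh_add, qh_neg, qh_sub, qh_two_eq, coefBeta_eq, qc_zpow_eq_qh]
  field_simp [this]

theorem op_a_raiseK : opO Φ .a * raiseK Φ = qh q (-1) • (raiseK Φ * opO Φ .a) := by
  refine weightedShift_comm Φ (by simp) fun n k l t => ?_
  have := qh_ne q
  have hq := qc_ne q
  have ht := coefA_ne q t
  simp [mul_add, mul_sub, two_mul, mul_two, qh_add, qh_neg, qh_sub, qh_two_eq, coefBeta_eq, qc_zpow_eq_qh]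
  field_simp [this]

/-- As β_n is proportional to α_n/t, the two orders of multiplication produce α_{n+1}² and α_n², so
they do not merely q-commute. The difference is a multiple of λ that cancels the prefactor λ⁻¹; this
is the reason for requiring λ ≠ 0. -/
theorem op_a_raiseN (hl : lam q ≠ 0) :
    opO Φ .a * raiseN Φ = qh q (-1) • (raiseN Φ * opO Φ .a) + opK Φ (-1) * opO Φ .c := by
  simp only [opO, raiseN, opK, weightedShift_mul, ← map_smul, Prod.mk_add_mk, zero_add, add_zero]
  norm_num only
  rw [← map_add]
  refine weightedShift_congr Φ rfl fun n k l => ?_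
  ext t
  have := qh_ne q
  have hq := qc_ne q
  have ht := coefA_ne q t
  have hl' := lam_eq_qh q
  have hs := coefAlpha_sq q n t
  have hs' := coefAlpha_sq q (n + 1) t
  simp [mul_add, two_mul, qh_add, qh_two_eq, qc_zpow_eq_qh] at hs hs'
  simp [mul_add, mul_sub, two_mul, mul_two, qh_add, qh_neg, qh_sub, qh_two_eq, coefBeta_eq, qc_zpow_eq_qh]
  field_simp [this] at hs hs' hl' ⊢
  -- Here α_{n+1}² - α_n² = q^{2n}(q² - 1)t², and `hl'` is the identity qλ = q² - 1 with
  -- denominators cleared.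
  linear_combination hs' - hs - qh q n ^ 4 * coefA q t ^ 2 * hl'

theorem op_b_opK : opO Φ .b * opK Φ 1 = qh q (-1) • (opK Φ 1 * opO Φ .b) := by
  refine weightedShift_comm Φ (by simp) fun n k l t => ?_
  have := qh_ne q
  simp [mul_add, mul_sub, two_mul, mul_two, qh_add, qh_neg, qh_sub, qh_two_eq]
  field_simp [this]

theorem op_b_lowerK : opO Φ .b * lowerK Φ = qh q (-1) • (lowerK Φ * opO Φ .b) := by
  refine weightedShift_comm Φ (by simp) fun n k l t => ?_
  have := qh_ne q
  have hq := qc_ne q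
  have ht := coefA_ne q t
  simp [mul_add, mul_sub, two_mul, mul_two, qh_add, qh_neg, qh_sub, qh_two_eq, coefBeta_eq, qc_zpow_eq_qh]
  field_simp [this]

theorem op_b_lowerN : opO Φ .b * lowerN Φ = qh q (-1) • (lowerN Φ * opO Φ .b) := by
  refine weightedShift_comm Φ (by simp) fun n k l t => ?_
  have := qh_ne q
  have hq := qc_ne q
  have ht := coefA_ne q t
  simp [mul_add, mul_sub, two_mul, mul_two, qh_add, qh_neg, qh_sub, qh_two_eq, coefBeta_eq, qc_zpow_eq_qh]
  field_simp [this]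

theorem op_b_raiseK : opO Φ .b * raiseK Φ = qh q (-1) • (raiseK Φ * opO Φ .b) := by
  refine weightedShift_comm Φ (by simp) fun n k l t => ?_
  have := qh_ne q
  have hq := qc_ne q
  have ht := coefA_ne q t
  simp [mul_add, mul_sub, two_mul, mul_two, qh_add, qh_neg, qh_sub, qh_two_eq, coefBeta_eq, qc_zpow_eq_qh]
  field_simp [this]

/-- Both orders contain the same root α_{n+1}; only the powers of q differ, and their difference
supplies the factor λ. -/
theorem op_b_raiseN (hl : lam q ≠ 0) :
    opO Φ .b * raiseN Φ = qh q (-1) • (raiseN Φ * opO Φ .b) + opK Φ (-1) * opO Φ .d := by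
  simp only [opO, raiseN, opK, weightedShift_mul, ← map_smul, Prod.mk_add_mk, zero_add, add_zero]
  norm_num only
  rw [← map_add]
  refine weightedShift_congr Φ rfl fun n k l => ?_
  ext t
  have := qh_ne q
  have hq := qc_ne q
  have ht := coefA_ne q t
  have hl' := lam_eq_qh q
  have hs := coefAlpha_sq q n t
  have hs' := coefAlpha_sq q (n + 1) t
  simp [mul_add, two_mul, qh_add, qh_two_eq, qc_zpow_eq_qh] at hs hs'
  simp [mul_add, mul_sub, two_mul, mul_two, qh_add, qh_neg, qh_sub, qh_two_eq, coefBeta_eq, qc_zpow_eq_qh]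
  field_simp [this] at hs hs' hl' ⊢
  linear_combination -coefAlpha q (n + 1) t * hl'

theorem op_c_opK : opO Φ .c * opK Φ 1 = qh q 1 • (opK Φ 1 * opO Φ .c) := by
  refine weightedShift_comm Φ (by simp) fun n k l t => ?_
  have := qh_ne q
  simp [mul_add, mul_sub, two_mul, mul_two, qh_add, qh_neg, qh_sub, qh_two_eq]
  field_simp [this]

theorem op_c_lowerK : opO Φ .c * lowerK Φ = qh q 1 • (lowerK Φ * opO Φ .c) := by
  refine weightedShift_comm Φ (by simp) fun n k l t => ?_
  have := qh_ne q
  have hq := qc_ne q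
  have ht := coefA_ne q t
  simp [mul_add, mul_sub, two_mul, mul_two, qh_add, qh_neg, qh_sub, qh_two_eq, coefBeta_eq, qc_zpow_eq_qh]
  field_simp [this]

theorem op_c_lowerN (hl : lam q ≠ 0) :
    opO Φ .c * lowerN Φ = qh q 1 • (lowerN Φ * opO Φ .c) - opK Φ (-1) * opO Φ .a := by
  simp only [opO, lowerN, opK, weightedShift_mul, ← map_smul, Prod.mk_add_mk, zero_add, add_zero]
  norm_num only
  rw [← map_sub]
  refine weightedShift_congr Φ rfl fun n k l => ?_
  ext t
  have := qh_ne q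
  have hq := qc_ne q
  have ht := coefA_ne q t
  have hl' := lam_eq_qh q
  have hs := coefAlpha_sq q n t
  have hs' := coefAlpha_sq q (n + 1) t
  simp [mul_add, two_mul, qh_add, qh_two_eq, qc_zpow_eq_qh] at hs hs'
  simp [mul_add, mul_sub, two_mul, mul_two, qh_add, qh_neg, qh_sub, qh_two_eq, coefBeta_eq, qc_zpow_eq_qh]
  field_simp [this] at hs hs' hl' ⊢
  linear_combination coefAlpha q n t * hl'

theorem op_c_raiseK : opO Φ .c * raiseK Φ = qh q 1 • (raiseK Φ * opO Φ .c) := by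
  refine weightedShift_comm Φ (by simp) fun n k l t => ?_
  have := qh_ne q
  have hq := qc_ne q
  have ht := coefA_ne q t
  simp [mul_add, mul_sub, two_mul, mul_two, qh_add, qh_neg, qh_sub, qh_two_eq, coefBeta_eq, qc_zpow_eq_qh]
  field_simp [this]

theorem op_c_raiseN : opO Φ .c * raiseN Φ = qh q 1 • (raiseN Φ * opO Φ .c) := by
  refine weightedShift_comm Φ (by simp) fun n k l t => ?_
  have := qh_ne q
  have hq := qc_ne q
  have ht := coefA_ne q t
  simp [mul_add, mul_sub, two_mul, mul_two, qh_add, qh_neg, qh_sub, qh_two_eq, coefBeta_eq, qc_zpow_eq_qh]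
  field_simp [this]

theorem op_d_opK : opO Φ .d * opK Φ 1 = qh q 1 • (opK Φ 1 * opO Φ .d) := by
  refine weightedShift_comm Φ (by simp) fun n k l t => ?_
  have := qh_ne q
  simp [mul_add, mul_sub, two_mul, mul_two, qh_add, qh_neg, qh_sub, qh_two_eq]
  field_simp [this]

theorem op_d_lowerK : opO Φ .d * lowerK Φ = qh q 1 • (lowerK Φ * opO Φ .d) := by
  refine weightedShift_comm Φ (by simp) fun n k l t => ?_
  have := qh_ne q
  have hq := qc_ne q
  have ht := coefA_ne q t
  simp [mul_add, mul_sub, two_mul, mul_two, qh_add, qh_neg, qh_sub, qh_two_eq, coefBeta_eq, qc_zpow_eq_qh]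
  field_simp [this]

theorem op_d_lowerN (hl : lam q ≠ 0) :
    opO Φ .d * lowerN Φ = qh q 1 • (lowerN Φ * opO Φ .d) - opK Φ (-1) * opO Φ .b := by
  simp only [opO, lowerN, opK, weightedShift_mul, ← map_smul, Prod.mk_add_mk, zero_add, add_zero]
  norm_num only
  rw [← map_sub]
  refine weightedShift_congr Φ rfl fun n k l => ?_
  ext t
  have := qh_ne q
  have hq := qc_ne q
  have ht := coefA_ne q t
  have hl' := lam_eq_qh q
  have hs := coefAlpha_sq q n t
  have hs' := coefAlpha_sq q (n + 1) t
  simp [mul_add, two_mul, qh_add, qh_two_eq, qc_zpow_eq_qh] at hs hs'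
  simp [mul_add, mul_sub, two_mul, mul_two, qh_add, qh_neg, qh_sub, qh_two_eq, coefBeta_eq, qc_zpow_eq_qh]
  field_simp [this] at hs hs' hl' ⊢
  linear_combination hs - hs' + qh q n ^ 4 * coefA q t ^ 2 * hl'

theorem op_d_raiseK : opO Φ .d * raiseK Φ = qh q 1 • (raiseK Φ * opO Φ .d) := by
  refine weightedShift_comm Φ (by simp) fun n k l t => ?_
  have := qh_ne q
  have hq := qc_ne q
  have ht := coefA_ne q t
  simp [mul_add, mul_sub, two_mul, mul_two, qh_add, qh_neg, qh_sub, qh_two_eq, coefBeta_eq, qc_zpow_eq_qh]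
  field_simp [this]

theorem op_d_raiseN : opO Φ .d * raiseN Φ = qh q 1 • (raiseN Φ * opO Φ .d) := by
  refine weightedShift_comm Φ (by simp) fun n k l t => ?_
  have := qh_ne q
  have hq := qc_ne q
  have ht := coefA_ne q t
  simp [mul_add, mul_sub, two_mul, mul_two, qh_add, qh_neg, qh_sub, qh_two_eq, coefBeta_eq, qc_zpow_eq_qh]
  field_simp [this]

theorem opCross_rel (hl : lam q ≠ 0) : CrossRelations q (opU Φ) (opO Φ) where
  aK := op_a_opK Φ
  aE := by
    have h1 := op_a_lowerK Φ
    have h2 := op_a_lowerN Φ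
    simp only [opU, mul_add, add_mul, smul_mul_assoc, mul_smul_comm, smul_add, h1, h2]
    module
  aF := by
    have h1 := op_a_raiseK Φ
    have h2 := op_a_raiseN Φ hl
    simp only [opU, mul_add, add_mul, smul_mul_assoc, mul_smul_comm, smul_add, h1, h2]
    module
  bK := op_b_opK Φ
  bE := by
    have h1 := op_b_lowerK Φ
    have h2 := op_b_lowerN Φ
    simp only [opU, mul_add, add_mul, smul_mul_assoc, mul_smul_comm, smul_add, h1, h2]
    module
  bF := by
    have h1 := op_b_raiseK Φ
    have h2 := op_b_raiseN Φ hl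
    simp only [opU, mul_add, add_mul, smul_mul_assoc, mul_smul_comm, smul_add, h1, h2]
    module
  cK := op_c_opK Φ
  cE := by
    have h1 := op_c_lowerK Φ
    have h2 := op_c_lowerN Φ hl
    simp only [opU, mul_add, add_mul, smul_mul_assoc, mul_smul_comm, smul_add, h1, h2]
    module
  cF := by
    have h1 := op_c_raiseK Φ
    have h2 := op_c_raiseN Φ
    simp only [opU, mul_add, add_mul, smul_mul_assoc, mul_smul_comm, smul_add, h1, h2]
  dK := op_d_opK Φ
  dE := by
    have h1 := op_d_lowerK Φ
    have h2 := op_d_lowerN Φ hl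
    simp only [opU, mul_add, add_mul, smul_mul_assoc, mul_smul_comm, smul_add, h1, h2]
    module
  dF := by
    have h1 := op_d_raiseK Φ
    have h2 := op_d_raiseN Φ
    simp only [opU, mul_add, add_mul, smul_mul_assoc, mul_smul_comm, smul_add, h1, h2]

/-- The representation of the cross product algebra on the algebraic direct sum. -/
noncomputable def seriesHom (hl : lam q ≠ 0) : Cross q →ₐ[ℂ] Module.End ℂ (Idx →₀ M) :=
  Cross.lift (opU_rel Φ) (opO_rel Φ) (opCross_rel Φ hl)

theorem seriesHom_ofU (hl : lam q ≠ 0) (g : UGen) :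
    seriesHom Φ hl (Cross.ofU q (Uq.gen q g)) = opU Φ g := Cross.lift_ofU ..

theorem seriesHom_ofO (hl : lam q ≠ 0) (g : OGen) :
    seriesHom Φ hl (Cross.ofO q (Oq.gen q g)) = opO Φ g := Cross.lift_ofO ..

end Operators

/-! ### Multiplication operators on `L²((q,1], r dμ₀)` -/

section Multiplication
variable (q : RPos) (μ₀ : Measure (Set.Ioc (q : ℝ) 1))

/-- The inclusion of `(q,1]` into `[q,1]`. -/
def iocToIcc (r : Set.Ioc (q : ℝ) 1) : Set.Icc (q : ℝ) 1 := ⟨r, r.2.1.le, r.2.2⟩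

theorem continuous_iocToIcc : Continuous (iocToIcc q) :=
  continuous_subtype_val.subtype_mk _

theorem memLp_coef (f : Coef q) : MemLp (fun r => f (iocToIcc q r)) ⊤ (weighted q μ₀) :=
  memLp_top_of_bound (f.continuous.comp (continuous_iocToIcc q)).measurable.aestronglyMeasurable
    ‖f‖ (Filter.Eventually.of_forall fun _ => f.norm_coe_le_norm _)

/-- The operator of multiplication by a continuous function. -/
noncomputable def mulOp (f : Coef q) : L2q q μ₀ →L[ℂ] L2q q μ₀ :=
  (ContinuousLinearMap.mul ℂ ℂ).holderL (weighted q μ₀) ⊤ 2 2 (memLp_coef q μ₀ f).toLp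

theorem mulOp_coe (f : Coef q) (ζ : L2q q μ₀) :
    mulOp q μ₀ f ζ =ᵐ[weighted q μ₀] fun r => f (iocToIcc q r) * ζ r := by
  refine ((ContinuousLinearMap.mul ℂ ℂ).coeFn_holder (r := 2)
    (memLp_coef q μ₀ f).toLp ζ).trans ?_
  filter_upwards [(memLp_coef q μ₀ f).coeFn_toLp] with r hr
  rw [hr]
  rfl

theorem mulOp_inner (f : Coef q) (ζ η : L2q q μ₀) :
    inner ℂ (mulOp q μ₀ f ζ) η = inner ℂ ζ (mulOp q μ₀ (star f) η) := by
  rw [L2.inner_def, L2.inner_def]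
  refine integral_congr_ae ?_
  filter_upwards [mulOp_coe q μ₀ f ζ, mulOp_coe q μ₀ (star f) η] with r h1 h2
  rw [h1, h2]
  simp
  ring

/-- The multiplication operators as a `*`-homomorphism. -/
noncomputable def mulHom : Coef q →⋆ₐ[ℂ] (L2q q μ₀ →L[ℂ] L2q q μ₀) where
  toFun := mulOp q μ₀
  map_one' := by
    ext1 ζ
    refine Lp.ext ((mulOp_coe q μ₀ 1 ζ).trans (Filter.Eventually.of_forall fun r => ?_))
    simp
  map_mul' f g := by
    ext1 ζ
    refine Lp.ext ?_
    filter_upwards [mulOp_coe q μ₀ (f * g) ζ, mulOp_coe q μ₀ f (mulOp q μ₀ g ζ),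
      mulOp_coe q μ₀ g ζ] with r h1 h2 h3
    rw [h1]
    refine Eq.trans ?_ h2.symm
    rw [h3, ContinuousMap.mul_apply, mul_assoc]
  map_zero' := by
    ext1 ζ
    refine Lp.ext ?_
    filter_upwards [mulOp_coe q μ₀ 0 ζ, Lp.coeFn_zero ℂ 2 (weighted q μ₀)] with r h1 h2
    rw [h1]
    refine Eq.trans ?_ h2.symm
    simp
  map_add' f g := by
    ext1 ζ
    refine Lp.ext ?_
    filter_upwards [mulOp_coe q μ₀ (f + g) ζ, mulOp_coe q μ₀ f ζ, mulOp_coe q μ₀ g ζ,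
      Lp.coeFn_add (mulOp q μ₀ f ζ) (mulOp q μ₀ g ζ)] with r h1 h2 h3 h4
    rw [h1]
    refine Eq.trans ?_ h4.symm
    rw [Pi.add_apply, h2, h3, ContinuousMap.add_apply, add_mul]
  commutes' c := by
    ext1 ζ
    refine Lp.ext ?_
    filter_upwards [mulOp_coe q μ₀ (algebraMap ℂ _ c) ζ, Lp.coeFn_smul c ζ] with r h1 h2
    rw [h1]
    exact h2.symm
  map_star' f := by
    rw [ContinuousLinearMap.star_eq_adjoint, ContinuousLinearMap.eq_adjoint_iff]
    intro ζ η
    rw [mulOp_inner, star_star]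

theorem mulHom_apply (f : Coef q) : mulHom q μ₀ f = mulOp q μ₀ f := rfl

theorem mulHom_coefA : mulHom q μ₀ (coefA q) = mulQ q μ₀ := rfl

/-- The function `t⁻¹`. -/
noncomputable def coefInv : Coef q := coefOfReal q (fun t => t⁻¹) (continuousOn_inv_icc q)

theorem inverse_mulQ : Ring.inverse (mulQ q μ₀) = mulHom q μ₀ (coefInv q) := by
  have h : coefA q * coefInv q = 1 := by
    ext t
    have := (icc_pos t).ne'
    simp [coefA, coefInv, coefOfReal, this]
  rw [← mulHom_coefA]
  have h' : coefInv q * coefA q = 1 := by rw [mul_comm, h]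
  exact Ring.inverse_unit ⟨mulHom q μ₀ (coefA q), mulHom q μ₀ (coefInv q),
    by rw [← map_mul, h, map_one], by rw [← map_mul, h', map_one]⟩

/-- The function `q t⁻¹`. -/
noncomputable def coefB : Coef q :=
  coefOfReal q (fun t => q * t⁻¹) (continuousOn_const.mul (continuousOn_inv_icc q))

theorem qQinv_eq : qQinv q μ₀ = mulHom q μ₀ (coefB q) := by
  rw [qQinv, inverse_mulQ, ← map_smul]
  congr 1
  ext t
  simp [coefInv, coefB, coefOfReal, qc]

theorem isSelfAdjoint_coefOfReal (f : ℝ → ℝ) (hf : ContinuousOn f (Set.Icc (q : ℝ) 1)) :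
    IsSelfAdjoint (coefOfReal q f hf) := by
  ext t
  simp [coefOfReal]

/-- Homomorphisms can only shrink spectra, and in C([q,1]) the spectrum of a function is its range.
-/
theorem spectrum_starHom {K : Type*} [NormedAddCommGroup K] [InnerProductSpace ℂ K]
    [CompleteSpace K] (φ : Coef q →⋆ₐ[ℂ] (K →L[ℂ] K)) (f : ℝ → ℝ)
    (hf : ContinuousOn f (Set.Icc (q : ℝ) 1)) :
    spectrum ℝ (φ (coefOfReal q f hf)) ⊆ f '' Set.Icc (q : ℝ) 1 := by
  intro x hx
  rw [← spectrum.algebraMap_mem_iff ℂ] at hx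
  replace hx := AlgHom.spectrum_apply_subset φ _ hx
  rw [ContinuousMap.spectrum_eq_range] at hx
  obtain ⟨t, ht⟩ := hx
  exact ⟨t, t.2, Complex.ofReal_injective ht⟩

/-- Functional calculus commutes with `*`-homomorphisms, and inside C([q,1]) it is composition, as
one sees by evaluating at each point t. The detour through the complex calculus is made because φ is
a complex `*`-homomorphism. This identifies α_n and β_n of the multiplication operators with
multiplication by explicit functions. -/
theorem cfc_starHom {K : Type*} [NormedAddCommGroup K] [InnerProductSpace ℂ K]
    [CompleteSpace K] (φ : Coef q →⋆ₐ[ℂ] (K →L[ℂ] K)) (f g : ℝ → ℝ)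
    (hf : ContinuousOn f (Set.Icc (q : ℝ) 1)) (hg : ContinuousOn g (f '' Set.Icc (q : ℝ) 1)) :
    cfc g (φ (coefOfReal q f hf)) =
      φ (coefOfReal q (fun t => g (f t)) (hg.comp hf (Set.mapsTo_image _ _))) := by
  have hs := isSelfAdjoint_coefOfReal q f hf
  have hc : ContinuousOn (fun z : ℂ => ((g z.re : ℝ) : ℂ)) (spectrum ℂ (coefOfReal q f hf)) := by
    rw [ContinuousMap.spectrum_eq_range]
    refine Complex.continuous_ofReal.comp_continuousOn
      (hg.comp Complex.continuous_re.continuousOn ?_)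
    rintro _ ⟨t, rfl⟩
    exact ⟨t, t.2, rfl⟩
  have hφ : Continuous φ := AddMonoidHomClass.continuous_of_bound φ 1 fun a => by
    simpa only [one_mul] using NonUnitalStarAlgHom.norm_apply_le φ a
  rw [cfc_real_eq_complex g (hs.map φ),
    ← StarAlgHomClass.map_cfc (S := ℂ) φ _ (coefOfReal q f hf) hc hφ hs.isStarNormal
      (hs.map φ).isStarNormal]
  congr 1
  ext t
  have h := StarAlgHomClass.map_cfc (S := ℂ) (ContinuousMap.evalStarAlgHom ℂ ℂ t)
    (fun z : ℂ => ((g z.re : ℝ) : ℂ)) (coefOfReal q f hf) hc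
    (by exact ContinuousEvalConst.continuous_eval_const t) hs.isStarNormal
    (hs.map _).isStarNormal
  exact h.trans (cfc_algebraMap (A := ℂ) ((f t : ℝ) : ℂ) _)

theorem alpha_mulQ (n : ℤ) : alpha q n (mulQ q μ₀) = mulHom q μ₀ (coefAlpha q n) :=
  cfc_starHom q (mulHom q μ₀) (fun t => t) (fun t => √(1 + (q : ℝ) ^ (2 * n) * t ^ 2))
    continuousOn_id (by fun_prop)

theorem beta_mulQ (n : ℤ) : beta q n (mulQ q μ₀) = mulHom q μ₀ (coefBeta q n) :=
  cfc_starHom q (mulHom q μ₀) (fun t => t) (fun t => √(1 + (q : ℝ) ^ (-2 * n) * (t ^ 2)⁻¹))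
    continuousOn_id (by
      rw [Set.image_id']
      exact (continuousOn_const.add (continuousOn_const.mul (continuousOn_inv_sq_icc q))).sqrt)

theorem alpha_qQinv (k : ℤ) : alpha q k (qQinv q μ₀) = mulHom q μ₀ (coefKappa q k) := by
  rw [qQinv_eq]
  exact cfc_starHom q (mulHom q μ₀) (fun t => q * t⁻¹)
    (fun t => √(1 + (q : ℝ) ^ (2 * k) * t ^ 2)) _ (by fun_prop)

/-- Pointwise (c - f(r)) η(r) = 0 almost everywhere. Only r in the half-open interval matter, which
is how the endpoint eigenvalues get excluded although they may lie in the spectrum. -/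
theorem eq_zero_of_mulHom_eq_smul (f : ℝ → ℝ) (hf : ContinuousOn f (Set.Icc (q : ℝ) 1)) (c : ℝ)
    (hc : ∀ r ∈ Set.Ioc (q : ℝ) 1, f r ≠ c) (η : L2q q μ₀)
    (h : mulHom q μ₀ (coefOfReal q f hf) η = (c : ℂ) • η) : η = 0 := by
  refine Lp.ext ?_
  filter_upwards [mulOp_coe q μ₀ (coefOfReal q f hf) η, Lp.coeFn_smul (c : ℂ) η,
    Lp.coeFn_zero ℂ 2 (weighted q μ₀)] with r h1 h2 h3
  rw [h3]
  rw [mulHom_apply] at h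
  rw [h, h2] at h1
  have h4 : ((c : ℂ) - (f r : ℂ)) * η r = 0 := by
    rw [sub_mul, sub_eq_zero]
    exact h1
  refine (mul_eq_zero.1 h4).resolve_left (sub_ne_zero.2 ?_)
  exact fun h => hc r r.2 (Complex.ofReal_injective h.symm)

/-- Only an inclusion is available: for K = 0, which occurs when μ₀ = 0, the spectrum is empty. -/
theorem spectrum_one_subset {K : Type*} [NormedAddCommGroup K] [InnerProductSpace ℂ K]
    [CompleteSpace K] : spectrum ℝ (1 : K →L[ℂ] K) ⊆ {1} := by
  intro x hx
  by_contra h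
  refine hx ?_
  rw [spectrum.mem_resolventSet_iff, ← map_one (algebraMap ℝ (K →L[ℂ] K)), ← map_sub]
  exact (IsUnit.mk0 _ (sub_ne_zero.2 h)).map _

/-- Because t ↦ q t⁻¹ maps [q,1] to itself, every `*`-representation of C([q,1]) satisfies all the
conditions except the two on eigenvalues of A and B. Those depend on the representation and remain
as hypotheses. -/
theorem i2Params_of_starHom {K : Type*} [NormedAddCommGroup K] [InnerProductSpace ℂ K]
    [CompleteSpace K] (φ : Coef q →⋆ₐ[ℂ] (K →L[ℂ] K)) (hq : (q : ℝ) < 1)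
    (hA : ∀ η, φ (coefA q) η = ((q : ℝ) : ℂ) • η → η = 0)
    (hB : ∀ η, φ (coefB q) η = ((1 : ℝ) : ℂ) • η → η = 0) :
    I2Params q (φ (coefA q)) (φ (coefB q)) 1 1 where
  sign := Or.inl rfl
  selfAdjoint_A := (isSelfAdjoint_coefOfReal q _ _).map φ
  selfAdjoint_B := (isSelfAdjoint_coefOfReal q _ _).map φ
  selfAdjoint_H := IsSelfAdjoint.one _
  comm_AB := (Commute.all _ _).map φ
  comm_AH := Commute.one_right _
  comm_BH := Commute.one_right _
  spec_A := (spectrum_starHom q φ _ _).trans (Set.image_id' _).subset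
  spec_B := by
    refine (spectrum_starHom q φ _ _).trans ?_
    rintro _ ⟨t, ht, rfl⟩
    have hp : 0 < t := q.2.trans_le ht.1
    constructor
    · exact le_mul_of_one_le_right q.2.le ((one_le_inv₀ hp).2 ht.2)
    · exact mul_inv_le_one_of_le₀ ht.1 hp.le
  spec_H := spectrum_one_subset.trans
    (Set.singleton_subset_iff.2 ⟨Real.sqrt_le_one.2 hq.le, le_rfl⟩)
  eig_A η h := hA η h
  eig_B η h := hB η (h.trans (by rw [Complex.ofReal_one, one_smul]))
  eig_H η h := by
    have h1 : (1 - √(q : ℝ)) • η = 0 := by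
      rw [sub_smul, one_smul, sub_eq_zero]
      exact h
    refine (smul_eq_zero.1 h1).resolve_left (sub_ne_zero.2 ?_)
    intro h2
    exact ((Real.sqrt_lt' one_pos).2 (by rwa [one_pow])).ne' h2

theorem i2Params_mulQ (hq : (q : ℝ) < 1) : I2Params q (mulQ q μ₀) (qQinv q μ₀) 1 1 := by
  rw [qQinv_eq]
  refine i2Params_of_starHom q (mulHom q μ₀) hq (fun η h => ?_) (fun η h => ?_)
  · exact eq_zero_of_mulHom_eq_smul q μ₀ _ _ q (fun r hr => hr.1.ne') η h
  · refine eq_zero_of_mulHom_eq_smul q μ₀ _ _ 1 (fun r hr h' => ?_) η h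
    have hp : 0 < r := q.2.trans hr.1
    rw [mul_inv_eq_one₀ hp.ne'] at h'
    exact hr.1.ne h'

theorem mulOp_mem_boundedL2 (f : Coef q) {ζ : L2q q μ₀} (hζ : ζ ∈ boundedL2 q μ₀) :
    mulOp q μ₀ f ζ ∈ boundedL2 q μ₀ :=
  MemLp.ae_eq (mulOp_coe q μ₀ f ζ).symm (MemLp.mul hζ (memLp_coef q μ₀ f))

/-- Simple functions are bounded and already dense. -/
theorem dense_boundedL2 : Dense (boundedL2 q μ₀ : Set (L2q q μ₀)) := by
  have h := Lp.simpleFunc.denseRange (E := ℂ) (p := 2) (μ := weighted q μ₀) (by simp)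
  refine Dense.mono ?_ h
  rintro _ ⟨f, rfl⟩
  exact MemLp.ae_eq (Lp.simpleFunc.toSimpleFunc_eq_toFun f)
    (SimpleFunc.memLp_top _ _)

end Multiplication

/-! ### `*`-representations obtained from algebraic representations -/

section OfInjective
variable {X G H : Type*} [Ring X] [Algebra ℂ X] [StarRing X] [AddCommGroup G] [Module ℂ G]
  [NormedAddCommGroup H] [InnerProductSpace ℂ H] (T : X →ₐ[ℂ] Module.End ℂ G) (J : G →ₗ[ℂ] H)
  (hJ : Function.Injective J) (G₀ : Submodule ℂ G) (hG : ∀ x, ∀ g ∈ G₀, T x g ∈ G₀)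
  (hd : Dense (G₀.map J : Set H))
  (ha : ∀ x g h, inner ℂ (J (T x g)) (J h) = inner ℂ (J g) (J (T (star x) h)))

/-- The `*`-representation on the image of an invariant subspace `G₀` of an algebraic
representation `T` on `G` under an injective linear map `J` into a Hilbert space. -/
noncomputable def StarRep.ofInjective : StarRep X H where
  domain := G₀.map J
  dense := hd
  toHom :=
    { toFun := fun x => (Submodule.equivMapOfInjective J hJ G₀).conj ((T x).restrict (hG x))
      map_one' := by
        refine (congrArg _ (LinearMap.ext fun g => Subtype.ext ?_)).trans
          (Submodule.equivMapOfInjective J hJ G₀).conj_id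
        exact LinearMap.congr_fun (map_one T) (g : G)
      map_mul' := fun x y => by
        refine (congrArg _ (LinearMap.ext fun g => Subtype.ext ?_)).trans
          ((Submodule.equivMapOfInjective J hJ G₀).conj_comp
            ((T y).restrict (hG y)) ((T x).restrict (hG x)))
        exact LinearMap.congr_fun (map_mul T x y) (g : G)
      map_zero' := by
        refine (congrArg _ (LinearMap.ext fun g => Subtype.ext ?_)).trans
          (map_zero (Submodule.equivMapOfInjective J hJ G₀).conj)
        exact LinearMap.congr_fun (map_zero T) (g : G)
      map_add' := fun x y => by
        refine (congrArg _ (LinearMap.ext fun g => Subtype.ext ?_)).trans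
          (map_add (Submodule.equivMapOfInjective J hJ G₀).conj
            ((T x).restrict (hG x)) ((T y).restrict (hG y)))
        exact LinearMap.congr_fun (map_add T x y) (g : G)
      commutes' := fun c => by
        refine (congrArg _ (LinearMap.ext fun g => Subtype.ext ?_)).trans
          ((map_smul (Submodule.equivMapOfInjective J hJ G₀).conj c LinearMap.id).trans
            (congrArg (c • ·) (Submodule.equivMapOfInjective J hJ G₀).conj_id))
        exact LinearMap.congr_fun (AlgHom.commutes T c) (g : G) }
  adjoint := by
    rintro x ⟨_, g, hg, rfl⟩ ⟨_, h, hh, rfl⟩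
    have e : ∀ (f : G) (hf : f ∈ G₀), (Submodule.equivMapOfInjective J hJ G₀).symm
        ⟨J f, Submodule.mem_map_of_mem hf⟩ = ⟨f, hf⟩ := fun f hf => by
      rw [LinearEquiv.symm_apply_eq]; rfl
    change inner ℂ (J ((T x).restrict (hG x) ((Submodule.equivMapOfInjective J hJ G₀).symm
      ⟨J g, _⟩) : G)) (J h) = inner ℂ (J g) (J ((T (star x)).restrict (hG (star x))
      ((Submodule.equivMapOfInjective J hJ G₀).symm ⟨J h, _⟩) : G))
    rw [e g hg, e h hh]
    exact ha x g h

theorem StarRep.ofInjective_maps (x : X) (ξ ζ : H) :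
    (StarRep.ofInjective T J hJ G₀ hG hd ha).Maps x ξ ζ ↔
      ∃ g ∈ G₀, J g = ξ ∧ J (T x g) = ζ := by
  have e : ∀ (f : G) (hf : f ∈ G₀), (Submodule.equivMapOfInjective J hJ G₀).symm
      ⟨J f, Submodule.mem_map_of_mem hf⟩ = ⟨f, hf⟩ := fun f hf => by
    rw [LinearEquiv.symm_apply_eq]; rfl
  have key : ∀ (g : G) (hg : g ∈ G₀), ((StarRep.ofInjective T J hJ G₀ hG hd ha).toHom x
      ⟨J g, Submodule.mem_map_of_mem hg⟩ : H) = J (T x g) := fun g hg => by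
    change J ((T x).restrict (hG x) ((Submodule.equivMapOfInjective J hJ G₀).symm ⟨J g, _⟩) : G) = _
    rw [e g hg]
    rfl
  constructor
  · rintro ⟨⟨g, hg, rfl⟩, h⟩
    exact ⟨g, hg, rfl, (key g hg).symm.trans h⟩
  · rintro ⟨g, hg, rfl, rfl⟩
    exact ⟨Submodule.mem_map_of_mem hg, key g hg⟩

end OfInjective

/-! ### The series of `*`-representations -/

section Series
variable {q : RPos} {K : Type*} [NormedAddCommGroup K] [InnerProductSpace ℂ K]

/-- The inclusion of the algebraic direct sum into the Hilbert space direct sum. -/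
noncomputable def sumIncl (K : Type*) [NormedAddCommGroup K] [InnerProductSpace ℂ K] :
    (Idx →₀ K) →ₗ[ℂ] HSum K :=
  Finsupp.lsum ℂ fun p => lp.lsingle (𝕜 := ℂ) (E := fun _ : Idx => K) 2 p

theorem sumIncl_single (p : Idx) (η : K) :
    sumIncl K (Finsupp.single p η) = lp.single 2 p η := by
  simp [sumIncl]

theorem sumIncl_apply (g : Idx →₀ K) (p : Idx) : sumIncl K g p = g p := by
  induction g using Finsupp.induction_linear with
  | zero => simp
  | add f g hf hg => rw [map_add, lp.coeFn_add, Pi.add_apply, hf, hg, Finsupp.add_apply]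
  | single p' η =>
    rw [sumIncl_single, lp.single_apply, Finsupp.single_apply, Pi.single_apply]
    simp only [eq_comm]

theorem sumIncl_injective : Function.Injective (sumIncl K) := fun f g h => by
  ext p
  rw [← sumIncl_apply, h, sumIncl_apply]

/-- Pairing with a single position reads off one component, which turns formal adjointness into a
statement about individual coefficients. -/
theorem inner_sumIncl_single (p : Idx) (η : K) (g : Idx →₀ K) :
    inner ℂ (sumIncl K (Finsupp.single p η)) (sumIncl K g) = inner ℂ η (g p) := by
  rw [sumIncl_single, lp.inner_single_left, sumIncl_apply]

/-- The finitely supported families with entries in `D₀`. -/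
def entriesIn (D₀ : Submodule ℂ K) : Submodule ℂ (Idx →₀ K) where
  carrier := {g | ∀ p, g p ∈ D₀}
  zero_mem' _ := zero_mem _
  add_mem' hf hg p := add_mem (hf p) (hg p)
  smul_mem' c _ hg p := Submodule.smul_mem _ c (hg p)

theorem single_mem_entriesIn {D₀ : Submodule ℂ K} (p : Idx) {η : K} (hη : η ∈ D₀) :
    Finsupp.single p η ∈ entriesIn D₀ := fun p' => by
  rw [Finsupp.single_apply]
  split_ifs
  · exact hη
  · exact zero_mem _

theorem entriesIn_eq_span (D₀ : Submodule ℂ K) :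
    entriesIn D₀ = Submodule.span ℂ {g | ∃ p, ∃ η ∈ D₀, g = Finsupp.single p η} := by
  apply le_antisymm
  · intro g hg
    rw [← Finsupp.sum_single g]
    exact Submodule.sum_mem _ fun p _ => Submodule.subset_span ⟨p, g p, hg p, rfl⟩
  · rw [Submodule.span_le]
    rintro _ ⟨p, η, hη, rfl⟩
    exact single_mem_entriesIn p hη

theorem map_entriesIn (D₀ : Submodule ℂ K) : (entriesIn D₀).map (sumIncl K) =
    Submodule.span ℂ {ξ | ∃ n k l, ∃ η ∈ D₀, ξ = vec n k l η} := by
  rw [entriesIn_eq_span, Submodule.map_span]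
  congr 1
  ext ξ
  constructor
  · rintro ⟨_, ⟨⟨n, k, l⟩, η, hη, rfl⟩, rfl⟩
    exact ⟨n, k, l, η, hη, sumIncl_single _ _⟩
  · rintro ⟨n, k, l, η, hη, rfl⟩
    exact ⟨_, ⟨(n, k, l), η, hη, rfl⟩, sumIncl_single _ _⟩

theorem dense_map_entriesIn {D₀ : Submodule ℂ K} (hD : Dense (D₀ : Set K)) :
    Dense ((entriesIn D₀).map (sumIncl K) : Set (HSum K)) := by
  intro ξ
  rw [← Submodule.topologicalClosure_coe]
  -- A vector is the limit of its finite partial sums, and each component is approximated separately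
  -- from D₀.
  refine (Submodule.isClosed_topologicalClosure _).mem_of_tendsto
    (lp.hasSum_single (by simp) ξ) (Filter.Eventually.of_forall fun s => ?_)
  refine Submodule.sum_mem _ fun p _ => ?_
  exact map_mem_closure (lp.singleContinuousLinearMap ℂ (fun _ : Idx => K) 2 p).continuous
    (hD (ξ p)) fun η hη => ⟨_, single_mem_entriesIn p hη, sumIncl_single p η⟩

/-- The linear maps from `K` to the algebraic direct sum with finitely many components, all of
them bounded. -/
noncomputable def boundedColumns (K : Type*) [NormedAddCommGroup K] [InnerProductSpace ℂ K] :
    Submodule ℂ (K →ₗ[ℂ] (Idx →₀ K)) :=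
  Submodule.span ℂ {L | ∃ (p : Idx) (S : K →L[ℂ] K), L = (Finsupp.lsingle p).comp S.toLinearMap}

theorem lsingle_mem_boundedColumns (p : Idx) : Finsupp.lsingle p ∈ boundedColumns K :=
  Submodule.subset_span ⟨p, ContinuousLinearMap.id ℂ K, rfl⟩

/-- The represented elements may be unbounded on the whole sum, since the weights grow with the
position; restricted to one position they are continuous, which is all that the comparison of
closures needs. -/
theorem continuous_of_mem_boundedColumns {L : K →ₗ[ℂ] (Idx →₀ K)} (hL : L ∈ boundedColumns K) :
    Continuous fun η => sumIncl K (L η) := by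
  induction hL using Submodule.span_induction with
  | mem L h =>
    obtain ⟨p, S, rfl⟩ := h
    have h := (lp.singleContinuousLinearMap ℂ (fun _ : Idx => K) 2 p).continuous.comp S.continuous
    refine h.congr fun η => ?_
    exact (sumIncl_single p (S η)).symm
  | zero => simpa using continuous_const
  | add L L' _ _ h h' =>
    simp only [LinearMap.add_apply, map_add]
    exact h.add h'
  | smul c L _ h =>
    simp only [LinearMap.smul_apply, map_smul]
    exact h.const_smul c

/-- `T` is a formal adjoint of `S`. -/
def FormalAdjoint (S T : Module.End ℂ (Idx →₀ K)) : Prop :=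
  ∀ g h, inner ℂ (sumIncl K (S g)) (sumIncl K h) = inner ℂ (sumIncl K g) (sumIncl K (T h))

namespace FormalAdjoint
variable {S T S' T' : Module.End ℂ (Idx →₀ K)}

theorem symm (h : FormalAdjoint S T) : FormalAdjoint T S := fun g g' => by
  rw [← inner_conj_symm, ← h, inner_conj_symm]

theorem add (h : FormalAdjoint S T) (h' : FormalAdjoint S' T') :
    FormalAdjoint (S + S') (T + T') := fun g g' => by
  simp only [LinearMap.add_apply, map_add, inner_add_left, inner_add_right]
  rw [h, h']

theorem mul (h : FormalAdjoint S T) (h' : FormalAdjoint S' T') :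
    FormalAdjoint (S * S') (T' * T) := fun g g' => by
  rw [Module.End.mul_apply, Module.End.mul_apply, h, h']

theorem smul (h : FormalAdjoint S T) (c : ℂ) :
    FormalAdjoint (c • S) ((starRingEnd ℂ) c • T) := fun g g' => by
  simp only [LinearMap.smul_apply, map_smul, inner_smul_left, inner_smul_right]
  rw [h]

theorem one : FormalAdjoint (1 : Module.End ℂ (Idx →₀ K)) 1 := fun _ _ => rfl
end FormalAdjoint

/-! ### The `*`-representations attached to a `*`-homomorphism from C([q,1]). -/

section Operators
variable [CompleteSpace K] (φ : Coef q →⋆ₐ[ℂ] (K →L[ℂ] K))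

/-- The representation of the coefficient ring underlying a `*`-representation. -/
noncomputable def toEnd : Coef q →ₐ[ℂ] Module.End ℂ K :=
  { ContinuousLinearMap.toLinearMapRingHom.comp (φ : Coef q →+* (K →L[ℂ] K)) with
    commutes' := fun c => congrArg ContinuousLinearMap.toLinearMap (AlgHomClass.commutes φ c) }

theorem toEnd_apply (f : Coef q) (η : K) : toEnd φ f η = φ f η := rfl

theorem inner_toEnd (f : Coef q) (ζ η : K) :
    inner ℂ (toEnd φ f ζ) η = inner ℂ ζ (toEnd φ (star f) η) := by
  rw [toEnd_apply, toEnd_apply, map_star, ContinuousLinearMap.star_eq_adjoint,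
    ContinuousLinearMap.adjoint_inner_right]

/-- The adjoint of a shift by σ shifts back by -σ, and its coefficient at the target position is the
conjugate of the coefficient at the source. -/
theorem formalAdjoint_weightedShift {σ τ : Idx} {c d : Idx → Coef q} (h : σ + τ = 0)
    (h' : ∀ n k l t, d ((n, k, l) + σ) t = (starRingEnd ℂ) (c (n, k, l) t)) :
    FormalAdjoint (weightedShift (toEnd φ) σ c) (weightedShift (toEnd φ) τ d) := by
  intro g g'
  induction g using Finsupp.induction_linear with
  | zero => simp
  | add f g hf hg => simp only [map_add, inner_add_left, hf, hg]
  | single p η =>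
    have hd : d (p + σ) = star (c p) := ContinuousMap.ext (h' p.1 p.2.1 p.2.2)
    have hσ : p - τ = p + σ := by rw [eq_neg_of_add_eq_zero_left h, sub_eq_add_neg]
    rw [weightedShift_single, inner_sumIncl_single, inner_sumIncl_single, weightedShift_apply, hσ,
      hd, inner_toEnd]

theorem weightedShift_mem_boundedColumns (σ : Idx) (c : Idx → Coef q) {L : K →ₗ[ℂ] (Idx →₀ K)}
    (hL : L ∈ boundedColumns K) :
    (weightedShift (toEnd φ) σ c).comp L ∈ boundedColumns K := by
  induction hL using Submodule.span_induction with
  | mem L h =>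
    obtain ⟨p, S, rfl⟩ := h
    refine Submodule.subset_span ⟨p + σ, (φ (c p)).comp S, ?_⟩
    ext1 η
    exact weightedShift_single ..
  | zero => rw [LinearMap.comp_zero]; exact zero_mem _
  | add L L' _ _ h h' => rw [LinearMap.comp_add]; exact add_mem h h'
  | smul z L _ h => rw [LinearMap.comp_smul]; exact Submodule.smul_mem _ _ h

theorem weightedShift_mem_entriesIn {D₀ : Submodule ℂ K} (hD : ∀ f, ∀ η ∈ D₀, φ f η ∈ D₀)
    (σ : Idx) (c : Idx → Coef q) {g : Idx →₀ K} (hg : g ∈ entriesIn D₀) :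
    weightedShift (toEnd φ) σ c g ∈ entriesIn D₀ := fun p => by
  rw [weightedShift_apply]
  exact hD _ _ (hg _)

theorem coefKappa_conj (k : ℤ) (t : Set.Icc (q : ℝ) 1) :
    (starRingEnd ℂ) (coefKappa q k t) = coefKappa q k t := Complex.conj_ofReal _

theorem coefBeta_conj (n : ℤ) (t : Set.Icc (q : ℝ) 1) :
    (starRingEnd ℂ) (coefBeta q n t) = coefBeta q n t := Complex.conj_ofReal _

theorem coefAlpha_conj (n : ℤ) (t : Set.Icc (q : ℝ) 1) :
    (starRingEnd ℂ) (coefAlpha q n t) = coefAlpha q n t := Complex.conj_ofReal _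

theorem coefA_conj (t : Set.Icc (q : ℝ) 1) :
    (starRingEnd ℂ) (coefA q t) = coefA q t := Complex.conj_ofReal _

theorem formalAdjoint_raiseK : FormalAdjoint (raiseK (toEnd φ)) (lowerK (toEnd φ)) := by
  refine formalAdjoint_weightedShift φ (by simp) fun n k l t => ?_
  have := qh_ne q
  simp only [Prod.mk_add_mk, ContinuousMap.smul_apply, smul_eq_mul, map_mul, map_inv₀, conj_lam,
    conj_qh, coefKappa_conj, add_zero]
  congr 3
  ring

theorem formalAdjoint_raiseN : FormalAdjoint (raiseN (toEnd φ)) (lowerN (toEnd φ)) := by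
  refine formalAdjoint_weightedShift φ (by simp) fun n k l t => ?_
  have := qh_ne q
  simp only [Prod.mk_add_mk, ContinuousMap.smul_apply, smul_eq_mul, map_mul, map_inv₀, conj_lam,
    conj_qh, coefBeta_conj, add_zero]
  congr 3
  ring

theorem formalAdjoint_opK (e : ℤ) : FormalAdjoint (opK (toEnd φ) e) (opK (toEnd φ) e) :=
  formalAdjoint_weightedShift φ (by simp) fun n k l t => by simp [conj_qh]

theorem formalAdjoint_a : FormalAdjoint (opO (toEnd φ) .a) (opO (toEnd φ) .d) :=
  formalAdjoint_weightedShift φ (by simp) fun n k l t => by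
    simp [coefAlpha_conj]

theorem formalAdjoint_b : FormalAdjoint (opO (toEnd φ) .b) (qc q • opO (toEnd φ) .c) := by
  rw [opO, opO, ← map_smul]
  refine formalAdjoint_weightedShift φ (by simp) fun n k l t => ?_
  simp [coefA_conj, conj_qc, zpow_add₀ (qc_ne q)]
  ring

/-- Membership of the images of all generators gives membership of all images. -/
theorem seriesHom_induction (hl : lam q ≠ 0) {P : Module.End ℂ (Idx →₀ K) → Prop}
    (hs : ∀ σ c, P (weightedShift (toEnd φ) σ c)) (hm : ∀ S T, P S → P T → P (S * T))
    (ha : ∀ S T, P S → P T → P (S + T)) (x : Cross q) : P (seriesHom (toEnd φ) hl x) := by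
  induction x using Cross.induction with
  | hc c =>
    rw [AlgHom.commutes, Algebra.algebraMap_eq_smul_one, ← weightedShift_one (toEnd φ), ← map_smul]
    exact hs _ _
  | hu g =>
    rw [seriesHom_ofU]
    cases g
    · rw [opU, smul_add, lowerK, lowerN, ← map_smul, ← map_smul]
      exact ha _ _ (hs _ _) (hs _ _)
    · exact ha _ _ (hs _ _) (hs _ _)
    · exact hs _ _
    · exact hs _ _
  | ho g =>
    rw [seriesHom_ofO]
    cases g <;> exact hs _ _
  | hm x y hx hy => rw [map_mul]; exact hm _ _ hx hy
  | ha x y hx hy => rw [map_add]; exact ha _ _ hx hy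

theorem seriesHom_mem_entriesIn (hl : lam q ≠ 0) {D₀ : Submodule ℂ K}
    (hD : ∀ f, ∀ η ∈ D₀, φ f η ∈ D₀) (x : Cross q) :
    ∀ g ∈ entriesIn D₀, seriesHom (toEnd φ) hl x g ∈ entriesIn D₀ := by
  refine seriesHom_induction φ hl (P := fun S => ∀ g ∈ entriesIn D₀, S g ∈ entriesIn D₀)
    (fun σ c g hg => weightedShift_mem_entriesIn φ hD σ c hg)
    (fun S T hS hT g hg => hS _ (hT g hg)) (fun S T hS hT g hg => add_mem (hS g hg) (hT g hg)) x

/-- The property is phrased as stability of the whole class of bounded columns, since that form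
passes to products and sums of weighted shifts. -/
theorem seriesHom_mem_boundedColumns (hl : lam q ≠ 0) (x : Cross q) :
    ∀ L ∈ boundedColumns K, (seriesHom (toEnd φ) hl x).comp L ∈ boundedColumns K := by
  refine seriesHom_induction φ hl
    (P := fun S => ∀ L ∈ boundedColumns K, S.comp L ∈ boundedColumns K)
    (fun σ c L hL => weightedShift_mem_boundedColumns φ σ c hL)
    (fun S T hS hT L hL => ?_) (fun S T hS hT L hL => ?_) x
  · exact hS _ (hT L hL)
  · exact add_mem (hS L hL) (hT L hL)

/-- Formal adjoints behave under scalars, sums and products as the involution does, so only the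
generators need checking: raising and lowering parts pair up, a with d, b with qc, and K with
itself. -/
theorem formalAdjoint_seriesHom (hl : lam q ≠ 0) (x : Cross q) :
    FormalAdjoint (seriesHom (toEnd φ) hl x) (seriesHom (toEnd φ) hl (star x)) := by
  induction x using Cross.induction with
  | hc c =>
    rw [Cross.star_algebraMap, AlgHom.commutes, AlgHom.commutes, Algebra.algebraMap_eq_smul_one,
      Algebra.algebraMap_eq_smul_one]
    exact FormalAdjoint.one.smul c
  | hm x y hx hy =>
    rw [star_mul, map_mul, map_mul]
    exact hx.mul hy
  | ha x y hx hy =>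
    rw [star_add, map_add, map_add]
    exact hx.add hy
  | hu g =>
    -- The scalar -1 undoes the sign built into E, leaving the sum of the lowering parts. The case
    -- of E follows from this one by symmetry.
    have h2 : FormalAdjoint (opU (toEnd φ) .F) ((-1 : ℂ) • opU (toEnd φ) .E) := by
      have h := (formalAdjoint_raiseK φ).add (formalAdjoint_raiseN φ)
      rwa [opU, opU, smul_smul, neg_one_mul, neg_neg, one_smul]
    cases g
    · rw [Cross.star_E, map_neg, seriesHom_ofU, seriesHom_ofU,
        ← neg_one_smul ℂ (opU (toEnd φ) UGen.F)]
      have h3 := h2.symm.smul (-1)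
      rwa [smul_smul, neg_one_mul, neg_neg, one_smul, map_neg, map_one] at h3
    · rw [Cross.star_F, map_neg, seriesHom_ofU, seriesHom_ofU,
        ← neg_one_smul ℂ (opU (toEnd φ) UGen.E)]
      exact h2
    · rw [Cross.star_K, seriesHom_ofU]
      exact formalAdjoint_opK φ 1
    · rw [Cross.star_Ki, seriesHom_ofU]
      exact formalAdjoint_opK φ (-1)
  | ho g =>
    cases g
    · rw [Cross.star_a, seriesHom_ofO, seriesHom_ofO]
      exact formalAdjoint_a φ
    · rw [Cross.star_b, map_smul, seriesHom_ofO, seriesHom_ofO]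
      exact formalAdjoint_b φ
    · rw [Cross.star_c, map_smul, seriesHom_ofO, seriesHom_ofO]
      have h3 := (formalAdjoint_b φ).symm.smul (qc q)⁻¹
      rwa [smul_smul, inv_mul_cancel₀ (qc_ne q), one_smul, map_inv₀, conj_qc] at h3
    · rw [Cross.star_d, seriesHom_ofO, seriesHom_ofO]
      exact (formalAdjoint_a φ).symm

/-- The `*`-representation on the span of the vectors `η_{nkl}` with `η ∈ D₀`. -/
noncomputable def seriesRep (hl : lam q ≠ 0) (D₀ : Submodule ℂ K)
    (hD : ∀ f, ∀ η ∈ D₀, φ f η ∈ D₀) (hd : Dense (D₀ : Set K)) : StarRep (Cross q) (HSum K) :=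
  StarRep.ofInjective (seriesHom (toEnd φ) hl) (sumIncl K) sumIncl_injective (entriesIn D₀)
    (seriesHom_mem_entriesIn φ hl hD) (dense_map_entriesIn hd)
    (fun x => formalAdjoint_seriesHom φ hl x)

variable (hl : lam q ≠ 0) {D₀ : Submodule ℂ K} (hD : ∀ f, ∀ η ∈ D₀, φ f η ∈ D₀)
  (hd : Dense (D₀ : Set K))

theorem seriesRep_maps (x : Cross q) (ξ ζ : HSum K) : (seriesRep φ hl D₀ hD hd).Maps x ξ ζ ↔
    ∃ g ∈ entriesIn D₀, sumIncl K g = ξ ∧ sumIncl K (seriesHom (toEnd φ) hl x g) = ζ :=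
  StarRep.ofInjective_maps ..

theorem seriesRep_maps_vec (x : Cross q) {n k l : ℤ} {η : K} (hη : η ∈ D₀) {ζ : HSum K}
    (h : sumIncl K (seriesHom (toEnd φ) hl x (Finsupp.single (n, k, l) η)) = ζ) :
    (seriesRep φ hl D₀ hD hd).Maps x (vec n k l η) ζ :=
  (seriesRep_maps φ hl hD hd x _ _).2 ⟨_, single_mem_entriesIn _ hη, sumIncl_single _ _, h⟩

/-- By linearity it suffices to approximate the graph point of a single vector η_p. For fixed p both
of its coordinates depend continuously on η, and η is a limit of vectors in D₀. -/
theorem closure_graph_seriesRep (x : Cross q) {D₁ : Submodule ℂ K}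
    (hD₁ : ∀ f, ∀ η ∈ D₁, φ f η ∈ D₁) (hd₁ : Dense (D₁ : Set K)) :
    (seriesRep φ hl D₁ hD₁ hd₁).graph x ⊆ closure ((seriesRep φ hl D₀ hD hd).graph x) := by
  have h0 : (seriesRep φ hl D₀ hD hd).graph x = (entriesIn D₀).map
      ((sumIncl K).prod ((sumIncl K).comp (seriesHom (toEnd φ) hl x))) := by
    ext p
    refine (seriesRep_maps φ hl hD hd x _ _).trans ?_
    simp [Prod.ext_iff]
  rintro ⟨_, _⟩ h
  obtain ⟨g, -, rfl, rfl⟩ := (seriesRep_maps φ hl hD₁ hd₁ x _ _).1 h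
  rw [h0, ← Submodule.topologicalClosure_coe, SetLike.mem_coe]
  clear h
  induction g using Finsupp.induction_linear with
  | zero => simp only [map_zero]; exact zero_mem _
  | add f g hf hg => simp only [map_add]; exact add_mem hf hg
  | single p η =>
    have hc : Continuous fun η : K => (sumIncl K (Finsupp.single p η),
        sumIncl K (seriesHom (toEnd φ) hl x (Finsupp.single p η))) :=
      (continuous_of_mem_boundedColumns (lsingle_mem_boundedColumns p)).prodMk
        (continuous_of_mem_boundedColumns
          (seriesHom_mem_boundedColumns φ hl x _ (lsingle_mem_boundedColumns p)))
    exact map_mem_closure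
      (f := fun η : K => (sumIncl K (Finsupp.single p η),
        sumIncl K (seriesHom (toEnd φ) hl x (Finsupp.single p η)))) hc (hd η)
      fun η hη => ⟨_, single_mem_entriesIn p hη, rfl⟩

theorem closure_graph_seriesRep_eq (x : Cross q) {D₁ : Submodule ℂ K}
    (hD₁ : ∀ f, ∀ η ∈ D₁, φ f η ∈ D₁) (hd₁ : Dense (D₁ : Set K)) :
    closure ((seriesRep φ hl D₀ hD hd).graph x) =
      closure ((seriesRep φ hl D₁ hD₁ hd₁).graph x) :=
  (closure_minimal (closure_graph_seriesRep φ hl hD₁ hd₁ x hD hd) isClosed_closure).antisymm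
    (closure_minimal (closure_graph_seriesRep φ hl hD hd x hD₁ hd₁) isClosed_closure)

end Operators
end Series

theorem lam_ne {q : RPos} (hq : (q : ℝ) < 1) : lam q ≠ 0 := by
  have h : (q : ℝ) - (q : ℝ)⁻¹ ≠ 0 := sub_ne_zero.2 (hq.trans ((one_lt_inv₀ q.2).2 hq)).ne
  have h' := Complex.ofReal_ne_zero.2 h
  push_cast at h'
  exact h'

/-- The representation attached to the multiplication operator satisfies the formulas of the
series with parameters `A = Q`, `B = q Q⁻¹`, `H = 1`, `ε = 1`. -/
theorem isSeriesI2_seriesRep (q : RPos) (hq : (q : ℝ) < 1) (μ₀ : Measure (Set.Ioc (q : ℝ) 1))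
    (hl : lam q ≠ 0) (D₀ : Submodule ℂ (L2q q μ₀)) (hD : ∀ f, ∀ η ∈ D₀, mulHom q μ₀ f η ∈ D₀)
    (hd : Dense (D₀ : Set (L2q q μ₀))) :
    IsSeriesI2 (seriesRep (mulHom q μ₀) hl D₀ hD hd) D₀ (mulQ q μ₀) (qQinv q μ₀) 1 1 where
  params := i2Params_mulQ q μ₀ hq
  domain_eq := map_entriesIn D₀
  a n k l η hη := by
    refine seriesRep_maps_vec _ hl hD hd _ hη ?_
    rw [seriesHom_ofO, opO, weightedShift_single, sumIncl_single, alpha_mulQ]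
    simp [vec, toEnd_apply, sub_eq_add_neg]
  d n k l η hη := by
    refine seriesRep_maps_vec _ hl hD hd _ hη ?_
    rw [seriesHom_ofO, opO, weightedShift_single, sumIncl_single, alpha_mulQ]
    simp [vec, toEnd_apply]
  b n k l η hη := by
    refine seriesRep_maps_vec _ hl hD hd _ hη ?_
    rw [seriesHom_ofO, opO, weightedShift_single, sumIncl_single, ← mulHom_coefA]
    simp [vec, toEnd_apply, lp.single_smul]
  c n k l η hη := by
    refine seriesRep_maps_vec _ hl hD hd _ hη ?_
    rw [seriesHom_ofO, opO, weightedShift_single, sumIncl_single, ← mulHom_coefA]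
    simp [vec, toEnd_apply, lp.single_smul, sub_eq_add_neg]
  F n k l η hη := by
    refine seriesRep_maps_vec _ hl hD hd _ hη ?_
    rw [seriesHom_ofU, opU, raiseK, raiseN, LinearMap.add_apply, weightedShift_single,
      weightedShift_single, map_add, sumIncl_single, sumIncl_single, alpha_qQinv, beta_mulQ,
      Ring.inverse_one]
    simp [vec, toEnd_apply, lp.single_smul, sub_eq_add_neg]
  E n k l η hη := by
    refine seriesRep_maps_vec _ hl hD hd _ hη ?_
    rw [seriesHom_ofU, opU, lowerK, lowerN, LinearMap.smul_apply, LinearMap.add_apply,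
      weightedShift_single, weightedShift_single, map_smul, map_add, sumIncl_single,
      sumIncl_single, alpha_qQinv, beta_mulQ, Ring.inverse_one]
    simp [vec, toEnd_apply, lp.single_smul, sub_eq_add_neg]
  K n k l η hη := by
    refine seriesRep_maps_vec _ hl hD hd _ hη ?_
    rw [seriesHom_ofU, opU, opK, weightedShift_single, sumIncl_single]
    simp [vec, toEnd_apply, lp.single_smul]

/-! ### The functional `h_{μ₀}` -/

/-- For n ≠ 0, translation by half a period of the character changes its sign and preserves the
integral. -/
theorem integral_fourier (n : ℤ) :
    ∫ s : UnitAddCircle, fourier n s = if n = 0 then 1 else 0 := by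
  split_ifs with h
  · subst h
    simp [measureReal_def, UnitAddCircle.measure_univ]
  · refine integral_eq_zero_of_add_right_eq_neg (g := ((1 / 2 / n : ℝ) : UnitAddCircle)) ?_
    exact fourier_add_half_inv_index h one_pos

theorem torusInt_eq (n k : ℤ) : torusInt n k = if n = 0 ∧ k = 0 then 1 else 0 := by
  simp only [torusInt, integral_const_mul, integral_mul_const, integral_fourier]
  split_ifs <;> simp_all

theorem F0.induction {q : RPos} {p : F0 q → Prop} (x : F0 q) (h0 : p 0)
    (hm : ∀ n k (f : LBc q), p ⟨mono q n k f, mono_mem f.2 n k⟩)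
    (hs : ∀ (c : ℂ) x, p x → p (c • x)) (ha : ∀ x y, p x → p y → p (x + y)) : p x := by
  obtain ⟨x, hx⟩ := x
  induction (show x ∈ F0span q from hx) using Submodule.span_induction with
  | zero => exact h0
  | add y y' hy hy' h h' => exact ha ⟨y, hy⟩ ⟨y', hy'⟩ (h hy) (h' hy')
  | smul c y hy h => exact hs c ⟨y, hy⟩ (h hy)
  | mem y hy =>
    obtain ⟨n, k, f, hf, rfl⟩ := hy
    exact hm n k ⟨f, hf⟩

instance (q : RPos) (μ₀ : Measure (Set.Ioc (q : ℝ) 1)) [IsFiniteMeasure μ₀] :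
    IsFiniteMeasure (weighted q μ₀) := by
  refine isFiniteMeasure_withDensity (ne_of_lt ?_)
  refine (lintegral_mono (g := fun _ => 1) fun r => ?_).trans_lt (by simp)
  exact ENNReal.ofReal_le_one.2 r.2.2

theorem integral_weighted (q : RPos) (μ₀ : Measure (Set.Ioc (q : ℝ) 1))
    (f : Set.Ioc (q : ℝ) 1 → ℂ) :
    ∫ s, f s ∂(weighted q μ₀) = ∫ s, f s * ((s : ℝ) : ℂ) ∂μ₀ := by
  have hm : Measurable fun r : Set.Ioc (q : ℝ) 1 => ENNReal.ofReal (r : ℝ) :=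
    ENNReal.measurable_ofReal.comp measurable_subtype_coe
  rw [weighted, integral_withDensity_eq_integral_toReal_smul hm
    (Filter.Eventually.of_forall fun _ => ENNReal.ofReal_lt_top)]
  refine integral_congr_ae (Filter.Eventually.of_forall fun s => ?_)
  change (ENNReal.ofReal (s : ℝ)).toReal • f s = _
  rw [ENNReal.toReal_ofReal (q.2.trans s.2.1).le, Complex.real_smul, mul_comm]

section Radial
variable (q : RPos) (μ₀ : Measure (Set.Ioc (q : ℝ) 1)) [IsFiniteMeasure μ₀]

/-- Splitting into shells, one factor q^m is the weight of μ on the shell m and the other comes from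
r = q^m s. -/
theorem hasSum_radialInt (f : LBc q) :
    HasSum (fun m : ℤ => qc q ^ (2 * m) * ∫ s, f.1 (shell q m s) ∂(weighted q μ₀))
      (radialInt q μ₀ f) := by
  have h := hasSum_integral_measure (integrable_of_mem q μ₀ f.2)
  refine Eq.subst (motive := fun g => HasSum g (radialInt q μ₀ f)) (funext fun m => ?_) h
  have hq : (0 : ℝ) < (q : ℝ) ^ m := zpow_pos q.2 m
  have hm : AEStronglyMeasurable (fun r : RPos => f.1 r * ((r : ℝ) : ℂ)) (μ₀.map (shell q m)) :=
    (f.1.2.1.mul (Complex.measurable_ofReal.comp measurable_subtype_coe)).aestronglyMeasurable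
  rw [integral_smul_measure, integral_map (measurable_shell q m).aemeasurable hm,
    integral_weighted, ENNReal.toReal_ofReal hq.le, Complex.real_smul, two_mul,
    zpow_add₀ (qc_ne q), mul_assoc, ← integral_const_mul (qc q ^ m)]
  congr 1
  · simp [qc]
  · refine integral_congr_ae (Filter.Eventually.of_forall fun s => ?_)
    simp [shell, qc]
    ring

theorem shell_add (m k : ℤ) (s : Set.Ioc (q : ℝ) 1) : q ^ k * shell q m s = shell q (m + k) s := by
  rw [shell, shell, ← mul_assoc, ← zpow_add, add_comm]

/-- Dilation by q^k permutes the shells, so reindexing the sum over m produces the scaling factor.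
This is the only property of μ that invariance uses. -/
theorem radialInt_shift (f : LBc q) (k : ℤ) :
    radialInt q μ₀ ⟨LB.shift q k f, LBc.shift_mem f.2 k⟩ =
      qc q ^ (-2 * k) * radialInt q μ₀ f := by
  have h := (hasSum_radialInt q μ₀ f).mul_left (qc q ^ (-2 * k))
  rw [← (Equiv.addRight k).hasSum_iff] at h
  refine (hasSum_radialInt q μ₀ ⟨LB.shift q k f, LBc.shift_mem f.2 k⟩).unique ?_
  refine Eq.subst (motive := fun g => HasSum g _) (funext fun m => ?_) h
  simp only [Function.comp_apply, Equiv.coe_addRight, ← mul_assoc, ← zpow_add₀ (qc_ne q),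
    LB.shift_apply, shell_add]
  congr 2
  ring

theorem haar_mono_eq (n k : ℤ) (f : LBc q) : haar q μ₀ ⟨mono q n k f, mono_mem f.2 n k⟩ =
    if n = 0 ∧ k = 0 then radialInt q μ₀ f else 0 := by
  rw [haar_mono q μ₀ n k f.2, torusInt_eq, ite_mul, one_mul, zero_mul]
  rfl

theorem haar_eq_zero_of_ne {n k : ℤ} {f : LB q} (hf : f ∈ LBc q) (h : ¬(n = 0 ∧ k = 0)) :
    haar q μ₀ ⟨mono q n k f, mono_mem hf n k⟩ = 0 := by
  rw [haar_mono_eq q μ₀ n k ⟨f, hf⟩, if_neg h]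

end Radial

/-! ### The action on `F_0(SU_q(1,1))` -/

section Action
variable {q : RPos}

theorem act_gen (x : FAlg q) (g : UGen) : act q x (Uq.gen q g) = actGen q g x := by
  rw [act, actHom, Uq.lift_gen]
  rfl

theorem coe_actF0_gen (x : F0 q) (g : UGen) :
    (actF0 x (Uq.gen q g) : FAlg q) = actGen q g x := act_gen _ _

theorem actF0_add_left (x y : F0 q) (f : Uq q) : actF0 (x + y) f = actF0 x f + actF0 y f :=
  Subtype.ext (map_add (unop (actHom q f)) (x : FAlg q) y)

theorem actF0_smul_left (c : ℂ) (x : F0 q) (f : Uq q) : actF0 (c • x) f = c • actF0 x f :=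
  Subtype.ext (map_smul (unop (actHom q f)) c (x : FAlg q))

theorem actF0_zero_left (f : Uq q) : actF0 (0 : F0 q) f = 0 :=
  Subtype.ext (map_zero (unop (actHom q f)))

theorem actF0_add (x : F0 q) (f g : Uq q) : actF0 x (f + g) = actF0 x f + actF0 x g :=
  Subtype.ext (DFunLike.congr_fun (congrArg unop (map_add (actHom q) f g)) (x : FAlg q))

theorem actF0_mul (x : F0 q) (f g : Uq q) : actF0 x (f * g) = actF0 (actF0 x f) g :=
  Subtype.ext (DFunLike.congr_fun (congrArg unop (map_mul (actHom q) f g)) (x : FAlg q))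

theorem actF0_smul (x : F0 q) (c : ℂ) (f : Uq q) : actF0 x (c • f) = c • actF0 x f :=
  Subtype.ext (DFunLike.congr_fun (congrArg unop (map_smul (actHom q) c f)) (x : FAlg q))

theorem actF0_neg (x : F0 q) (f : Uq q) : actF0 x (-f) = -actF0 x f :=
  Subtype.ext (DFunLike.congr_fun (congrArg unop (map_neg (actHom q) f)) (x : FAlg q))

theorem actF0_one (x : F0 q) : actF0 x 1 = x :=
  Subtype.ext (DFunLike.congr_fun (congrArg unop (map_one (actHom q))) (x : FAlg q))

theorem actF0_algebraMap (x : F0 q) (c : ℂ) : actF0 x (algebraMap ℂ (Uq q) c) = c • x := by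
  rw [Algebra.algebraMap_eq_smul_one, actF0_smul, actF0_one]

end Action

/-! ### Invariance of the functional. -/

section Invariance
variable (q : RPos) (μ₀ : Measure (Set.Ioc (q : ℝ) 1)) [IsFiniteMeasure μ₀]

/-- The cancellation pattern common to E and F: a function plus a multiple of its own dilate, with
coefficients balanced against the scaling of the integral. -/
theorem radialInt_smul_add_shift (c d : ℂ) (k : ℤ) (f : LBc q) (h : c = -d * qc q ^ (-2 * k)) :
    radialInt q μ₀ (c • f + d • (⟨LB.shift q k f, LBc.shift_mem f.2 k⟩ : LBc q)) = 0 := by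
  rw [map_add, map_smul, map_smul, radialInt_shift, h]
  simp only [smul_eq_mul]
  ring

theorem haar_actE (x : F0 q) : haar q μ₀ (actF0 x (Uq.gen q .E)) = 0 := by
  induction x using F0.induction with
  | h0 => rw [actF0_zero_left, map_zero]
  | ha x y hx hy => rw [actF0_add_left, map_add, hx, hy, add_zero]
  | hs c x hx => rw [actF0_smul_left, map_smul, hx, smul_zero]
  | hm n k f =>
    have hG : f.1 * wt q (-k) * rinv q ∈ LBc q := LBc.mul_mem (LBc.mul_mem f.2 _) _
    have h1 : (f.1 * wt q (-k) - (qc q ^ (-n)) • (LB.shift q (-1) f * wt q 0)) * rinv q ∈ LBc q :=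
      LBc.mul_mem (sub_mem (LBc.mul_mem f.2 _)
        (Submodule.smul_mem _ _ (LBc.mul_mem (LBc.shift_mem f.2 _) _))) _
    have h2 : actF0 (⟨mono q n k f, mono_mem f.2 n k⟩ : F0 q) (Uq.gen q .E) =
        (qh q (n + k + 1) * (lam q)⁻¹) • ⟨mono q (n - 1) (k + 1) _, mono_mem h1 _ _⟩ :=
      Subtype.ext ((coe_actF0_gen _ _).trans (actE_mono q n k f))
    rw [h2, map_smul]
    by_cases h : n - 1 = 0 ∧ k + 1 = 0
    -- Only u v⁻¹ f is carried to the trivial character of the torus. With G = f √(1+q²r²)/r the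
    -- radial part of the result is G(r) - q⁻² G(q⁻¹r), whose integral vanishes.
    · obtain ⟨rfl, rfl⟩ : n = 1 ∧ k = -1 := by omega
      rw [haar_mono_eq q μ₀ _ _ ⟨_, h1⟩, if_pos (by norm_num)]
      have h3 := radialInt_smul_add_shift q μ₀ 1 (-(qc q ^ (-2 : ℤ))) (-1) ⟨_, hG⟩
        (by rw [neg_neg, ← zpow_add₀ (qc_ne q)]; norm_num)
      rw [smul_eq_zero]
      right
      rw [← h3]
      congr 1
      refine Subtype.ext ?_
      simp only [Submodule.coe_add, neg_smul, ← sub_eq_add_neg, Submodule.coe_smul, map_mul, wt_shift, rinv_shift, one_smul,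
        neg_neg, mul_smul_comm, smul_smul, ← zpow_add₀ (qc_ne q), sub_mul, smul_mul_assoc]
      norm_num
      rw [sub_eq_add_neg, sq, mul_inv_rev, inv_mul_cancel_right₀ (qc_ne q)]
    · rw [haar_eq_zero_of_ne q μ₀ h1 h, smul_zero]

theorem haar_actF (x : F0 q) : haar q μ₀ (actF0 x (Uq.gen q .F)) = 0 := by
  induction x using F0.induction with
  | h0 => rw [actF0_zero_left, map_zero]
  | ha x y hx hy => rw [actF0_add_left, map_add, hx, hy, add_zero]
  | hs c x hx => rw [actF0_smul_left, map_smul, hx, smul_zero]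
  | hm n k f =>
    have hG : f.1 * wt q (-k + 1) * rinv q ∈ LBc q := LBc.mul_mem (LBc.mul_mem f.2 _) _
    have h1 : (LB.shift q 1 f * wt q 1 - (qc q ^ n) • (f.1 * wt q (-k + 1))) * rinv q ∈ LBc q :=
      LBc.mul_mem (sub_mem (LBc.mul_mem (LBc.shift_mem f.2 _) _)
        (Submodule.smul_mem _ _ (LBc.mul_mem f.2 _))) _
    have h2 : actF0 (⟨mono q n k f, mono_mem f.2 n k⟩ : F0 q) (Uq.gen q .F) =
        (qh q (k - n - 3) * (lam q)⁻¹) • ⟨mono q (n + 1) (k - 1) _, mono_mem h1 _ _⟩ :=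
      Subtype.ext ((coe_actF0_gen _ _).trans (actF_mono q n k f))
    rw [h2, map_smul]
    by_cases h : n + 1 = 0 ∧ k - 1 = 0
    -- Only u⁻¹ v f contributes. With G = f √(1+r²)/r its radial part is q G(qr) - q⁻¹ G(r).
    · obtain ⟨rfl, rfl⟩ : n = -1 ∧ k = 1 := by omega
      rw [haar_mono_eq q μ₀ _ _ ⟨_, h1⟩, if_pos (by norm_num)]
      have h3 := radialInt_smul_add_shift q μ₀ (-(qc q ^ (-1 : ℤ))) (qc q ^ (1 : ℤ)) 1 ⟨_, hG⟩
        (by rw [neg_mul, ← zpow_add₀ (qc_ne q)]; norm_num)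
      rw [smul_eq_zero]
      right
      rw [← h3]
      congr 1
      refine Subtype.ext ?_
      simp only [Submodule.coe_add, neg_smul, ← sub_eq_add_neg, Submodule.coe_smul, map_mul, wt_shift, rinv_shift,
        mul_smul_comm, smul_smul, ← zpow_add₀ (qc_ne q), sub_mul, smul_mul_assoc,
        neg_add_eq_sub]
      norm_num
    · rw [haar_eq_zero_of_ne q μ₀ h1 h, smul_zero]

/-- K acts trivially on the monomials with n = k = 0, the only ones that the functional sees. The
image is passed as a separate y so that membership in `F0` stays out of the statement and one lemma
serves both K and K⁻¹. -/
theorem haar_actK (e : ℤ) (x : F0 q) {y : F0 q} (hy : (y : FAlg q) = actK q e x) :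
    haar q μ₀ y = haar q μ₀ x := by
  have hmem : ∀ x : F0 q, actK q e x ∈ F0 q := fun x => by
    induction x using F0.induction with
    | h0 => exact (map_zero (actK q e)).symm ▸ zero_mem _
    | ha x y hx hy => rw [show ((x + y : F0 q) : FAlg q) = x + y from rfl, map_add]; exact add_mem hx hy
    | hs c x hx =>
      rw [show ((c • x : F0 q) : FAlg q) = c • (x : FAlg q) from rfl, map_smul]
      exact SMulMemClass.smul_mem c hx
    | hm n k f => rw [actK_mono]; exact SMulMemClass.smul_mem _ (mono_mem f.2 n k)
  obtain rfl : y = ⟨_, hmem x⟩ := Subtype.ext hy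
  clear hy
  induction x using F0.induction with
  | h0 => exact congrArg (haar q μ₀) (Subtype.ext (map_zero (actK q e)))
  | ha x y hx hy =>
    rw [map_add, ← hx, ← hy, ← map_add]
    exact congrArg (haar q μ₀) (Subtype.ext (map_add (actK q e) _ _))
  | hs c x hx =>
    rw [map_smul, ← hx, ← map_smul]
    exact congrArg (haar q μ₀) (Subtype.ext (map_smul (actK q e) c _))
  | hm n k f =>
    refine (congrArg (haar q μ₀) (Subtype.ext (actK_mono q e n k f) :
      _ = qh q (e * (n - k)) • (⟨mono q n k f, mono_mem f.2 n k⟩ : F0 q))).trans ?_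
    rw [map_smul, haar_mono_eq]
    split_ifs with h
    · rw [h.1, h.2, sub_zero, mul_zero, qh_zero, one_smul]
    · rw [smul_zero]

theorem isUqInvariant_haar : IsUqInvariant (haar q μ₀) := by
  intro x f
  induction f using Uq.induction generalizing x with
  | hc c => rw [actF0_algebraMap, map_smul, AlgHom.commutes]; rfl
  | hg g =>
    rw [Uq.counit, Uq.lift_gen]
    cases g
    · rw [haar_actE, zero_mul]
    · rw [haar_actF, zero_mul]
    · rw [one_mul]; exact haar_actK q μ₀ 1 x (coe_actF0_gen x .K)
    · rw [one_mul]; exact haar_actK q μ₀ (-1) x (coe_actF0_gen x .Ki)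
  | hm f g hf hg => rw [actF0_mul, hg, hf, map_mul]; ring
  | ha f g hf hg => rw [actF0_add, map_add, hf, hg, map_add, add_mul]

end Invariance

/-! ### The Fourier transform `F_0(SU_q(1,1)) → ⊕ L²((q,1], r dμ₀)` -/

section Comp
variable (q : RPos) (μ₀ : Measure (Set.Ioc (q : ℝ) 1))

theorem memLp_shell (m : ℤ) (f : LBc q) :
    MemLp (fun s => f.1 (shell q m s)) ⊤ (weighted q μ₀) := by
  obtain ⟨M, hM⟩ := f.1.2.2 _ f.2
  refine memLp_top_of_bound (f.1.2.1.comp (measurable_shell q m)).aestronglyMeasurable (max M 0)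
    (Filter.Eventually.of_forall fun s => ?_)
  by_cases h : shell q m s ∈ tsupport (f.1 : RPos → ℂ)
  · exact (hM _ h).trans (le_max_left _ _)
  · rw [image_eq_zero_of_notMem_tsupport h, norm_zero]
    exact le_max_right _ _

variable [IsFiniteMeasure μ₀]

/-- The function `s ↦ f(q^m s)` on `(q,1]`. -/
noncomputable def comp (m : ℤ) : LBc q →ₗ[ℂ] L2q q μ₀ where
  toFun f := ((memLp_shell q μ₀ m f).mono_exponent le_top).toLp
  map_add' _ _ := rfl
  map_smul' _ _ := rfl

theorem comp_coe (m : ℤ) (f : LBc q) :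
    comp q μ₀ m f =ᵐ[weighted q μ₀] fun s => f.1 (shell q m s) :=
  ((memLp_shell q μ₀ m f).mono_exponent le_top).coeFn_toLp

theorem comp_mem_boundedL2 (m : ℤ) (f : LBc q) : comp q μ₀ m f ∈ boundedL2 q μ₀ :=
  MemLp.ae_eq (comp_coe q μ₀ m f).symm (memLp_shell q μ₀ m f)

theorem mulOp_comp {c : Coef q} {m m' : ℤ} {f g : LBc q}
    (h : ∀ s, c (iocToIcc q s) * f.1 (shell q m s) = g.1 (shell q m' s)) :
    mulOp q μ₀ c (comp q μ₀ m f) = comp q μ₀ m' g := by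
  refine Lp.ext ?_
  filter_upwards [mulOp_coe q μ₀ c (comp q μ₀ m f), comp_coe q μ₀ m f, comp_coe q μ₀ m' g]
    with s h1 h2 h3
  rw [h1, h2, h3, h]

theorem comp_eq_zero {m : ℤ} {f : LBc q} (h : ∀ s, f.1 (shell q m s) = 0) :
    comp q μ₀ m f = 0 := by
  refine Lp.ext ?_
  filter_upwards [comp_coe q μ₀ m f, Lp.coeFn_zero ℂ 2 (weighted q μ₀)] with s h1 h2
  rw [h1, h2, h]
  rfl

/-- A compact subset of the open half line meets only finitely many shells. -/
theorem finite_comp (f : LBc q) : {m : ℤ | comp q μ₀ m f ≠ 0}.Finite := by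
  refine (finite_shells q f.2).subset fun m hm => ?_
  by_contra hcon
  exact hm (comp_eq_zero q μ₀ fun s => image_eq_zero_of_notMem_tsupport fun hs => hcon ⟨s, hs⟩)

theorem inner_comp (m : ℤ) (f g : LBc q) :
    inner ℂ (comp q μ₀ m f) (comp q μ₀ m g) =
      ∫ s, (star f.1 * g.1) (shell q m s) ∂(weighted q μ₀) := by
  rw [L2.inner_def]
  refine integral_congr_ae ?_
  filter_upwards [comp_coe q μ₀ m f, comp_coe q μ₀ m g] with s h1 h2
  rw [h1, h2, RCLike.inner_apply, mul_comm]
  rfl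


/-! ### The basic functions on the shells. -/

theorem wt_shell (a m : ℤ) (s : Set.Ioc (q : ℝ) 1) :
    wt q a (shell q m s) = coefAlpha q (a + m) (iocToIcc q s) := by
  have h : (q : ℝ) ^ (2 * a) * ((q : ℝ) ^ m * (s : ℝ)) ^ 2 = (q : ℝ) ^ (2 * (a + m)) * (s : ℝ) ^ 2 := by
    rw [mul_pow, ← mul_assoc, ← zpow_natCast, ← zpow_mul, ← zpow_add₀ q.2.ne']
    congr 2; push_cast; ring
  simp [wt, LB.ofCont, coefAlpha, coefOfReal, iocToIcc, shell, h]

theorem rfun_shell (m : ℤ) (s : Set.Ioc (q : ℝ) 1) :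
    rfun q (shell q m s) = qc q ^ m * coefA q (iocToIcc q s) := by
  simp [rfun, LB.ofCont, coefA, coefOfReal, iocToIcc, shell, qc]

theorem rinv_shell (m : ℤ) (s : Set.Ioc (q : ℝ) 1) :
    rinv q (shell q m s) = (qc q ^ m)⁻¹ * (coefA q (iocToIcc q s))⁻¹ := by
  simp [rinv, LB.ofCont, coefA, coefOfReal, iocToIcc, shell, qc, mul_comm]

/-- This reflects B = qA⁻¹: the root that governs moves in k is a β of A, so both kinds of move can
arise from the single function √(1+r²)/r and its dilates. -/
theorem coefKappa_eq (k : ℤ) : coefKappa q k = coefBeta q (-k - 1) := by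
  ext t
  have h : (q : ℝ) ^ (2 * k) * (q * (t : ℝ)⁻¹) ^ 2 =
      (q : ℝ) ^ (-2 * (-k - 1)) * ((t : ℝ) ^ 2)⁻¹ := by
    rw [mul_pow, ← mul_assoc, ← zpow_natCast, ← zpow_add₀ q.2.ne', inv_pow]
    congr 2; push_cast; ring
  simp [coefKappa, coefBeta, coefOfReal] at h ⊢
  rw [h]

end Comp

/-! ### The Fourier transform, its range and its isometry property. -/

section W
variable (q : RPos) (μ₀ : Measure (Set.Ioc (q : ℝ) 1)) [IsFiniteMeasure μ₀]

theorem coefc_mono (n k i j : ℤ) (f : LBc q) :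
    coefc i j (⟨mono q n k f, mono_mem f.2 n k⟩ : F0 q) = if n = i ∧ k = j then f else 0 := by
  have hl : lco q (mono q n k f) = Finsupp.single (mon n k) (LB.shift q k f) := lco_sgl ..
  refine Subtype.ext ?_
  change LB.shift q (-j) (lco q (mono q n k f) (mon i j)) = _
  rw [hl]
  split_ifs with hg
  · obtain ⟨rfl, rfl⟩ := hg
    rw [Finsupp.single_eq_same, LB.shift_shift, neg_add_cancel, LB.shift_zero]
  · rw [Finsupp.single_eq_of_ne, map_zero]
    · rfl
    · intro h
      have h := Multiplicative.ofAdd.injective h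
      simp only [Prod.mk.injEq] at h
      exact hg ⟨h.1.symm, h.2.symm⟩

/-- The entries of the Fourier transform. -/
noncomputable def entry (p : Idx) : F0 q →ₗ[ℂ] L2q q μ₀ :=
  -- The position (n,k,l) holds the shell m = -k-2 of the coefficient of u^i v^j with i = -l+k-2 and
  -- j = m-n. The offset in k matches κ_k with the right β, and the offset in l makes the eigenvalue
  -- of K equal to q^{(j-i)/2}. The modulus of (-q)^m gives the isometry, and its sign gives the sum
  -- in the action of E and F.
  ((-qc q) ^ (-p.2.1 - 2)) • (comp q μ₀ (-p.2.1 - 2)).comp (coefc (-p.2.2 + p.2.1 - 2) (-p.2.1 - 2 - p.1))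

theorem entry_mono (n k l i j : ℤ) (f : LBc q) :
    entry q μ₀ (n, k, l) ⟨mono q i j f, mono_mem f.2 i j⟩ =
      if i = -l + k - 2 ∧ j = -k - 2 - n then (-qc q) ^ (-k - 2) • comp q μ₀ (-k - 2) f else 0 := by
  simp only [entry, LinearMap.smul_apply, LinearMap.comp_apply, coefc_mono]
  split_ifs
  · rfl
  · rw [map_zero, smul_zero]

/-- A monomial occupies one position for each shell, and only finitely many shells meet the support
of its radial part. -/
theorem finite_entry (x : F0 q) : {p | entry q μ₀ p x ≠ 0}.Finite := by
  induction x using F0.induction with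
  | h0 => simp
  | hs c x hx =>
    exact hx.subset fun p hp h => hp (by rw [map_smul, h, smul_zero])
  | ha x y hx hy =>
    refine (hx.union hy).subset fun p hp => ?_
    by_contra hcon
    simp only [Set.mem_union, Set.mem_ofPred_eq, not_or, not_not] at hcon
    exact hp (by rw [map_add, hcon.1, hcon.2, add_zero])
  | hm i j f =>
    refine ((finite_comp q μ₀ f).image fun m => ((m - j, -m - 2, -i - m - 4) : Idx)).subset ?_
    rintro ⟨n, k, l⟩ hp
    rw [Set.mem_ofPred_eq, entry_mono] at hp
    split_ifs at hp with h
    · refine ⟨-k - 2, fun h' => hp (by rw [h', smul_zero]), ?_⟩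
      simp only [Prod.mk.injEq]
      omega
    · exact absurd rfl hp

/-- The Fourier transform. -/
noncomputable def fourierW : F0 q →ₗ[ℂ] (Idx →₀ L2q q μ₀) where
  toFun x := Finsupp.ofSupportFinite (fun p => entry q μ₀ p x) (finite_entry q μ₀ x)
  map_add' x y := Finsupp.ext fun p => map_add (entry q μ₀ p) x y
  map_smul' c x := Finsupp.ext fun p => map_smul (entry q μ₀ p) c x

theorem fourierW_apply (x : F0 q) (p : Idx) : fourierW q μ₀ x p = entry q μ₀ p x := rfl

theorem fourierW_mem_entriesIn (x : F0 q) : fourierW q μ₀ x ∈ entriesIn (boundedL2 q μ₀) :=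
  fun _ => Submodule.smul_mem _ _ (comp_mem_boundedL2 q μ₀ _ _)

/-- For q < 1 the half-open shells q^m(q,1] are disjoint and ordered decreasingly in m. Applied in
both directions this shows that a point determines its shell. -/
theorem shell_eq_imp (hq : (q : ℝ) < 1) {m m' : ℤ} {s s' : Set.Ioc (q : ℝ) 1}
    (h : shell q m s = shell q m' s') : m ≤ m' := by
  by_contra! hlt
  have h1 : (q : ℝ) ^ m * (s : ℝ) = (q : ℝ) ^ m' * (s' : ℝ) := congrArg Subtype.val h
  have h2 : (q : ℝ) ^ m ≤ (q : ℝ) ^ (m' + 1) :=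
    zpow_le_zpow_right_of_le_one₀ q.2 hq.le (by omega)
  rw [zpow_add_one₀ q.2.ne'] at h2
  have h3 : (q : ℝ) ^ m * (s : ℝ) ≤ (q : ℝ) ^ m :=
    mul_le_of_le_one_right (zpow_pos q.2 m).le s.2.2
  have h4 := mul_lt_mul_of_pos_left s'.2.1 (zpow_pos q.2 m')
  linarith

theorem shell_injective (m : ℤ) : Function.Injective (shell q m) := fun _ _ h =>
  Subtype.ext (congrArg (fun r : RPos => (r : ℝ)) (mul_left_cancel h))

/-- An injective Borel map out of a standard Borel space is a Borel embedding, so extending a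
function by zero from one shell keeps it measurable. -/
theorem measurableEmbedding_shell (m : ℤ) : MeasurableEmbedding (shell q m) := by
  have : StandardBorelSpace (Set.Ioc (q : ℝ) 1) := measurableSet_Ioc.standardBorel
  exact (measurable_shell q m).measurableEmbedding (shell_injective q m)

/-- Every bounded measurable function on `(q,1]` is the restriction to the shell `q^m (q,1]` of an
element of `LBc q` that vanishes on the other shells. -/
theorem exists_comp_eq (hq : (q : ℝ) < 1) (m : ℤ) {η : L2q q μ₀} (hη : η ∈ boundedL2 q μ₀) :
    ∃ f : LBc q, comp q μ₀ m f = η ∧ ∀ m', m' ≠ m → comp q μ₀ m' f = 0 := by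
  let M : ℝ := (eLpNorm η ⊤ (weighted q μ₀)).toReal
  -- The chosen representative of η is bounded only almost everywhere, whereas elements of `LB` must
  -- be locally bounded at every point. Cutting off at the essential supremum repairs this on a null
  -- set.
  let S : Set (Set.Ioc (q : ℝ) 1) := {s | ‖η s‖ ≤ M}
  let g : Set.Ioc (q : ℝ) 1 → ℂ := S.indicator η
  have hgm : Measurable g := (Lp.stronglyMeasurable η).measurable.indicator
    ((Lp.stronglyMeasurable η).measurable.norm measurableSet_Iic)
  have hgM : ∀ s, ‖g s‖ ≤ M := fun s => by
    by_cases h : s ∈ S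
    · exact (congrArg norm (Set.indicator_of_mem h _)).trans_le h
    · refine (congrArg norm (Set.indicator_of_notMem h _)).trans_le ?_
      rw [norm_zero]
      exact ENNReal.toReal_nonneg
  have hge : g =ᵐ[weighted q μ₀] η := by
    have hle : ∀ᵐ s ∂(weighted q μ₀), ‖η s‖ₑ ≤ eLpNorm η ⊤ (weighted q μ₀) := by
      rw [eLpNorm_exponent_top]
      exact ae_le_eLpNormEssSup
    filter_upwards [hle] with s hs
    refine Set.indicator_of_mem ?_ _
    rw [Set.mem_ofPred_eq, ← toReal_enorm]
    exact ENNReal.toReal_mono hη.2.ne hs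
  let f : RPos → ℂ := Function.extend (shell q m) g (0 : RPos → ℂ)
  have hf : ∀ s, f (shell q m s) = g s := (shell_injective q m).extend_apply g (0 : RPos → ℂ)
  have hf0 : ∀ r : RPos, (¬∃ s, shell q m s = r) → f r = 0 := fun r => Function.extend_apply' g (0 : RPos → ℂ) r
  have hfm : Measurable f :=
    (measurableEmbedding_shell q m).measurable_extend hgm measurable_const
  have hfM : ∀ r, ‖f r‖ ≤ M := fun r => by
    by_cases h : ∃ s, shell q m s = r
    · obtain ⟨s, rfl⟩ := h
      rw [hf]
      exact hgM s
    · rw [hf0 r h, norm_zero]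
      exact ENNReal.toReal_nonneg
  have hfc : HasCompactSupport f := by
    -- The shell itself is not closed; its support is enclosed in the compact set q^m[q,1].
    have hc : Continuous fun t : Set.Icc (q : ℝ) 1 => q ^ m * (⟨t, icc_pos t⟩ : RPos) :=
      (continuous_scale _).comp (continuous_subtype_val.subtype_mk _)
    refine HasCompactSupport.intro (isCompact_range hc) fun r hr => hf0 r ?_
    rintro ⟨s, rfl⟩
    exact hr ⟨iocToIcc q s, rfl⟩
  refine ⟨⟨⟨f, hfm, fun C _ => ⟨M, fun r _ => hfM r⟩⟩, hfc⟩, ?_, fun m' hm' => ?_⟩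
  · refine Lp.ext ((comp_coe q μ₀ m _).trans (Filter.EventuallyEq.trans ?_ hge))
    exact Filter.Eventually.of_forall hf
  · refine comp_eq_zero q μ₀ fun s => hf0 _ ?_
    rintro ⟨s', h⟩
    exact hm' (le_antisymm (shell_eq_imp q hq h.symm) (shell_eq_imp q hq h))

theorem single_mem_range_fourierW (hq : (q : ℝ) < 1) (p : Idx) {η : L2q q μ₀}
    (hη : η ∈ boundedL2 q μ₀) : ∃ x, fourierW q μ₀ x = Finsupp.single p η := by
  obtain ⟨n, k, l⟩ := p
  have hc : (-qc q) ^ (-k - 2) ≠ 0 := zpow_ne_zero _ (neg_ne_zero.2 (qc_ne q))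
  obtain ⟨f, hf, hf'⟩ := exists_comp_eq q μ₀ hq (-k - 2) hη
  refine ⟨((-qc q) ^ (-k - 2))⁻¹ • ⟨mono q (-l + k - 2) (-k - 2 - n) f, mono_mem f.2 _ _⟩,
    Finsupp.ext fun p => ?_⟩
  obtain ⟨n', k', l'⟩ := p
  rw [map_smul, Finsupp.smul_apply, fourierW_apply, entry_mono, Finsupp.single_apply]
  by_cases hk : k' = k
  · subst hk
    have : (-l + k' - 2 = -l' + k' - 2 ∧ -k' - 2 - n = -k' - 2 - n') ↔
        ((n, k', l) : Idx) = (n', k', l') := by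
      rw [Prod.mk.injEq, Prod.mk.injEq]
      omega
    simp only [hf, this]
    split_ifs
    · rw [smul_smul, inv_mul_cancel₀ hc, one_smul]
    · rw [smul_zero]
  -- For another k' the entry reads the shell -k'-2, on which f vanishes.
  · rw [hf' _ (by omega), smul_zero, ite_self, smul_zero, if_neg]
    intro h
    simp only [Prod.mk.injEq] at h
    exact hk h.2.1.symm

theorem range_fourierW (hq : (q : ℝ) < 1) :
    LinearMap.range (fourierW q μ₀) = entriesIn (boundedL2 q μ₀) := by
  refine le_antisymm ?_ fun g hg => ?_
  · rintro _ ⟨x, rfl⟩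
    exact fourierW_mem_entriesIn q μ₀ x
  · rw [← g.sum_single]
    exact Submodule.sum_mem _ fun p _ => single_mem_range_fourierW q μ₀ hq p (hg p)

/-! #### The Fourier transform is isometric -/

theorem star_mono_mul_mono (i j i' j' : ℤ) (f g : LBc q) :
    star (⟨mono q i j f, mono_mem f.2 i j⟩ : F0 q) * ⟨mono q i' j' g, mono_mem g.2 i' j'⟩ =
      ⟨mono q (-i + i') (-j + j') (LB.shift q (-j' + j) (star f.1) * g.1),
        mono_mem (LBc.mul_mem' g.2 _) _ _⟩ := by
  refine Subtype.ext ?_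
  change star (mono q i j f.1) * mono q i' j' g.1 = _
  rw [star_mono, mono_mul, LB.shift_shift]

/-- Distinct monomials occupy disjoint sets of positions, matching orthogonality of characters on
the torus. For equal monomials the sum over positions is the sum over shells that computes the
radial integral. -/
theorem hasSum_inner_fourierW (i j i' j' : ℤ) (f g : LBc q) :
    HasSum (fun p : Idx =>
      inner ℂ (entry q μ₀ p ⟨mono q i j f, mono_mem f.2 i j⟩)
        (entry q μ₀ p ⟨mono q i' j' g, mono_mem g.2 i' j'⟩))
      (haar q μ₀ (star (⟨mono q i j f, mono_mem f.2 i j⟩ : F0 q) *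
        ⟨mono q i' j' g, mono_mem g.2 i' j'⟩)) := by
  rw [star_mono_mul_mono, haar_mono_eq q μ₀ _ _ ⟨_, LBc.mul_mem' g.2 _⟩]
  by_cases h : i = i' ∧ j = j'
  · obtain ⟨rfl, rfl⟩ := h
    rw [if_pos (by omega)]
    have hinj : Function.Injective fun m : ℤ => ((m - j, -m - 2, -i - m - 4) : Idx) :=
      fun m m' h => by simp only [Prod.mk.injEq] at h; omega
    rw [← hinj.hasSum_iff]
    · refine Eq.subst (motive := fun F => HasSum F _) (funext fun m => ?_)
        (hasSum_radialInt q μ₀ ⟨_, LBc.mul_mem' g.2 (LB.shift q (-j + j) (star f.1))⟩)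
      rw [Function.comp_apply, entry_mono, entry_mono, if_pos (by omega), if_pos (by omega),
        inner_smul_left, inner_smul_right, inner_comp, ← mul_assoc]
      have hm : -(-m - 2) - 2 = m := by ring
      have hs : LB.shift q (-j + j) (star f.1) = star f.1 := by
        rw [neg_add_cancel, LB.shift_zero]
      rw [hm, hs]
      congr 1
      -- The two normalising factors multiply to (-q)^{2m} = q^{2m}, the weight of the shell; the
      -- sign disappears.
      rw [map_zpow₀, map_neg, conj_qc, ← zpow_add₀ (neg_ne_zero.2 (qc_ne q)), two_mul,
        Even.neg_zpow ⟨m, rfl⟩]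
    · rintro ⟨n, k, l⟩ hp
      rw [entry_mono, if_neg, inner_zero_left]
      rintro ⟨h1, h2⟩
      refine hp ⟨-k - 2, ?_⟩
      simp only [Prod.mk.injEq]
      omega
  · rw [if_neg (by omega)]
    refine Eq.subst (motive := fun F => HasSum F _) (funext fun p => ?_) hasSum_zero
    obtain ⟨n, k, l⟩ := p
    rw [entry_mono, entry_mono]
    by_cases h1 : i = -l + k - 2 ∧ j = -k - 2 - n
    · rw [if_neg (c := i' = _ ∧ j' = _) (by omega), inner_zero_right]
    · rw [if_neg h1, inner_zero_left]

theorem haar_star_mul (x y : F0 q) : haar q μ₀ (star x * y) =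
    inner ℂ (sumIncl (L2q q μ₀) (fourierW q μ₀ x)) (sumIncl (L2q q μ₀) (fourierW q μ₀ y)) := by
  induction x using F0.induction with
  | h0 => rw [star_zero, zero_mul, map_zero, map_zero, map_zero, inner_zero_left]
  | hs c x hx =>
    rw [star_smul, smul_mul_assoc, map_smul, map_smul, map_smul, inner_smul_left, hx]
    rfl
  | ha x x' hx hx' => rw [star_add, add_mul, map_add, map_add, map_add, inner_add_left, hx, hx']
  | hm i j f =>
    induction y using F0.induction with
    | h0 => rw [mul_zero, map_zero, map_zero, map_zero, inner_zero_right]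
    | hs c y hy =>
      rw [mul_smul_comm, map_smul, map_smul, map_smul, inner_smul_right, hy]
      rfl
    | ha y y' hy hy' => rw [mul_add, map_add, map_add, map_add, inner_add_right, hy, hy']
    | hm i' j' g =>
      refine (hasSum_inner_fourierW q μ₀ i j i' j' f g).unique ?_
      have h := lp.hasSum_inner (𝕜 := ℂ) (sumIncl (L2q q μ₀) (fourierW q μ₀ ⟨_, mono_mem f.2 i j⟩))
        (sumIncl (L2q q μ₀) (fourierW q μ₀ ⟨_, mono_mem g.2 i' j'⟩))
      simpa only [sumIncl_apply, fourierW_apply] using h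

/-- The isometry identity makes h(x* x) the squared norm of the transform of x; no pointwise
positivity argument is needed. -/
theorem isPositive_haar : IsPositive (haar q μ₀) := fun x => by
  refine ⟨‖sumIncl (L2q q μ₀) (fourierW q μ₀ x)‖ ^ 2, sq_nonneg _, ?_⟩
  rw [haar_star_mul, inner_self_eq_norm_sq_to_K]
  push_cast
  rfl
end W

/-! ### The Fourier transform intertwines the actions -/

section Intertwining
variable (q : RPos) (μ₀ : Measure (Set.Ioc (q : ℝ) 1)) [IsFiniteMeasure μ₀]

/-- The element `u^n v^k f(r)` of `F_0(SU_q(1,1))`. -/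
noncomputable def mono0 (n k : ℤ) : LBc q →ₗ[ℂ] F0 q where
  toFun f := ⟨mono q n k f, mono_mem f.2 n k⟩
  map_add' f g := Subtype.ext (map_add (mono q n k) f.1 g.1)
  map_smul' c f := Subtype.ext (map_smul (mono q n k) c f.1)

/-- Under the placement of the entries, a shift by σ changes the exponents of u and v by fixed
amounts and moves the shell m to m - σ.2.1. Intertwining thus reduces to a pointwise identity on
each shell, in which (-q)^{σ.2.1} is the ratio of the normalising factors. -/
theorem weightedShift_fourierW {σ : Idx} {c : Idx → Coef q} {i j i' j' : ℤ} {f g : LBc q}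
    (hi : i' = i - σ.2.2 + σ.2.1) (hj : j' = j - σ.2.1 - σ.1)
    (h : ∀ m s, (-qc q) ^ σ.2.1 * c (m - j, -m - 2, -i - m - 4) (iocToIcc q s) *
      f.1 (shell q m s) = g.1 (shell q (m - σ.2.1) s)) :
    weightedShift (toEnd (mulHom q μ₀)) σ c (fourierW q μ₀ (mono0 q i j f)) =
      fourierW q μ₀ (mono0 q i' j' g) := by
  obtain ⟨a, b, d⟩ := σ
  refine Finsupp.ext fun ⟨n, k, l⟩ => ?_
  dsimp only at hi hj h
  rw [weightedShift_apply, fourierW_apply, fourierW_apply, Prod.mk_sub_mk, Prod.mk_sub_mk]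
  refine (congrArg _ (entry_mono q μ₀ (n - a) (k - b) (l - d) i j f)).trans
    (Eq.trans ?_ (entry_mono q μ₀ n k l i' j' g).symm)
  by_cases hm : i = -(l - d) + (k - b) - 2 ∧ j = -(k - b) - 2 - (n - a)
  · rw [if_pos hm, if_pos (by omega), map_smul, toEnd_apply, mulHom_apply]
    have hz : (-qc q) ^ (-(k - b) - 2) = (-qc q) ^ (-k - 2) * (-qc q) ^ b := by
      rw [← zpow_add₀ (neg_ne_zero.2 (qc_ne q))]
      congr 1
      ring
    rw [hz, mul_smul, ← map_smul (mulOp q μ₀ _), ← map_smul (comp q μ₀ _)]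
    congr 1
    refine mulOp_comp q μ₀ fun s => ?_
    have h1 := h (-(k - b) - 2) s
    rw [show -(k - b) - 2 - j = n - a by omega, show -(-(k - b) - 2) - 2 = k - b by ring,
      show -i - (-(k - b) - 2) - 4 = l - d by omega, show -(k - b) - 2 - b = -k - 2 by ring] at h1
    rw [← h1, mul_comm ((-qc q) ^ b), mul_assoc]
    rfl
  · rw [if_neg hm, if_neg (by omega), map_zero]

theorem opO_fourierW (o : OGen) (x : F0 q) : opO (toEnd (mulHom q μ₀)) o (fourierW q μ₀ x) =
    fourierW q μ₀ (mulF0 (phi q (Oq.gen q o)) x) := by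
  have hadd : ∀ (y : FAlg q) (x x' : F0 q), mulF0 y (x + x') = mulF0 y x + mulF0 y x' :=
    fun y x x' => Subtype.ext (mul_add _ _ _)
  have hsmul : ∀ (c : ℂ) (y : FAlg q) (x : F0 q), mulF0 y (c • x) = c • mulF0 y x :=
    fun c y x => Subtype.ext (mul_smul_comm c y x.1)
  have hzero : ∀ (y : FAlg q), mulF0 y (0 : F0 q) = 0 := fun y => Subtype.ext (mul_zero _)
  have hq := qc_ne q
  induction x using F0.induction with
  | h0 => rw [hzero, map_zero, map_zero]
  | hs c x hx => rw [hsmul, map_smul, map_smul, map_smul, hx]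
  | ha x y hx hy => rw [hadd, map_add, map_add, map_add, hx, hy]
  | hm i j f =>
    have hmul : ∀ (i' j' : ℤ) (g : LB q), phi q (Oq.gen q o) = mono q i' j' g →
        mulF0 (phi q (Oq.gen q o)) ⟨mono q i j f, mono_mem f.2 i j⟩ =
          mono0 q (i' + i) (j' + j) ⟨LB.shift q (-j) g * f.1, LBc.mul_mem' f.2 _⟩ :=
      fun i' j' g hg => Subtype.ext ((congrArg (· * mono q i j f.1) hg).trans (mono_mul ..))
    cases o
    · rw [hmul 0 1 (wt q 0) (by rw [phi, Oq.lift_gen])]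
      refine weightedShift_fourierW q μ₀ (by simp) (by simp [add_comm]) fun m s => ?_
      change _ = LB.shift q (-j) (wt q 0) _ * _
      dsimp only
      rw [wt_shift, wt_shell, show 0 + -j + (m - 0) = m - j by ring]
      simp
    · rw [hmul (-1) 0 (qc q • rfun q) (by rw [phi, Oq.lift_gen])]
      refine weightedShift_fourierW q μ₀ (by simp; ring) (by simp) fun m s => ?_
      change _ = LB.shift q (-j) (qc q • rfun q) _ * _
      rw [map_smul, rfun_shift]
      change _ = qc q * (_ * rfun q _) * _
      rw [rfun_shell]
      simp
      left
      rw [zpow_add_one₀ hq, zpow_sub₀ hq]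
      ring
    · rw [hmul 1 0 (rfun q) (by rw [phi, Oq.lift_gen])]
      refine weightedShift_fourierW q μ₀ (by simp; ring) (by simp) fun m s => ?_
      change _ = LB.shift q (-j) (rfun q) _ * _
      rw [rfun_shift]
      change _ = (_ * rfun q _) * _
      rw [rfun_shell]
      simp
      left
      rw [zpow_sub₀ hq]
      ring
    · rw [hmul 0 (-1) (wt q 1) (by rw [phi, Oq.lift_gen])]
      refine weightedShift_fourierW q μ₀ (by simp) (by simp; ring) fun m s => ?_
      change _ = LB.shift q (-j) (wt q 1) _ * _
      dsimp only
      rw [wt_shift, wt_shell, show 1 + -j + (m - 0) = m - j + 1 by ring]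
      simp

/-! ### The action of E, F and K under the transform. -/

theorem wt_mul_rinv_shell (a m : ℤ) (s : Set.Ioc (q : ℝ) 1) :
    wt q a (shell q m s) * rinv q (shell q m s) = qc q ^ a * coefBeta q (a + m) (iocToIcc q s) := by
  have hq := qc_ne q
  rw [wt_shell, rinv_shell, coefBeta_eq, zpow_add₀ hq]
  field_simp

theorem inv_qc_eq_qh : (qc q)⁻¹ = qh q (-2) := by rw [qh_neg, qh_two]

/-- This is the undilated term of E: it stays on its shell and so changes n and l but not k. The
factor q⁻¹ comes from S⁻¹(E) = -q⁻¹E. -/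
theorem lowerN_fourierW (i j : ℤ) (f : LBc q) :
    lowerN (toEnd (mulHom q μ₀)) (fourierW q μ₀ (mono0 q i j f)) =
      fourierW q μ₀ (mono0 q (i - 1) (j + 1) (((qc q)⁻¹ * (qh q (i + j + 1) * (lam q)⁻¹)) •
        ⟨f.1 * (wt q (-j) * rinv q), LBc.mul_mem f.2 _⟩)) := by
  refine weightedShift_fourierW q μ₀ (by simp) (by simp) fun m s => ?_
  change _ * (((lam q)⁻¹ * qh q _) * coefBeta q (m - j) (iocToIcc q s)) * _ =
    _ * (f.1 _ * (wt q (-j) _ * rinv q _))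
  dsimp only
  rw [wt_mul_rinv_shell, sub_zero, zpow_zero, one_mul, neg_add_eq_sub, inv_qc_eq_qh,
    qc_zpow_eq_qh]
  -- At the position belonging to the shell m the exponent no longer depends on m: it equals i - j -
  -- 1.
  have key : qh q (m - j + 2 * (-m - 2) - (-i - m - 4) - 1) =
      qh q (-2) * qh q (i + j + 1) * qh q (-j + -j) := by
    rw [← qh_add, ← qh_add]
    congr 1
    ring
  rw [key]
  ring

/-- This is the dilated term of E: f(q⁻¹r) carries the shell m to m + 1 and so lowers k. The minus
sign is that of the quotient (-q)⁻¹ of the normalising factors. -/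
theorem lowerK_fourierW (i j : ℤ) (f : LBc q) :
    lowerK (toEnd (mulHom q μ₀)) (fourierW q μ₀ (mono0 q i j f)) =
      fourierW q μ₀ (mono0 q (i - 1) (j + 1) ((-((qc q)⁻¹ * (qh q (i + j + 1) * (lam q)⁻¹) *
        qc q ^ (-i))) •
        ⟨LB.shift q (-1) f.1 * (wt q 0 * rinv q), LBc.mul_mem (LBc.shift_mem f.2 _) _⟩)) := by
  refine weightedShift_fourierW q μ₀ (by simp; ring) (by simp) fun m s => ?_
  change _ * (((lam q)⁻¹ * qh q _) * coefKappa q _ (iocToIcc q s)) * _ =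
    _ * (f.1 _ * (wt q 0 _ * rinv q _))
  dsimp only
  rw [wt_mul_rinv_shell, coefKappa_eq, shell_add, zpow_zero, one_mul, zpow_neg_one, inv_neg,
    inv_qc_eq_qh, qc_zpow_eq_qh, show m - -1 + -1 = m by ring,
    show -(-m - 2) - 1 = 0 + (m - -1) by ring]
  have key : qh q (-2) * qh q (-(m - j) - 2 * (-m - 2) + (-i - m - 4) + 1) =
      qh q (-2) * qh q (i + j + 1) * qh q (-i + -i) := by
    rw [← qh_add, ← qh_add, ← qh_add]
    congr 1
    ring
  linear_combination (-(lam q)⁻¹ * coefBeta q (0 + (m - -1)) (iocToIcc q s) *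
    f.1 (shell q m s)) * key

/-- The dilated term of F: f(qr) carries the shell m to m - 1, again at the cost of a sign. -/
theorem raiseK_fourierW (i j : ℤ) (f : LBc q) :
    raiseK (toEnd (mulHom q μ₀)) (fourierW q μ₀ (mono0 q i j f)) =
      fourierW q μ₀ (mono0 q (i + 1) (j - 1) ((-(qc q * (qh q (j - i - 3) * (lam q)⁻¹))) •
        ⟨LB.shift q 1 f.1 * (wt q 1 * rinv q), LBc.mul_mem (LBc.shift_mem f.2 _) _⟩)) := by
  refine weightedShift_fourierW q μ₀ (by simp) (by simp) fun m s => ?_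
  change _ * (((lam q)⁻¹ * qh q _) * coefKappa q _ (iocToIcc q s)) * _ =
    _ * (f.1 _ * (wt q 1 _ * rinv q _))
  dsimp only
  rw [wt_mul_rinv_shell, coefKappa_eq, shell_add, zpow_one, zpow_one, ← qh_two,
    show m - 1 + 1 = m by ring, show -(-m - 2 + 1) - 1 = 1 + (m - 1) by ring]
  have key : qh q (-(m - j) - 2 * (-m - 2) + (-i - m - 4) - 1) =
      qh q (j - i - 3) * qh q 2 := by
    rw [← qh_add]
    congr 1
    ring
  linear_combination (-qh q 2 * (lam q)⁻¹ * coefBeta q (1 + (m - 1)) (iocToIcc q s) *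
    f.1 (shell q m s)) * key

theorem raiseN_fourierW (i j : ℤ) (f : LBc q) :
    raiseN (toEnd (mulHom q μ₀)) (fourierW q μ₀ (mono0 q i j f)) =
      fourierW q μ₀ (mono0 q (i + 1) (j - 1) ((qc q * (qh q (j - i - 3) * (lam q)⁻¹) * qc q ^ i) •
        ⟨f.1 * (wt q (-j + 1) * rinv q), LBc.mul_mem f.2 _⟩)) := by
  refine weightedShift_fourierW q μ₀ (by simp) (by simp) fun m s => ?_
  change _ * (((lam q)⁻¹ * qh q _) * coefBeta q (m - j + 1) (iocToIcc q s)) * _ =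
    _ * (f.1 _ * (wt q (-j + 1) _ * rinv q _))
  dsimp only
  rw [wt_mul_rinv_shell, sub_zero, zpow_zero, one_mul, show -j + 1 + m = m - j + 1 by ring,
    qc_zpow_eq_qh, qc_zpow_eq_qh, ← qh_two]
  have key : qh q (m - j + 2 * (-m - 2) - (-i - m - 4) + 1) =
      qh q 2 * qh q (j - i - 3) * qh q (i + i) * qh q (-j + 1 + (-j + 1)) := by
    rw [← qh_add, ← qh_add, ← qh_add]
    congr 1
    ring
  rw [key]
  ring

theorem opK_fourierW (e i j : ℤ) (f : LBc q) :
    opK (toEnd (mulHom q μ₀)) e (fourierW q μ₀ (mono0 q i j f)) =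
      fourierW q μ₀ (mono0 q i j (qh q (-e * (i - j)) • f)) := by
  refine weightedShift_fourierW q μ₀ (by simp) (by simp) fun m s => ?_
  change _ * (qh q _ * 1) * _ = _ * f.1 _
  simp only [Prod.fst_zero, Prod.snd_zero, zpow_zero, one_mul, mul_one, sub_zero]
  congr 2
  ring

theorem opU_fourierW (g : UGen) (x : F0 q) : opU (toEnd (mulHom q μ₀)) g (fourierW q μ₀ x) =
    fourierW q μ₀ (actF0 x (unop (Uq.antipodeInv q (Uq.gen q g)))) := by
  induction x using F0.induction with
  | h0 => rw [actF0_zero_left, map_zero, map_zero]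
  | hs c x hx => rw [actF0_smul_left, map_smul, map_smul, map_smul, hx]
  | ha x y hx hy => rw [actF0_add_left, map_add, map_add, map_add, hx, hy]
  | hm i j f =>
    change opU _ g (fourierW q μ₀ (mono0 q i j f)) = fourierW q μ₀ (actF0 (mono0 q i j f) _)
    rw [Uq.antipodeInv, Uq.lift_gen]
    cases g
    · rw [opU, LinearMap.smul_apply, LinearMap.add_apply, lowerN_fourierW, lowerK_fourierW,
        ← map_add, ← map_add, ← map_smul, ← map_smul]
      congr 1
      dsimp only
      rw [unop_op, actF0_neg, actF0_smul]
      refine Subtype.ext ?_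
      change _ = -((qc q)⁻¹ • (actF0 (mono0 q i j f) (Uq.gen q .E) : FAlg q))
      rw [coe_actF0_gen]
      refine Eq.trans ?_ (congrArg (fun y => -((qc q)⁻¹ • y)) (actE_mono q i j f)).symm
      rw [← map_smul, ← map_smul, ← map_neg]
      refine congrArg (mono q (i - 1) (j + 1)) ?_
      simp only [Submodule.coe_add, Submodule.coe_smul, sub_mul, smul_mul_assoc, mul_assoc]
      module
    · rw [opU, LinearMap.add_apply, raiseN_fourierW, raiseK_fourierW, ← map_add, ← map_add]
      congr 1
      dsimp only
      rw [unop_op, actF0_neg, actF0_smul]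
      refine Subtype.ext ?_
      change _ = -(qc q • (actF0 (mono0 q i j f) (Uq.gen q .F) : FAlg q))
      rw [coe_actF0_gen]
      refine Eq.trans ?_ (congrArg (fun y => -(qc q • y)) (actF_mono q i j f)).symm
      rw [← map_smul, ← map_smul, ← map_neg]
      refine congrArg (mono q (i + 1) (j - 1)) ?_
      simp only [Submodule.coe_add, Submodule.coe_smul, sub_mul, smul_mul_assoc, mul_assoc]
      module
    · rw [opU, opK_fourierW]
      congr 1
      refine Subtype.ext ?_
      rw [unop_op, coe_actF0_gen]
      refine Eq.trans ?_ (actK_mono q (-1) i j f).symm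
      exact map_smul (mono q i j) _ _
    · rw [opU, opK_fourierW, neg_neg]
      congr 1
      refine Subtype.ext ?_
      rw [unop_op, coe_actF0_gen]
      refine Eq.trans ?_ (actK_mono q 1 i j f).symm
      exact map_smul (mono q i j) _ _

theorem seriesHom_ofO_fourierW (hl : lam q ≠ 0) (a : Oq q) (x : F0 q) :
    seriesHom (toEnd (mulHom q μ₀)) hl (Cross.ofO q a) (fourierW q μ₀ x) =
      fourierW q μ₀ (mulF0 (phi q a) x) := by
  induction a using Oq.induction generalizing x with
  | hc c =>
    rw [AlgHom.commutes, AlgHom.commutes, AlgHom.commutes, Module.algebraMap_end_apply, ← map_smul]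
    exact congrArg _ (Subtype.ext (Algebra.smul_def c x.1))
  | hg o => rw [seriesHom_ofO, opO_fourierW]
  | hm a b ha hb =>
    rw [map_mul, map_mul, Module.End.mul_apply, hb, ha, map_mul]
    exact congrArg _ (Subtype.ext (mul_assoc _ _ _).symm)
  | ha a b ha hb =>
    rw [map_add, map_add, LinearMap.add_apply, ha, hb, ← map_add, map_add (phi q)]
    exact congrArg _ (Subtype.ext (add_mul _ _ _).symm)

theorem seriesHom_ofU_fourierW (hl : lam q ≠ 0) (f : Uq q) (x : F0 q) :
    seriesHom (toEnd (mulHom q μ₀)) hl (Cross.ofU q f) (fourierW q μ₀ x) =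
      fourierW q μ₀ (actF0 x (unop (Uq.antipodeInv q f))) := by
  induction f using Uq.induction generalizing x with
  | hc c =>
    rw [AlgHom.commutes, AlgHom.commutes, AlgHom.commutes, Module.algebraMap_end_apply, ← map_smul]
    exact congrArg _ (actF0_algebraMap x c).symm
  | hg g => rw [seriesHom_ofU, opU_fourierW]
  | hm f g hf hg =>
    -- A right action composed with the antimultiplicative S⁻¹ is a left action, so the factors
    -- appear in the right order.
    rw [map_mul, map_mul, Module.End.mul_apply, hg, hf, map_mul, unop_mul, actF0_mul]
  | ha f g hf hg =>
    rw [map_add, map_add, LinearMap.add_apply, hf, hg, ← map_add, map_add (Uq.antipodeInv q), unop_add, actF0_add]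

end Intertwining

/-! ### The unitary operator -/

theorem denseRange_toGNS {A : Type*} [NonUnitalRing A] [StarRing A] [Module ℂ A] [StarModule ℂ A]
    [IsScalarTower ℂ A A] [SMulCommClass ℂ A A] {h : A →ₗ[ℂ] ℂ} (hp : IsPositive h) :
    DenseRange (toGNS hp) :=
  UniformSpace.Completion.denseRange_coe.comp (toPreGNS hp).surjective.denseRange
    (UniformSpace.Completion.continuous_coe _)

section Unitary
variable (q : RPos) (hq : (q : ℝ) < 1) (μ₀ : Measure (Set.Ioc (q : ℝ) 1)) [IsFiniteMeasure μ₀]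

/-- The Fourier transform as a map into the Hilbert space `⊕ L²((q,1], r dμ₀)`. -/
noncomputable def fourierH : F0 q →ₗ[ℂ] HSum (L2q q μ₀) :=
  (sumIncl (L2q q μ₀)).comp (fourierW q μ₀)

theorem range_fourierH (hq : (q : ℝ) < 1) : LinearMap.range (fourierH q μ₀) =
    (entriesIn (boundedL2 q μ₀)).map (sumIncl (L2q q μ₀)) := by
  rw [fourierH, LinearMap.range_comp, range_fourierW q μ₀ hq]

theorem norm_fourierH (x : F0 q) :
    ‖fourierH q μ₀ x‖ = ‖toGNS (isPositive_haar q μ₀) x‖ := by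
  rw [norm_eq_sqrt_re_inner (𝕜 := ℂ), norm_eq_sqrt_re_inner (𝕜 := ℂ), inner_toGNS, haar_star_mul]
  rfl

/-- The unitary operator given by the Fourier transform. -/
noncomputable def fourierU : GNS (isPositive_haar q μ₀) ≃ₗᵢ[ℂ] HSum (L2q q μ₀) :=
  -- `F0` maps to both Hilbert spaces with dense range and equal norms, though not injectively in
  -- general. The identity of `F0` therefore induces a unitary, and the null space needs no separate
  -- treatment.
  (LinearEquiv.refl ℂ (F0 q)).extendOfIsometry (toGNS (isPositive_haar q μ₀)) (fourierH q μ₀)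
    (denseRange_toGNS _) (by
      rw [DenseRange, ← LinearMap.coe_range, range_fourierH q μ₀ hq]
      exact dense_map_entriesIn (dense_boundedL2 q μ₀)) (norm_fourierH q μ₀)

theorem fourierU_toGNS (x : F0 q) : fourierU q hq μ₀ (toGNS _ x) = fourierH q μ₀ x :=
  LinearEquiv.extendOfIsometry_eq ..

theorem fourierU_symm_sumIncl (x : F0 q) :
    (fourierU q hq μ₀).symm (sumIncl _ (fourierW q μ₀ x)) = toGNS _ x := by
  rw [LinearIsometryEquiv.symm_apply_eq, fourierU_toGNS]
  rfl

/-- The inverse of the Fourier transform on finitely supported families. -/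
noncomputable def fourierJ : (Idx →₀ L2q q μ₀) →ₗ[ℂ] GNS (isPositive_haar q μ₀) :=
  (fourierU q hq μ₀).symm.toLinearEquiv.toLinearMap.comp (sumIncl (L2q q μ₀))

theorem map_fourierJ : (entriesIn (boundedL2 q μ₀)).map (fourierJ q hq μ₀) =
    LinearMap.range (toGNS (isPositive_haar q μ₀)) := by
  rw [← range_fourierW q μ₀ hq, ← LinearMap.range_comp]
  exact congrArg LinearMap.range (LinearMap.ext fun x => fourierU_symm_sumIncl q hq μ₀ x)

/-- The Heisenberg representation. -/
noncomputable def heisenbergRep : StarRep (Cross q) (GNS (isPositive_haar q μ₀)) :=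
  -- Only the embedding differs from that of ρ₀: finitely supported families are sent into the
  -- completion by the inverse unitary.
  StarRep.ofInjective (seriesHom (toEnd (mulHom q μ₀)) (lam_ne hq)) (fourierJ q hq μ₀)
    ((fourierU q hq μ₀).symm.injective.comp sumIncl_injective) (entriesIn (boundedL2 q μ₀))
    (seriesHom_mem_entriesIn (mulHom q μ₀) (lam_ne hq) fun f _ => mulOp_mem_boundedL2 q μ₀ f)
    (by
      rw [map_fourierJ, LinearMap.coe_range]
      exact denseRange_toGNS _)
    fun x g h => ((fourierU q hq μ₀).symm.inner_map_map _ _).trans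
      ((formalAdjoint_seriesHom (mulHom q μ₀) (lam_ne hq) x g h).trans
        ((fourierU q hq μ₀).symm.inner_map_map _ _).symm)

/-- The transported operators obey the prescribed formula because the transform intertwines left
multiplication and the action through S⁻¹ with `seriesHom`; the domain is the set of classes because
the transform is onto the bounded families. -/
theorem isHeisenbergRep_heisenbergRep :
    IsHeisenbergRep (isPositive_haar q μ₀) (heisenbergRep q hq μ₀) where
  domain_eq := map_fourierJ q hq μ₀
  map f a x := by
    refine (StarRep.ofInjective_maps ..).2 ⟨_, fourierW_mem_entriesIn q μ₀ x,
      fourierU_symm_sumIncl q hq μ₀ x, ?_⟩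
    rw [map_mul, Module.End.mul_apply, seriesHom_ofO_fourierW, seriesHom_ofU_fourierW]
    exact fourierU_symm_sumIncl q hq μ₀ _

/-- Both representations come from the same algebraic one on the same families, and their embeddings
differ by the unitary. -/
theorem unitarilyEquivalent_heisenbergRep :
    (heisenbergRep q hq μ₀).UnitarilyEquivalent
      (seriesRep (mulHom q μ₀) (lam_ne hq) (boundedL2 q μ₀)
        (fun f _ => mulOp_mem_boundedL2 q μ₀ f) (dense_boundedL2 q μ₀)) := by
  refine ⟨fourierU q hq μ₀, fun ξ => ?_, fun x ξ ζ h => ?_⟩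
  · change ξ ∈ (entriesIn (boundedL2 q μ₀)).map (fourierJ q hq μ₀) ↔
      _ ∈ (entriesIn (boundedL2 q μ₀)).map (sumIncl (L2q q μ₀))
    rw [Submodule.mem_map, Submodule.mem_map]
    refine exists_congr fun g => and_congr_right fun _ => ?_
    exact (fourierU q hq μ₀).symm_apply_eq
  · obtain ⟨g, hg, rfl, rfl⟩ := (StarRep.ofInjective_maps ..).1 h
    refine (seriesRep_maps ..).2 ⟨g, hg, ?_, ?_⟩ <;>
    exact ((fourierU q hq μ₀).apply_symm_apply _).symm

end Unitary
end SUq11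

/-! ### The main theorem. -/

theorem mainTheorem7 (q : RPos) (hq : (q : ℝ) < 1) (μ₀ : Measure (Set.Ioc (q : ℝ) 1))
    [IsFiniteMeasure μ₀] :
    IsUqInvariant (haar q μ₀) ∧ ∃ hpos : IsPositive (haar q μ₀),
      ∃ π : StarRep (Cross q) (GNS hpos), IsHeisenbergRep hpos π ∧
      ∃ ρ₀ ρ : StarRep (Cross q) (HSum (L2q q μ₀)),
        IsSeriesI2 ρ₀ (boundedL2 q μ₀) (mulQ q μ₀) (qQinv q μ₀) 1 1 ∧
        IsSeriesI2 ρ ⊤ (mulQ q μ₀) (qQinv q μ₀) 1 1 ∧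
        (∀ x, closure (ρ₀.graph x) = closure (ρ.graph x)) ∧
        π.UnitarilyEquivalent ρ₀ :=
  ⟨isUqInvariant_haar q μ₀, isPositive_haar q μ₀, heisenbergRep q hq μ₀,
    isHeisenbergRep_heisenbergRep q hq μ₀,
    seriesRep (mulHom q μ₀) (lam_ne hq) (boundedL2 q μ₀)
      (fun f _ => mulOp_mem_boundedL2 q μ₀ f) (dense_boundedL2 q μ₀),
    -- Taking all of K as the space of entries gives the larger representation ρ.
    seriesRep (mulHom q μ₀) (lam_ne hq) ⊤ (fun _ _ _ => trivial) (by simp),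
    isSeriesI2_seriesRep q hq μ₀ _ _ _ _, isSeriesI2_seriesRep q hq μ₀ _ _ _ _,
    fun x => closure_graph_seriesRep_eq _ _ _ _ x _ _,
    unitarilyEquivalent_heisenbergRep q hq μ₀⟩
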